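/- Let $\lambda,\mu,\alpha,\beta>0$ and let $X$ be the continuous-time birth–death process on $\mathbb Z$ with birth rates $\lambda_n=\lambda$ $(n\ge0)$, $\lambda_n=\beta$ $(n<0)$ and death rates $\mu_n=\mu$ $(n\ge 0)$, $\mu_n=\alpha$ $(n<0)$; $P_{ij}(t)=\mathbb P(X_t=j\mid X_0=i)$. Let $\pi_0=1$, $\pi_n=\frac{\lambda_0\cdots\lambda_{n-1}}{\mu_1\cdots\mu_n}$, $\pi_{-n}=\frac{\mu_0\cdots\mu_{-n+1}}{\lambda_{-1}\cdots\lambda_{-n}}$ $(n\ge1)$, and let the polynomials $(Q^k_n)_{n\in\mathbb Z}$, $k=1,2$, be given by $Q_0^1=1,\ Q_{-1}^1=0,\ Q_0^2=0,\ Q_{-1}^2=1$ and $-xQ_n^k=\lambda_nQ_{n+1}^k-(\lambda_n+\mu_n)Q_n^k+\mu_nQ_{n-1}^k$, $n\in\mathbb Z$. A spectral matrix of $X$ is a symmetric matrix $\Psi=(\psi_{kl})_{k,l=1,2}$ of finite signed Borel measures on $\mathbb R$, supported on $[0,\infty)$ and positive semidefinite on every Borel set, with $$P_{ij}(t)=\pi_j\sum_{k,l=1}^2\int_0^\infty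 e^{-xt}Q_i^k(x)Q_j^l(x)\,d\psi_{kl}(x)\quad(i,j\in\mathbb Z,\ t\ge0)$$ (all integrals being absolutely convergent). Put $\Sigma_\pm^{a,b}(x)=\sqrt{\pm[(a+b-x)^2-4ab]}$ (wherever the radicand is nonnegative), $\sigma_\pm=(\sqrt\lambda\pm\sqrt\mu)^2$, $\tau_\pm=(\sqrt\alpha\pm\sqrt\beta)^2$, $\kappa=\alpha\lambda-\beta\mu$, $$D(x)=4\mu x\,[(\lambda-\mu+\alpha-\beta)\kappa-(\lambda-\beta)(\alpha-\mu)x],$$ and let $p,q,r,s$ be the symmetric $2\times2$ matrices with entries, writing $R(x)=-x^2+(\alpha+\beta+\lambda+\mu)x+(\lambda-\mu)(\alpha-\beta)$, - $p_{11}=((\mu-\alpha)x+\kappa)R(x)$, $\;p_{22}=((\beta-\lambda)x+\kappa)R(x)$, $\;p_{12}=(\alpha\lambda-2\alpha\beta-2\lambda\mu+3\beta\mu)x^2-(\alpha-3\beta+\lambda-3\mu)\kappa x+(\lambda-\mu)(\alpha-\beta)\kappa$; - $q_{11}=(\alpha-\mu)x^2+(-\alpha^2-\alpha\beta-\alpha\lambda+\alpha\mu+2\beta\mu)x-(\alpha-\beta)\kappa$,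 $\;q_{12}=(\alpha\lambda+\beta\mu-2\alpha\beta)x-(\alpha-\beta)\kappa$, $\;q_{22}=(\beta-\lambda)x^2+(-\alpha\beta+2\alpha\lambda-\beta^2+\beta\lambda-\beta\mu)x-(\alpha-\beta)\kappa$; - $r_{11}=(\mu-\alpha)x^2+(2\alpha\lambda+\alpha\mu-\beta\mu-\lambda\mu-\mu^2)x-(\lambda-\mu)\kappa$, $\;r_{12}=(\alpha\lambda+\beta\mu-2\lambda\mu)x-(\lambda-\mu)\kappa$, $\;r_{22}=(\lambda-\beta)x^2+(-\alpha\lambda+\beta\lambda+2\beta\mu-\lambda^2-\lambda\mu)x-(\lambda-\mu)\kappa$; - $s_{11}=(\mu-\alpha)x+\kappa$, $\;s_{12}=\kappa$, $\;s_{22}=(\beta-\lambda)x+\kappa$. Define the matrix functions $S^{\pm}=-\frac{\Sigma_-^{\lambda,\mu}}{\pi D}(q\pm\Sigma_+^{\alpha,\beta}s)$, $\;T^{\pm}=-\frac{\Sigma_-^{\alpha,\beta}}{\pi D}(r\pm\Sigma_+^{\lambda,\mu}s)$, $\;M=-\frac1{\pi D}(\Sigma_-^{\lambda,\mu}q+\Sigma_-^{\alpha,\beta}r)$.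 Then the following hold. **(i) Polynomials.** The recurrence has exactly one solution, and for $n\in\mathbb N_0$, with $U_n$ the Chebyshev polynomials of the second kind ($U_{-1}=0$), $$Q_n^1=\left(\tfrac\mu\lambda\right)^{n/2}U_n\!\left(\tfrac{\lambda+\mu-x}{2\sqrt{\lambda\mu}}\right),\quad Q_{-n-1}^1=-\left(\tfrac\beta\alpha\right)^{(n+1)/2}U_{n-1}\!\left(\tfrac{\alpha+\beta-x}{2\sqrt{\alpha\beta}}\right),$$ $$Q_n^2=-\left(\tfrac\mu\lambda\right)^{(n+1)/2}U_{n-1}\!\left(\tfrac{\lambda+\mu-x}{2\sqrt{\lambda\mu}}\right),\quad Q_{-n-1}^2=\left(\tfrac\beta\alpha\right)^{n/2}U_{n}\!\left(\tfrac{\alpha+\beta-x}{2\sqrt{\alpha\beta}}\right).$$ **(ii) Spectral matrix.** $X$ has exactly one spectral matrix, $\Psi=\Psi_c+\Psi_d$. Suppose first that $(\alpha,\beta)\ne(\mu,\lambda)$. Then $\Psi_c$ is absolutely continuous with integrable density, zero off the listed intervals, equal to 1. (a) if $[\sigma_-,\sigma_+]\cap[\tau_-,\tau_+]=\emptyset$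 and $\sigma_-<\tau_-$: $S^+$ on $[\sigma_-,\sigma_+]$, $T^-$ on $[\tau_-,\tau_+]$; (b) if $[\sigma_-,\sigma_+]\cap[\tau_-,\tau_+]=\emptyset$ and $\tau_-<\sigma_-$: $T^+$ on $[\tau_-,\tau_+]$, $S^-$ on $[\sigma_-,\sigma_+]$; 2. (a) if $[\tau_-,\tau_+]\subseteq[\sigma_-,\sigma_+]$: $S^+$ on $[\sigma_-,\tau_-]$, $M$ on $[\tau_-,\tau_+]$, $S^-$ on $[\tau_+,\sigma_+]$; (b) if $[\sigma_-,\sigma_+]\subseteq[\tau_-,\tau_+]$: $T^+$ on $[\tau_-,\sigma_-]$, $M$ on $[\sigma_-,\sigma_+]$, $T^-$ on $[\sigma_+,\tau_+]$; 3. (a) if $\sigma_-<\tau_-\le\sigma_+<\tau_+$: $S^+$ on $[\sigma_-,\tau_-]$, $M$ on $[\tau_-,\sigma_+]$, $T^-$ on $[\sigma_+,\tau_+]$; (b) if $\tau_-<\sigma_-\le\tau_+<\sigma_+$: $T^+$ on $[\tau_-,\sigma_-]$, $M$ on $[\sigma_-,\tau_+]$, $S^-$ on $[\tau_+,\sigma_+]$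 (values at the finitely many zeros of $D$ and common endpoints are irrelevant). If $(\alpha,\beta)=(\mu,\lambda)$, the density of $\Psi_c$ is $\frac1{\pi\sqrt{(x-\sigma_-)(\sigma_+-x)}}\begin{pmatrix}1&\frac{\lambda+\mu-x}{2\mu}\\ \frac{\lambda+\mu-x}{2\mu}&\frac\lambda\mu\end{pmatrix}$ on $[\sigma_-,\sigma_+]$. With $\zeta=\frac{(\alpha-\beta+\lambda-\mu)\kappa}{(\lambda-\beta)(\alpha-\mu)}$, $C_1=\lambda(\alpha-\mu)^2-\mu(\beta-\lambda)^2$, $C_2=\beta(\alpha-\mu)^2-\alpha(\beta-\lambda)^2$, the discrete part is in all cases $$\Psi_d=\frac{(\beta-\alpha)(\mu-\lambda)}{\mu(\beta-\alpha+\mu-\lambda)}\begin{pmatrix}1&1\\1&1\end{pmatrix}\delta_0\,\mathbf 1_{\{\mu>\lambda,\,\beta>\alpha\}}-\frac{C_1C_2}{\mu(\alpha-\mu)(\beta-\lambda)(\alpha-\beta+\lambda-\mu)}\begin{pmatrix}\frac1{(\beta-\lambda)^2}&\frac1{(\alpha-\mu)(\beta-\lambda)}\\ \frac1{(\alpha-\mu)(\beta-\lambda)}&\frac1{(\alpha-\mu)^2}\end{pmatrix}\delta_\zeta\,\mathbf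 1_{A_1\cup A_2\cup A_3},$$ where $A_1=\{\alpha>\mu,\beta>\lambda,C_1<0,C_2>0\}$, $A_2=\{\alpha<\mu,\beta>\lambda,C_1<0,C_2>0\}$, $A_3=\{\alpha<\mu,\beta<\lambda,C_1<0,C_2>0\}$ (a term is absent when its indicator vanishes). Moreover $A_1\cup A_2\cup A_3=B\cap(D_1\cup D_2)$ with $B=\{\alpha\ne\mu,\ \sqrt{\lambda/\mu}<|\frac{\beta-\lambda}{\alpha-\mu}|<\sqrt{\beta/\alpha}\}$, $D_1=\{\beta>\lambda\}$, $D_2=\{\alpha<\mu,\beta<\lambda\}$. **(iii) Stieltjes transforms.** For real $z<0$, $B(z;\psi_{kl})=\int\frac{d\psi_{kl}(x)}{x-z}$ converges absolutely and, with $\Sigma=\Sigma_+^{\lambda,\mu}(z)$, $\mathrm T=\Sigma_+^{\alpha,\beta}(z)$ and $E=\beta\Sigma+\lambda \mathrm T+(\beta-\lambda)z+\kappa$, $$B(z;\psi_{11})=\frac{2\alpha}{\alpha\Sigma+\mu \mathrm T+(\mu-\alpha)z+\kappa},\quad B(z;\psi_{12})=\frac\beta\mu\cdot\frac{\lambda+\mu-z-\Sigma}{E},\quad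 B(z;\psi_{22})=\frac\beta\mu\cdot\frac{2\lambda}{E};$$ if $D(z)\neq0$, then also $B(z;\psi_{kl})=\dfrac{p_{kl}(z)+q_{kl}(z)\Sigma+r_{kl}(z)\mathrm T+s_{kl}(z)\Sigma \mathrm T}{D(z)}$. **(iv) Classification.** If $\lambda>\mu$ or $\alpha>\beta$, then $\int_0^\infty x^{-1}d\psi_{11}(x)<\infty$ and $\int_0^\infty x^{-1}d\psi_{22}(x)<\infty$; if $\lambda\le\mu$ and $\alpha\le\beta$, both integrals are infinite. The process is transient if and only if $\lambda>\mu$ or $\alpha>\beta$; it is recurrent if and only if $\lambda\le\mu$ and $\alpha\le\beta$; it is positive recurrent if and only if $\lambda<\mu$ and $\alpha<\beta$; it is null recurrent if and only if $\lambda\le\mu$, $\alpha\le\beta$ and at least one of these is an equality. (A state is recurrent if the process started there, after leaving it, returns with probability one, and positive or null recurrent if moreover the mean return time is finite or infinite; it is transient otherwise. Each statement holds for all states simultaneously.) **(v) Invariant distribution.** $\pi_n=(\lambda/\mu)^n$ for $n\ge0$ and $\pi_{-n}=\frac\mu\beta\left(\frac\alpha\beta\right)^{n-1}$ for $n\ge1$.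 If $\mu>\lambda$ and $\beta>\alpha$, the process has exactly one invariant probability distribution, namely $n\mapsto\frac{(\beta-\alpha)(\mu-\lambda)}{\mu(\beta-\alpha+\mu-\lambda)}\,\pi_n$. -/

import Mathlib

open MeasureTheory ProbabilityTheory Polynomial
open scoped ENNReal

noncomputable section

namespace BilateralBD

/-! ### Birth-death processes on the integers

Throughout, `b n` is the birth rate and `d n` the death rate in the state `n : ℤ`. -/

/-- The source of randomness: for every jump, a uniform variable that selects the direction and a
standard exponential variable that drives the holding time. -/
abbrev Noise : Type := ℕ → unitInterval × ℝ

/-- All the driving variables are independent, uniform on `[0, 1]` and exponential of rate `1`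
respectively. -/
def noiseLaw : Measure Noise :=
  Measure.infinitePi fun _ : ℕ => (volume : Measure unitInterval).prod (expMeasure 1)

/-- The embedded jump chain started at `i`: from `k` it moves to `k + 1` with probability
`b k / (b k + d k)` and to `k - 1` otherwise. -/
def jumpChain (b d : ℤ → ℝ) (i : ℤ) (ω : Noise) : ℕ → ℤ
  | 0 => i
  | n + 1 =>
    if ((ω n).1 : ℝ) <
        b (jumpChain b d i ω n) / (b (jumpChain b d i ω n) + d (jumpChain b d i ω n))
    then jumpChain b d i ω n + 1
    else jumpChain b d i ω n - 1

/-- The time of the `n`-th jump: the holding time in the state `k` is exponential of rate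
`b k + d k`. -/
def jumpTime (b d : ℤ → ℝ) (i : ℤ) (ω : Noise) (n : ℕ) : ℝ :=
  ∑ m ∈ Finset.range n,
    (ω m).2 / (b (jumpChain b d i ω m) + d (jumpChain b d i ω m))

/-- The event `X_t = j` for the continuous-time birth-death process `X` started at `i`. -/
def stateAt (b d : ℤ → ℝ) (i : ℤ) (t : ℝ) (j : ℤ) : Set Noise :=
  {ω | ∃ n : ℕ, jumpTime b d i ω n ≤ t ∧ t < jumpTime b d i ω (n + 1) ∧
    jumpChain b d i ω n = j}

/-- The transition probability function `P_{ij}(t) = ℙ(X_t = j | X_0 = i)`. -/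
def transProb (b d : ℤ → ℝ) (i j : ℤ) (t : ℝ) : ℝ :=
  noiseLaw.real (stateAt b d i t j)

/-- The first time at which the process started at `i` is again in `i` after having left it
(`⊤` if this never happens). -/
def returnTime (b d : ℤ → ℝ) (i : ℤ) (ω : Noise) : ℝ≥0∞ :=
  ⨅ (n : ℕ) (_ : 1 ≤ n ∧ jumpChain b d i ω n = i), ENNReal.ofReal (jumpTime b d i ω n)

/-- Every state is recurrent: the process returns with probability one. -/
def IsRecurrent (b d : ℤ → ℝ) : Prop :=
  ∀ i, noiseLaw {ω | returnTime b d i ω < ⊤} = 1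

/-- Every state is transient: the process returns with probability less than one. -/
def IsTransient (b d : ℤ → ℝ) : Prop :=
  ∀ i, noiseLaw {ω | returnTime b d i ω < ⊤} < 1

/-- Every state is recurrent, with finite mean return time. -/
def IsPositiveRecurrent (b d : ℤ → ℝ) : Prop :=
  IsRecurrent b d ∧ ∀ i, ∫⁻ ω, returnTime b d i ω ∂noiseLaw < ⊤

/-- Every state is recurrent, with infinite mean return time. -/
def IsNullRecurrent (b d : ℤ → ℝ) : Prop :=
  IsRecurrent b d ∧ ∀ i, ∫⁻ ω, returnTime b d i ω ∂noiseLaw = ⊤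

/-- `p` is an invariant probability distribution of the process: `p P(t) = p` for all `t ≥ 0`. -/
def IsInvariantDistribution (b d : ℤ → ℝ) (p : ℤ → ℝ) : Prop :=
  (∀ n, 0 ≤ p n) ∧ HasSum p 1 ∧
    ∀ t : ℝ, 0 ≤ t → ∀ j, HasSum (fun i => p i * transProb b d i j t) (p j)

/-- The potential coefficients: `π_0 = 1`, `π_n = (b_0 ⋯ b_{n-1}) / (d_1 ⋯ d_n)` and
`π_{-n} = (d_0 ⋯ d_{-n+1}) / (b_{-1} ⋯ b_{-n})` for `n ≥ 1`. -/
def potential (b d : ℤ → ℝ) : ℤ → ℝ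
  | Int.ofNat n => ∏ m ∈ Finset.range n, b (m : ℤ) / d ((m : ℤ) + 1)
  | Int.negSucc n => ∏ m ∈ Finset.range (n + 1), d (-(m : ℤ)) / b (-(m : ℤ) - 1)

/-- The two families of polynomials `Q 0 = (Q_n^1)` and `Q 1 = (Q_n^2)` generated by the three-term
recurrence relation attached to the rates. -/
structure IsGeneratedFamily (b d : ℤ → ℝ) (Q : Fin 2 → ℤ → ℝ[X]) : Prop where
  first_zero : Q 0 0 = 1
  first_neg_one : Q 0 (-1) = 0
  second_zero : Q 1 0 = 0
  second_neg_one : Q 1 (-1) = 1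
  recurrence : ∀ k n,
    -(X * Q k n) = C (b n) * Q k (n + 1) - C (b n + d n) * Q k n + C (d n) * Q k (n - 1)

/-- `Ψ` is a spectral matrix of the process: a positive semidefinite symmetric `2 × 2` matrix of
finite signed measures supported on `[0, ∞)` such that the Karlin-McGregor formula holds. -/
structure IsSpectralMatrix (b d : ℤ → ℝ) (Q : Fin 2 → ℤ → ℝ[X])
    (Ψ : Fin 2 → Fin 2 → SignedMeasure ℝ) : Prop where
  posSemidef : ∀ E : Set ℝ, MeasurableSet E →
    (Matrix.of fun k l => Ψ k l E : Matrix (Fin 2) (Fin 2) ℝ).PosSemidef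
  support : ∀ k l, ∀ E : Set ℝ, MeasurableSet E → E ⊆ Set.Iio 0 → Ψ k l E = 0
  integrable : ∀ i j : ℤ, ∀ t : ℝ, 0 ≤ t → ∀ k l,
    (Ψ k l).Integrable fun x => Real.exp (-x * t) * ((Q k i).eval x * (Q l j).eval x)
  karlinMcGregor : ∀ i j : ℤ, ∀ t : ℝ, 0 ≤ t →
    transProb b d i j t = potential b d j *
      ∑ k, ∑ l, ∫ᵛ x, Real.exp (-x * t) * ((Q k i).eval x * (Q l j).eval x) ∂•(Ψ k l)

/-! ### Splitting into two M/M/1 queues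

Rates `lam`, `mu` on the nonnegative integers and `be`, `al` on the negative integers. -/

/-- Birth rates: `lam` on `n ≥ 0`, `be` on `n < 0`. -/
def birth (lam be : ℝ) (n : ℤ) : ℝ := if 0 ≤ n then lam else be

/-- Death rates: `mu` on `n ≥ 0`, `al` on `n < 0`. -/
def death (mu al : ℝ) (n : ℤ) : ℝ := if 0 ≤ n then mu else al

/-- `Σ_+^{u,v}(x)`. -/
def rootPlus (u v x : ℝ) : ℝ := √((u + v - x) ^ 2 - 4 * u * v)

/-- `Σ_-^{u,v}(x)`. -/
def rootMinus (u v x : ℝ) : ℝ := √(-((u + v - x) ^ 2 - 4 * u * v))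

/-- `(√u - √v)²`. -/
def edgeMinus (u v : ℝ) : ℝ := (√u - √v) ^ 2

/-- `(√u + √v)²`. -/
def edgePlus (u v : ℝ) : ℝ := (√u + √v) ^ 2

/-- The denominator polynomial. -/
def denom (lam mu al be x : ℝ) : ℝ :=
  4 * mu * x *
    ((lam - mu + al - be) * (al * lam - be * mu) - (lam - be) * (al - mu) * x)

/-- The coefficients `p_{kl}`. -/
def pMat (lam mu al be x : ℝ) : Matrix (Fin 2) (Fin 2) ℝ :=
  let p₁₁ := ((mu - al) * x + al * lam - be * mu) *
    (-x ^ 2 + (al + be + lam + mu) * x + (lam - mu) * (al - be))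
  let p₁₂ := (al * lam - 2 * al * be - 2 * lam * mu + 3 * be * mu) * x ^ 2
    - (al - 3 * be + lam - 3 * mu) * (al * lam - be * mu) * x
    + (lam - mu) * (al - be) * (al * lam - be * mu)
  let p₂₂ := ((be - lam) * x + al * lam - be * mu) *
    (-x ^ 2 + (al + be + lam + mu) * x + (lam - mu) * (al - be))
  !![p₁₁, p₁₂; p₁₂, p₂₂]

/-- The coefficients `q_{kl}`. -/
def qMat (lam mu al be x : ℝ) : Matrix (Fin 2) (Fin 2) ℝ :=
  let q₁₁ := (al - mu) * x ^ 2
    + (-al ^ 2 - al * be - al * lam + al * mu + 2 * be * mu) * x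
    - (al - be) * (al * lam - be * mu)
  let q₁₂ := (al * lam + be * mu - 2 * al * be) * x - (al - be) * (al * lam - be * mu)
  let q₂₂ := (be - lam) * x ^ 2
    + (-(al * be) + 2 * al * lam - be ^ 2 + be * lam - be * mu) * x
    - (al - be) * (al * lam - be * mu)
  !![q₁₁, q₁₂; q₁₂, q₂₂]

/-- The coefficients `r_{kl}`. -/
def rMat (lam mu al be x : ℝ) : Matrix (Fin 2) (Fin 2) ℝ :=
  let r₁₁ := (mu - al) * x ^ 2
    + (2 * al * lam + al * mu - be * mu - lam * mu - mu ^ 2) * x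
    - (lam - mu) * (al * lam - be * mu)
  let r₁₂ := (al * lam + be * mu - 2 * lam * mu) * x - (lam - mu) * (al * lam - be * mu)
  let r₂₂ := (lam - be) * x ^ 2
    + (-(al * lam) + be * lam + 2 * be * mu - lam ^ 2 - lam * mu) * x
    - (lam - mu) * (al * lam - be * mu)
  !![r₁₁, r₁₂; r₁₂, r₂₂]

/-- The coefficients `s_{kl}`. -/
def sMat (lam mu al be x : ℝ) : Matrix (Fin 2) (Fin 2) ℝ :=
  let s₁₁ := (mu - al) * x + al * lam - be * mu
  let s₁₂ := al * lam - be * mu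
  let s₂₂ := (be - lam) * x + al * lam - be * mu
  !![s₁₁, s₁₂; s₁₂, s₂₂]

/-- The density where only `Σ_+^{lam,mu}` is imaginary; `ε = ±1` is the sign in front of
`Σ_+^{al,be}`. -/
def sigmaDensity (lam mu al be ε x : ℝ) : Matrix (Fin 2) (Fin 2) ℝ :=
  -(rootMinus lam mu x / (Real.pi * denom lam mu al be x)) •
    (qMat lam mu al be x + (ε * rootPlus al be x) • sMat lam mu al be x)

/-- The density where only `Σ_+^{al,be}` is imaginary; `ε = ±1` is the sign in front of
`Σ_+^{lam,mu}`. -/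
def tauDensity (lam mu al be ε x : ℝ) : Matrix (Fin 2) (Fin 2) ℝ :=
  -(rootMinus al be x / (Real.pi * denom lam mu al be x)) •
    (rMat lam mu al be x + (ε * rootPlus lam mu x) • sMat lam mu al be x)

/-- The density where both square roots are imaginary. -/
def bothDensity (lam mu al be x : ℝ) : Matrix (Fin 2) (Fin 2) ℝ :=
  -(1 / (Real.pi * denom lam mu al be x)) •
    (rootMinus lam mu x • qMat lam mu al be x + rootMinus al be x • rMat lam mu al be x)

/-- The nonzero root of the denominator polynomial. -/
def zeta (lam mu al be : ℝ) : ℝ :=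
  ((al - be + lam - mu) * (al * lam - be * mu)) / ((lam - be) * (al - mu))

/-- The constant `C_1`. -/
def constOne (lam mu al be : ℝ) : ℝ := lam * (al - mu) ^ 2 - mu * (be - lam) ^ 2

/-- The constant `C_2`. -/
def constTwo (lam mu al be : ℝ) : ℝ := be * (al - mu) ^ 2 - al * (be - lam) ^ 2

/-- The condition `A_1 ∪ A_2 ∪ A_3` for the presence of an atom at `zeta`. -/
def ZetaCondition (lam mu al be : ℝ) : Prop :=
  (mu < al ∧ lam < be ∧ constOne lam mu al be < 0 ∧ 0 < constTwo lam mu al be) ∨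
  (al < mu ∧ lam < be ∧ constOne lam mu al be < 0 ∧ 0 < constTwo lam mu al be) ∨
  (al < mu ∧ be < lam ∧ constOne lam mu al be < 0 ∧ 0 < constTwo lam mu al be)

/-- The mass at `0`, without the indicator; it also normalises the invariant distribution. -/
def zeroMass (lam mu al be : ℝ) : ℝ :=
  ((be - al) * (mu - lam)) / (mu * (be - al + mu - lam))

/-- The matrix of masses at `zeta`, without the indicator. -/
def zetaMass (lam mu al be : ℝ) : Matrix (Fin 2) (Fin 2) ℝ :=
  -((constOne lam mu al be * constTwo lam mu al be) /
      (mu * (al - mu) * (be - lam) * (al - be + lam - mu))) •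
    !![1 / (be - lam) ^ 2, 1 / ((al - mu) * (be - lam));
       1 / ((al - mu) * (be - lam)), 1 / (al - mu) ^ 2]

open Classical in
/-- The discrete part of the spectral matrix. -/
def discretePart (lam mu al be : ℝ) (k l : Fin 2) : SignedMeasure ℝ :=
  (if lam < mu ∧ al < be then VectorMeasure.dirac 0 (zeroMass lam mu al be) else 0) +
  (if ZetaCondition lam mu al be then
    VectorMeasure.dirac (zeta lam mu al be) (zetaMass lam mu al be k l) else 0)

/-- The process with these rates has exactly one spectral matrix: its absolutely continuous part
has the (integrable) density `w`, and its discrete part is `discretePart`. -/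
def HasSpectralMatrix (lam mu al be : ℝ) (Q : Fin 2 → ℤ → ℝ[X])
    (w : ℝ → Matrix (Fin 2) (Fin 2) ℝ) : Prop :=
  (∀ k l, Integrable fun x => w x k l) ∧
  ∀ Ψ : Fin 2 → Fin 2 → SignedMeasure ℝ,
    IsSpectralMatrix (birth lam be) (death mu al) Q Ψ ↔
      Ψ = fun k l => (volume.withDensityᵥ fun x => w x k l) + discretePart lam mu al be k l

end BilateralBD

end

noncomputable section
namespace BilateralBD
open Filter Topology

/-! ### Probabilistic part: the first-step decomposition -/

/-! Conjugation by √π makes the generator symmetric on ℓ²(ℤ). The rates are bounded, so its negative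
J is a bounded self-adjoint operator, and J = D*D for a first-order difference operator D, so its
spectrum lies in [0, ∞). The vectors f_i = π_i^{-1/2} e_i satisfy J f_j = (b_j + d_j) f_j - b_j
f_{j+1} - d_j f_{j-1}. This is the recurrence of the polynomials, whence f_i = Q_i^1(J) f_0 +
Q_i^2(J) f_{-1} (`JacobiModel.vec_eq_sum`). It is also the backward equation, whence P_ij(t) = π_j
⟨f_i, e^{-tJ} f_j⟩ (`JacobiModel.transProb_eq_spectralProb`): conditioning on the first jump shows
that the constructed process solves the backward integral equation (`stateIn_backward`), and
solutions with geometric growth in the state are unique (`backward_unique`). So the polarised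
spectral measures of f_0 and f_{-1} form a spectral matrix. It is the only one, because for i, j in
{0, -1} the formula prescribes the Laplace transform of every entry.

To compute it, solve the resolvent equation. On the right half-line the solution is a multiple of
w^n, on the left half-line of v^n, where w and v are the square-summable roots of λw² - (λ+μ-z)w + μ
= 0 and αv² - (α+β-z)v + β = 0. Matching at 0 and -1 gives the transform (x²w + 2xy vw + y²v) / (μ(1
- vw)) of the spectral measure of x f_0 + y f_{-1} (`stieltjes_quadratic`). The roots extend
continuously to the closed upper half-plane, so Stieltjes inversion
(`restrict_compl_eq_withDensity`) yields the density away from the solutions of vw = 1. These are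
real, and for state-dependent rates they can only be 0 and ζ; the atoms there are limits of -iε
times the transform (`mass_eq`). Rationalising the denominator modulo the two quadratic equations
produces the coefficients p, q, r, s and D (`transform_rational`), and the boundary values of the
square roots produce the different regimes. Letting z increase to 0 in the transform gives the
moments of order -1.

The classification does not use the spectrum. Hitting probabilities and mean hitting times satisfy
first-step equations whose increments obey a one-step recursion on each half-line, so bounded,
superharmonic or nonnegative solutions can be analysed explicitly. For an invariant distribution,
differentiating pP(t) = p at 0 shows that the net flux across each edge is constant; summability
forces it to vanish, and detailed balance leaves only multiples of π. -/

instance isProbabilityMeasure_expOne : IsProbabilityMeasure (expMeasure 1) :=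
  isProbabilityMeasure_expMeasure one_pos

instance isProbabilityMeasure_noiseLaw : IsProbabilityMeasure noiseLaw := by
  unfold noiseLaw; infer_instance

/-- Put one more pair of driving variables in front of a noise sequence. -/
def noiseCons (p : unitInterval × ℝ) (ω : Noise) : Noise
  | 0 => p
  | n + 1 => ω n

lemma measurable_noiseCons :
    Measurable fun x : (unitInterval × ℝ) × Noise => noiseCons x.1 x.2 := by
  refine measurable_pi_lambda _ fun n => ?_
  cases n with
  | zero => exact measurable_fst
  | succ n => exact (measurable_pi_apply n).comp measurable_snd

/-- A product measure is determined by cylinders, and a cylinder pulled back along `noiseCons`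
splits into a condition on coordinate 0 and a cylinder for the shifted sequence. This is the renewal
structure behind every first-step argument below. -/
lemma map_noiseCons :
    (((volume : Measure unitInterval).prod (expMeasure 1)).prod noiseLaw).map
      (fun x : (unitInterval × ℝ) × Noise => noiseCons x.1 x.2) = noiseLaw := by
  refine Measure.eq_infinitePi _ fun s t ht => ?_
  classical
  rw [Measure.map_apply measurable_noiseCons
    (MeasurableSet.pi s.countable_toSet fun i _ => ht i)]
  set s' : Finset ℕ := s.preimage Nat.succ (Nat.succ_injective.injOn)
  set t0 : Set (unitInterval × ℝ) := if 0 ∈ s then t 0 else Set.univ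
  have h1 : (fun x : (unitInterval × ℝ) × Noise => noiseCons x.1 x.2) ⁻¹' (Set.pi s t) =
      t0 ×ˢ (Set.pi s' fun n => t (n + 1)) := by
    ext ⟨p, ω⟩
    simp only [Set.mem_preimage, Set.mem_pi, Set.mem_prod, t0, s', Finset.mem_coe,
      Finset.mem_preimage]
    constructor
    · intro h
      refine ⟨?_, fun n hn => h (n + 1) hn⟩
      split_ifs with h0
      · exact h 0 h0
      · trivial
    · rintro ⟨h0, h⟩ n hn
      cases n with
      | zero => simpa [hn, noiseCons] using h0
      | succ n => exact h n hn
  rw [h1, Measure.prod_prod, noiseLaw, Measure.infinitePi_pi _ fun i _ => ht (i + 1)]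
  have h2 : ∏ i ∈ s', ((volume : Measure unitInterval).prod (expMeasure 1)) (t (i + 1)) =
      ∏ i ∈ s.erase 0, ((volume : Measure unitInterval).prod (expMeasure 1)) (t i) := by
    have : s.erase 0 = s'.map ⟨Nat.succ, Nat.succ_injective⟩ := by
      ext n
      cases n <;> simp [s']
    rw [this, Finset.prod_map]; rfl
  rw [h2]
  by_cases h0 : 0 ∈ s
  · simp only [t0, h0, if_true]
    exact Finset.mul_prod_erase s
      (fun i => ((volume : Measure unitInterval).prod (expMeasure 1)) (t i)) h0
  · simp [t0, h0]

lemma lintegral_noise {F : Noise → ℝ≥0∞} (hF : Measurable F) :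
    ∫⁻ ω, F ω ∂noiseLaw =
      ∫⁻ p, ∫⁻ ω, F (noiseCons p ω) ∂noiseLaw
        ∂((volume : Measure unitInterval).prod (expMeasure 1)) := by
  conv_lhs => rw [← map_noiseCons]
  rw [lintegral_map hF measurable_noiseCons, lintegral_prod]
  exact (hF.comp measurable_noiseCons).aemeasurable

lemma expMeasure_one_Iio : expMeasure 1 (Set.Iio 0) = 0 := by
  have : expMeasure 1 = volume.withDensity (exponentialPDF 1) := rfl
  rw [this, withDensity_apply _ measurableSet_Iio]
  exact lintegral_exponentialPDF_of_nonpos le_rfl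

lemma ae_noise_nonneg : ∀ᵐ ω ∂noiseLaw, ∀ n, 0 ≤ (ω n).2 := by
  rw [ae_all_iff]
  intro n
  have h := (measurePreserving_eval_infinitePi
    (fun _ : ℕ => (volume : Measure unitInterval).prod (expMeasure 1)) n)
  have h2 : ∀ᵐ p ∂((volume : Measure unitInterval).prod (expMeasure 1)), 0 ≤ p.2 := by
    have h3 : ∀ᵐ x ∂(expMeasure 1), 0 ≤ x := by
      rw [ae_iff]; simpa [Set.Iio] using expMeasure_one_Iio
    exact Measure.quasiMeasurePreserving_snd.ae h3
  exact h.quasiMeasurePreserving.ae h2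

/-- The state after one jump from `i`. -/
def step (b d : ℤ → ℝ) (i : ℤ) (u : unitInterval) : ℤ :=
  if (u : ℝ) < b i / (b i + d i) then i + 1 else i - 1

lemma jumpChain_cons (b d : ℤ → ℝ) (i : ℤ) (p : unitInterval × ℝ) (ω : Noise) (n : ℕ) :
    jumpChain b d i (noiseCons p ω) (n + 1) = jumpChain b d (step b d i p.1) ω n := by
  induction n with
  | zero => rfl
  | succ n ih =>
    rw [jumpChain, ih]
    rfl

lemma jumpTime_cons (b d : ℤ → ℝ) (i : ℤ) (p : unitInterval × ℝ) (ω : Noise) (n : ℕ) :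
    jumpTime b d i (noiseCons p ω) (n + 1) =
      p.2 / (b i + d i) + jumpTime b d (step b d i p.1) ω n := by
  unfold jumpTime
  rw [Finset.sum_range_succ', add_comm]
  congr 1
  refine Finset.sum_congr rfl fun m _ => ?_
  rw [jumpChain_cons]
  rfl

lemma measurable_jumpChain (b d : ℤ → ℝ) (i : ℤ) (n : ℕ) :
    Measurable fun ω => jumpChain b d i ω n := by
  induction n with
  | zero => exact measurable_const
  | succ n ih =>
    refine Measurable.ite (measurableSet_lt (by fun_prop) ?_) ?_ ?_
    · exact (Measurable.of_discrete (f := fun k : ℤ => b k / (b k + d k))).comp ih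
    · exact (Measurable.of_discrete (f := fun k : ℤ => k + 1)).comp ih
    · exact (Measurable.of_discrete (f := fun k : ℤ => k - 1)).comp ih

lemma measurable_jumpTime (b d : ℤ → ℝ) (i : ℤ) (n : ℕ) :
    Measurable fun ω => jumpTime b d i ω n := by
  refine Finset.measurable_fun_sum _ fun m _ => ?_
  refine Measurable.div (by fun_prop) ?_
  exact (Measurable.of_discrete (f := fun k : ℤ => b k + d k)).comp (measurable_jumpChain b d i m)

lemma jumpTime_nonneg {b d : ℤ → ℝ} (hb : ∀ n, 0 < b n) (hd : ∀ n, 0 < d n) (i : ℤ) {ω : Noise}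
    (hω : ∀ n, 0 ≤ (ω n).2) (n : ℕ) : 0 ≤ jumpTime b d i ω n :=
  Finset.sum_nonneg fun m _ => div_nonneg (hω m) (add_pos (hb _) (hd _)).le

lemma jumpTime_mono {b d : ℤ → ℝ} (hb : ∀ n, 0 < b n) (hd : ∀ n, 0 < d n) (i : ℤ) {ω : Noise}
    (hω : ∀ n, 0 ≤ (ω n).2) : Monotone (jumpTime b d i ω) := by
  refine monotone_nat_of_le_succ fun n => ?_
  unfold jumpTime
  rw [Finset.sum_range_succ]
  exact le_add_of_nonneg_right (div_nonneg (hω n) (add_pos (hb _) (hd _)).le)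

lemma volume_unitInterval_lt {c : ℝ} (h0 : 0 ≤ c) (h1 : c ≤ 1) :
    (volume : Measure unitInterval) {u | (u : ℝ) < c} = ENNReal.ofReal c :=
  unitInterval.volume_Iio ⟨c, h0, h1⟩

/-- The uniform variable chooses the direction independently of the exponential one, so the integral
splits over the events `u < b i / (b i + d i)` and its complement. -/
lemma lintegral_step {b d : ℤ → ℝ} (hb : ∀ n, 0 < b n) (hd : ∀ n, 0 < d n) (i : ℤ)
    {g : ℤ → ℝ → ℝ≥0∞} (hg : ∀ k, Measurable (g k)) :
    ∫⁻ p, g (step b d i p.1) p.2 ∂((volume : Measure unitInterval).prod (expMeasure 1)) =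
      ENNReal.ofReal (b i / (b i + d i)) * ∫⁻ x, g (i + 1) x ∂(expMeasure 1) +
      ENNReal.ofReal (d i / (b i + d i)) * ∫⁻ x, g (i - 1) x ∂(expMeasure 1) := by
  have hq : 0 < b i + d i := add_pos (hb i) (hd i)
  have hstep : Measurable fun u => step b d i u :=
    Measurable.ite (measurableSet_lt (by fun_prop) measurable_const) measurable_const
      measurable_const
  have hm : Measurable fun p : unitInterval × ℝ => g (step b d i p.1) p.2 := by
    have : Measurable (Function.uncurry g) := measurable_from_prod_countable_right hg
    exact this.comp ((hstep.comp measurable_fst).prodMk measurable_snd)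
  rw [lintegral_prod _ hm.aemeasurable]
  set c := b i / (b i + d i) with hc
  have h0 : 0 ≤ c := div_nonneg (hb i).le hq.le
  have h1 : c ≤ 1 := (div_le_one hq).2 (le_add_of_nonneg_right (hd i).le)
  have hd' : d i / (b i + d i) = 1 - c := by rw [hc]; field_simp; ring
  have hmeas : MeasurableSet {u : unitInterval | (u : ℝ) < c} :=
    measurableSet_lt (by fun_prop) measurable_const
  rw [← lintegral_add_compl _ hmeas]
  congr 1
  · rw [setLIntegral_congr_fun hmeas (g := fun _ => ∫⁻ x, g (i + 1) x ∂(expMeasure 1))]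
    · rw [setLIntegral_const, volume_unitInterval_lt h0 h1, mul_comm]
    · intro u hu
      have : step b d i u = i + 1 := if_pos hu
      simp [this]
  · rw [setLIntegral_congr_fun hmeas.compl (g := fun _ => ∫⁻ x, g (i - 1) x ∂(expMeasure 1))]
    · rw [setLIntegral_const, prob_compl_eq_one_sub hmeas, volume_unitInterval_lt h0 h1, mul_comm,
        hd', ENNReal.ofReal_sub _ h0, ENNReal.ofReal_one]
    · intro u hu
      have : step b d i u = i - 1 := if_neg hu
      simp [this]


/-! ### The backward integral equation -/

/-- The event that the process started at `i` is in the set `A` at time `t`. -/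
def stateIn (b d : ℤ → ℝ) (i : ℤ) (t : ℝ) (A : Set ℤ) : Set Noise :=
  {ω | ∃ n : ℕ, jumpTime b d i ω n ≤ t ∧ t < jumpTime b d i ω (n + 1) ∧ jumpChain b d i ω n ∈ A}

lemma measurableSet_stateIn_prod (b d : ℤ → ℝ) (i : ℤ) (A : Set ℤ) :
    MeasurableSet {x : ℝ × Noise | x.2 ∈ stateIn b d i x.1 A} := by
  have h : {x : ℝ × Noise | x.2 ∈ stateIn b d i x.1 A} =
      ⋃ n : ℕ, ({x : ℝ × Noise | jumpTime b d i x.2 n ≤ x.1} ∩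
        {x | x.1 < jumpTime b d i x.2 (n + 1)}) ∩ {x | jumpChain b d i x.2 n ∈ A} := by
    ext x
    simp only [stateIn, Set.mem_ofPred_eq, Set.mem_iUnion, Set.mem_inter_iff, and_assoc]
  rw [h]
  refine MeasurableSet.iUnion fun n => MeasurableSet.inter (MeasurableSet.inter ?_ ?_) ?_
  · exact measurableSet_le ((measurable_jumpTime b d i n).comp measurable_snd) measurable_fst
  · exact measurableSet_lt measurable_fst ((measurable_jumpTime b d i _).comp measurable_snd)
  · exact ((measurable_jumpChain b d i n).comp measurable_snd) (MeasurableSet.of_discrete (s := A))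

lemma measurableSet_stateIn (b d : ℤ → ℝ) (i : ℤ) (t : ℝ) (A : Set ℤ) :
    MeasurableSet (stateIn b d i t A) :=
  measurable_prodMk_left (measurableSet_stateIn_prod b d i A)

lemma measurable_stateIn (b d : ℤ → ℝ) (i : ℤ) (A : Set ℤ) :
    Measurable fun t => noiseLaw (stateIn b d i t A) :=
  measurable_measure_prodMk_left (measurableSet_stateIn_prod b d i A)

/-- Either the first holding time exceeds t, or the path restarts at the first jump with the
remaining time. Nonnegative holding times guarantee that if a later jump occurs by time t then so
does the first one. -/
lemma mem_stateIn_cons {b d : ℤ → ℝ} (hb : ∀ n, 0 < b n) (hd : ∀ n, 0 < d n) (i : ℤ)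
    {t : ℝ} (ht : 0 ≤ t) (A : Set ℤ) (p : unitInterval × ℝ) {ω : Noise}
    (hω : ∀ n, 0 ≤ (ω n).2) :
    noiseCons p ω ∈ stateIn b d i t A ↔ (t < p.2 / (b i + d i) ∧ i ∈ A) ∨
      (p.2 / (b i + d i) ≤ t ∧
        ω ∈ stateIn b d (step b d i p.1) (t - p.2 / (b i + d i)) A) := by
  constructor
  · rintro ⟨n, h1, h2, h3⟩
    cases n with
    | zero =>
      left
      rw [jumpTime_cons] at h2
      exact ⟨by simpa [jumpTime] using h2, h3⟩
    | succ n =>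
      right
      rw [jumpTime_cons] at h1 h2
      rw [jumpChain_cons] at h3
      have := jumpTime_nonneg hb hd (step b d i p.1) hω n
      exact ⟨by linarith, n, by linarith, by linarith, h3⟩
  · rintro (⟨h1, h2⟩ | ⟨h0, n, h1, h2, h3⟩)
    · refine ⟨0, by simpa [jumpTime] using ht, ?_, h2⟩
      rw [jumpTime_cons]
      simpa [jumpTime] using h1
    · refine ⟨n + 1, ?_, ?_, ?_⟩
      · rw [jumpTime_cons]; linarith
      · rw [jumpTime_cons]; linarith
      · rw [jumpChain_cons]; exact h3

lemma lintegral_expMeasure_one {f : ℝ → ℝ≥0∞} (hf : Measurable f) :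
    ∫⁻ x, f x ∂(expMeasure 1) = ∫⁻ x in Set.Ici 0, ENNReal.ofReal (Real.exp (-x)) * f x := by
  have h : expMeasure 1 = volume.withDensity (exponentialPDF 1) := rfl
  have hm : Measurable (exponentialPDF 1) :=
    (measurable_exponentialPDFReal 1).ennreal_ofReal
  rw [h, lintegral_withDensity_eq_lintegral_mul _ hm hf, ← lintegral_indicator measurableSet_Ici]
  refine lintegral_congr fun x => ?_
  simp only [Pi.mul_apply, exponentialPDF_eq, Set.indicator, Set.mem_Ici]
  split_ifs <;> simp

lemma lintegral_expMeasure_one_le {h : ℝ → ℝ} (h0 : ∀ x, 0 ≤ h x) (hm : Measurable h) {K : ℝ}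
    (hK : ∀ x, h x ≤ K) {T : ℝ} (hT : 0 ≤ T) :
    ∫⁻ x, (if x ≤ T then ENNReal.ofReal (h x) else 0) ∂(expMeasure 1) =
      ENNReal.ofReal (∫ x in (0 : ℝ)..T, Real.exp (-x) * h x) := by
  rw [lintegral_expMeasure_one
      (Measurable.ite measurableSet_Iic hm.ennreal_ofReal measurable_const),
    intervalIntegral.integral_of_le hT, ← integral_Icc_eq_integral_Ioc,
    ofReal_integral_eq_lintegral_ofReal]
  · rw [← lintegral_indicator measurableSet_Icc, ← lintegral_indicator measurableSet_Ici]
    refine lintegral_congr fun x => ?_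
    simp only [Set.indicator, Set.mem_Ici, Set.mem_Icc]
    by_cases h1 : 0 ≤ x <;> by_cases h2 : x ≤ T <;>
      simp [h1, h2, ENNReal.ofReal_mul (Real.exp_pos _).le]
  · refine Measure.integrableOn_of_bounded (M := K) measure_Icc_lt_top.ne (by fun_prop) ?_
    refine (ae_restrict_mem measurableSet_Icc).mono fun x hx => ?_
    rw [Real.norm_of_nonneg (mul_nonneg (Real.exp_pos _).le (h0 x))]
    calc Real.exp (-x) * h x ≤ 1 * h x := by
          gcongr
          · exact h0 x
          · exact Real.exp_le_one_iff.2 (by linarith [hx.1])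
      _ ≤ K := by linarith [hK x]
  · exact Filter.Eventually.of_forall fun x => mul_nonneg (Real.exp_pos _).le (h0 x)

lemma expMeasure_one_Ioi {T : ℝ} (hT : 0 ≤ T) :
    expMeasure 1 (Set.Ioi T) = ENNReal.ofReal (Real.exp (-T)) := by
  have h1 : expMeasure 1 (Set.Iic T) = ENNReal.ofReal (1 - Real.exp (-T)) := by
    have h : expMeasure 1 = volume.withDensity (exponentialPDF 1) := rfl
    rw [h, withDensity_apply _ measurableSet_Iic, lintegral_exponentialPDF_eq_antiDeriv one_pos]
    simp [hT]
  rw [← Set.compl_Iic, prob_compl_eq_one_sub measurableSet_Iic, h1, ← ENNReal.ofReal_one,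
    ← ENNReal.ofReal_sub _ (by simpa using hT)]
  simp

open Classical in
-- Condition on the first jump: no jump by time t contributes the exponential term, and a jump with
-- remaining time r contributes the integrand. The statement is for sets of states so that it also
-- applies to the whole of ℤ, where it yields non-explosion.
lemma stateIn_backward {b d : ℤ → ℝ} (hb : ∀ n, 0 < b n) (hd : ∀ n, 0 < d n) (i : ℤ)
    {t : ℝ} (ht : 0 ≤ t) (A : Set ℤ) :
    noiseLaw.real (stateIn b d i t A) =
      (if i ∈ A then 1 else 0) * Real.exp (-((b i + d i) * t)) +
      ∫ r in (0 : ℝ)..t, Real.exp (-((b i + d i) * (t - r))) *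
        (b i * noiseLaw.real (stateIn b d (i + 1) r A) +
          d i * noiseLaw.real (stateIn b d (i - 1) r A)) := by
  set q := b i + d i with hqdef
  have hq : 0 < q := add_pos (hb i) (hd i)
  set P : ℤ → ℝ → ℝ := fun k r => noiseLaw.real (stateIn b d k r A) with hP
  have hPm : ∀ k, Measurable (P k) := fun k => (measurable_stateIn b d k A).ennreal_toReal
  have hP0 : ∀ k r, 0 ≤ P k r := fun k r => measureReal_nonneg
  have hP1 : ∀ k r, P k r ≤ 1 := fun k r => measureReal_le_one
  have hPof : ∀ k r, noiseLaw (stateIn b d k r A) = ENNReal.ofReal (P k r) := fun k r => by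
    simp [hP, measureReal_def]
  set g : ℤ → ℝ → ℝ≥0∞ := fun k x =>
    (if t < x / q then (if i ∈ A then 1 else 0) else 0) +
      (if x / q ≤ t then ENNReal.ofReal (P k (t - x / q)) else 0) with hg
  have hgm : ∀ k, Measurable (g k) := fun k => by
    refine Measurable.add ?_ ?_
    · exact Measurable.ite (measurableSet_lt measurable_const (by fun_prop)) measurable_const
        measurable_const
    · refine Measurable.ite (measurableSet_le (by fun_prop) measurable_const) ?_
        measurable_const
      exact ((hPm k).comp (by fun_prop)).ennreal_ofReal
  have h1 : noiseLaw (stateIn b d i t A) =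
      ∫⁻ p, g (step b d i p.1) p.2 ∂((volume : Measure unitInterval).prod (expMeasure 1)) := by
    rw [← lintegral_indicator_one (measurableSet_stateIn b d i t A),
      lintegral_noise (measurable_one.indicator (measurableSet_stateIn b d i t A))]
    refine lintegral_congr fun p => ?_
    have h2 : ∀ᵐ ω ∂noiseLaw, (stateIn b d i t A).indicator (1 : Noise → ℝ≥0∞) (noiseCons p ω) =
        (if t < p.2 / q then (if i ∈ A then 1 else 0) else 0) +
        (if p.2 / q ≤ t then
          (stateIn b d (step b d i p.1) (t - p.2 / q) A).indicator 1 ω else 0) := by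
      filter_upwards [ae_noise_nonneg] with ω hω
      have := mem_stateIn_cons hb hd i ht A p hω
      rw [← hqdef] at this
      simp only [Set.indicator, this, Pi.one_apply]
      rcases lt_or_ge t (p.2 / q) with h | h
      · simp [h, not_le.2 h]
      · simp [h, not_lt.2 h]
    rw [lintegral_congr_ae h2, lintegral_add_left measurable_const]
    simp only [hg, lintegral_const, measure_univ, mul_one]
    congr 1
    split_ifs
    · rw [lintegral_indicator_one (measurableSet_stateIn _ _ _ _ _), hPof]
    · simp
  have hfirst : ∫⁻ x, (if t < x / q then (if i ∈ A then 1 else 0) else 0 : ℝ≥0∞) ∂(expMeasure 1) =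
      ENNReal.ofReal ((if i ∈ A then 1 else 0) * Real.exp (-(q * t))) := by
    have : (fun x : ℝ => (if t < x / q then (if i ∈ A then 1 else 0) else 0 : ℝ≥0∞)) =
        (Set.Ioi (q * t)).indicator fun _ => if i ∈ A then 1 else 0 := by
      ext x
      simp [Set.indicator, lt_div_iff₀ hq, mul_comm]
    rw [this, lintegral_indicator measurableSet_Ioi, setLIntegral_const,
      expMeasure_one_Ioi (by positivity)]
    split_ifs <;> simp
  -- The substitution x = q (t - r) passes from the standard exponential variable to the time
  -- remaining after the first jump.
  have hsub : ∀ k, ∫ x in (0 : ℝ)..(q * t), Real.exp (-x) * P k (t - x / q) =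
      q * ∫ r in (0 : ℝ)..t, Real.exp (-(q * (t - r))) * P k r := fun k => by
    have := intervalIntegral.integral_comp_sub_mul (a := 0) (b := t)
      (fun x => Real.exp (-x) * P k (t - x / q)) hq.ne' (q * t)
    simp only [mul_zero, sub_zero, sub_self, smul_eq_mul] at this
    rw [← mul_inv_cancel_left₀ hq.ne' (∫ x in (0 : ℝ)..(q * t), _), ← this]
    congr 1
    refine intervalIntegral.integral_congr fun r _ => ?_
    rw [← mul_sub, mul_div_cancel_left₀ _ hq.ne', sub_sub_cancel]
  have hsecond : ∀ k, ∫⁻ x, (if x / q ≤ t then ENNReal.ofReal (P k (t - x / q)) else 0)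
      ∂(expMeasure 1) =
      ENNReal.ofReal (q * ∫ r in (0 : ℝ)..t, Real.exp (-(q * (t - r))) * P k r) := fun k => by
    rw [← hsub k, ← lintegral_expMeasure_one_le (K := 1) (fun x => hP0 k _)
      ((hPm k).comp (by fun_prop)) (fun x => hP1 k _) (by positivity)]
    refine lintegral_congr fun x => ?_
    simp only [div_le_iff₀ hq, mul_comm]
  have hI0 : ∀ k, 0 ≤ ∫ r in (0 : ℝ)..t, Real.exp (-(q * (t - r))) * P k r := fun k =>
    intervalIntegral.integral_nonneg ht fun r _ => mul_nonneg (Real.exp_pos _).le (hP0 k r)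
  have hint : ∀ k, IntervalIntegrable (fun r => Real.exp (-(q * (t - r))) * P k r) volume 0 t :=
    fun k => by
    have hc : IntervalIntegrable (fun r => Real.exp (-(q * (t - r)))) volume 0 t :=
      Continuous.intervalIntegrable (by fun_prop) _ _
    refine hc.mono_fun (by have := hPm k; fun_prop) (Filter.Eventually.of_forall fun r => ?_)
    beta_reduce
    rw [norm_mul, Real.norm_of_nonneg (hP0 k r)]
    exact mul_le_of_le_one_right (norm_nonneg _) (hP1 k r)
  have hgl : ∀ k, ∫⁻ x, g k x ∂(expMeasure 1) =
      ENNReal.ofReal ((if i ∈ A then 1 else 0) * Real.exp (-(q * t)) +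
        q * ∫ r in (0 : ℝ)..t, Real.exp (-(q * (t - r))) * P k r) := fun k => by
    rw [hg, ENNReal.ofReal_add (by positivity) (mul_nonneg hq.le (hI0 k)), ← hfirst,
      ← hsecond, lintegral_add_left]
    exact Measurable.ite (measurableSet_lt measurable_const (by fun_prop)) measurable_const
      measurable_const
  have hb' : 0 ≤ b i / q := (div_pos (hb i) hq).le
  have hd' : 0 ≤ d i / q := (div_pos (hd i) hq).le
  have hnn : ∀ k, 0 ≤ (if i ∈ A then (1 : ℝ) else 0) * Real.exp (-(q * t)) +
        q * ∫ r in (0 : ℝ)..t, Real.exp (-(q * (t - r))) * P k r := fun k =>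
    add_nonneg (by positivity) (mul_nonneg hq.le (hI0 k))
  rw [measureReal_def, h1, lintegral_step hb hd i hgm, hgl, hgl, ← hqdef,
    ← ENNReal.ofReal_mul hb', ← ENNReal.ofReal_mul hd',
    ← ENNReal.ofReal_add (mul_nonneg hb' (hnn _)) (mul_nonneg hd' (hnn _)),
    ENNReal.toReal_ofReal (add_nonneg (mul_nonneg hb' (hnn _)) (mul_nonneg hd' (hnn _)))]
  have hsplit : ∫ r in (0 : ℝ)..t, Real.exp (-(q * (t - r))) *
        (b i * P (i + 1) r + d i * P (i - 1) r) =
      b i * (∫ r in (0 : ℝ)..t, Real.exp (-(q * (t - r))) * P (i + 1) r) +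
      d i * ∫ r in (0 : ℝ)..t, Real.exp (-(q * (t - r))) * P (i - 1) r := by
    rw [← intervalIntegral.integral_const_mul, ← intervalIntegral.integral_const_mul,
      ← intervalIntegral.integral_add ((hint _).const_mul _) ((hint _).const_mul _)]
    refine intervalIntegral.integral_congr fun r _ => ?_
    ring
  rw [hsplit]
  have hbd : b i = q - d i := by rw [hqdef]; ring
  field_simp
  rw [hbd]; ring

/-- Uniqueness for the backward integral equation among families of at most exponential growth. -/
lemma backward_unique {b d : ℤ → ℝ} (hb : ∀ n, 0 < b n) (hd : ∀ n, 0 < d n) {M : ℝ}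
    (hbM : ∀ n, b n ≤ M) (hdM : ∀ n, d n ≤ M) {G : ℤ → ℝ → ℝ} {T K c : ℝ} (hc : 1 ≤ c)
    (hK : ∀ i, ∀ t ∈ Set.Icc 0 T, |G i t| ≤ K * c ^ i.natAbs)
    (hG : ∀ i, ∀ t ∈ Set.Icc 0 T, G i t = ∫ r in (0 : ℝ)..t, Real.exp (-((b i + d i) * (t - r))) *
        (b i * G (i + 1) r + d i * G (i - 1) r)) :
    ∀ i, ∀ t ∈ Set.Icc 0 T, G i t = 0 := by
  have hM : 0 < M := (hb 0).trans_le (hbM 0)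
  have hc0 : 0 < c := one_pos.trans_le hc
  -- Iterating the equation gives a Picard bound: each iteration integrates once more, costs at most
  -- 2M from the two rates, and costs a factor c because the neighbouring state may lie one step
  -- further out.
  set L := 2 * M * c with hL
  have key : ∀ n : ℕ, ∀ i, ∀ t ∈ Set.Icc 0 T,
      |G i t| ≤ K * c ^ i.natAbs * ((L * t) ^ n / n.factorial) := by
    intro n
    induction n with
    | zero => intro i t ht; simpa using hK i t ht
    | succ n ih =>
      intro i t ht
      have hK0 : 0 ≤ K := by
        have := (abs_nonneg _).trans (hK 0 t ht); simpa using this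
      have hnb : ∀ k : ℤ, (k = i + 1 ∨ k = i - 1) → c ^ k.natAbs ≤ c ^ (i.natAbs + 1) := by
        intro k hk
        exact pow_le_pow_right₀ hc (by omega)
      have hbound : ∀ r ∈ Set.Icc 0 t, |Real.exp (-((b i + d i) * (t - r))) *
          (b i * G (i + 1) r + d i * G (i - 1) r)| ≤
          K * c ^ i.natAbs * (L ^ (n + 1) / n.factorial) * r ^ n := by
        intro r hr
        have hrT : r ∈ Set.Icc 0 T := ⟨hr.1, hr.2.trans ht.2⟩
        have e1 : Real.exp (-((b i + d i) * (t - r))) ≤ 1 := by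
          refine Real.exp_le_one_iff.2 (neg_nonpos.2 (mul_nonneg (add_pos (hb i) (hd i)).le ?_))
          linarith [hr.2]
        have hLr : 0 ≤ (L * r) ^ n / (n.factorial : ℝ) := by
          have := hr.1; positivity
        have g : ∀ k : ℤ, (k = i + 1 ∨ k = i - 1) → |G k r| ≤
            K * c ^ (i.natAbs + 1) * ((L * r) ^ n / n.factorial) := fun k hk =>
          (ih k r hrT).trans (by exact mul_le_mul_of_nonneg_right (mul_le_mul_of_nonneg_left (hnb k hk) hK0) hLr)
        have g1 := g (i + 1) (Or.inl rfl)
        have g2 := g (i - 1) (Or.inr rfl)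
        rw [abs_mul, abs_of_pos (Real.exp_pos _)]
        calc Real.exp (-((b i + d i) * (t - r))) * |b i * G (i + 1) r + d i * G (i - 1) r|
            ≤ 1 * (b i * |G (i + 1) r| + d i * |G (i - 1) r|) := by
              gcongr
              refine (abs_add_le _ _).trans ?_
              rw [abs_mul, abs_mul, abs_of_pos (hb i), abs_of_pos (hd i)]
          _ ≤ 1 * (M * (K * c ^ (i.natAbs + 1) * ((L * r) ^ n / n.factorial)) +
              M * (K * c ^ (i.natAbs + 1) * ((L * r) ^ n / n.factorial))) := by
              gcongr
              · exact hbM i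
              · exact hdM i
          _ = _ := by rw [hL]; ring
      rw [hG i t ht, ← Real.norm_eq_abs]
      refine (intervalIntegral.norm_integral_le_of_norm_le ht.1
        (g := fun r => K * c ^ i.natAbs * (L ^ (n + 1) / n.factorial) * r ^ n) ?_
        (Continuous.intervalIntegrable (by fun_prop) _ _)).trans_eq ?_
      · refine Filter.Eventually.of_forall fun r hr => ?_
        exact hbound r ⟨hr.1.le, hr.2⟩
      · rw [intervalIntegral.integral_const_mul, integral_pow, Nat.factorial_succ]
        have := Nat.factorial_ne_zero n
        push_cast
        field_simp
        ring
  intro i t ht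
  have hlim : Filter.Tendsto (fun n : ℕ => K * c ^ i.natAbs * ((L * t) ^ n / n.factorial))
      Filter.atTop (nhds 0) := by
    simpa using (FloorSemiring.tendsto_pow_div_factorial_atTop (L * t)).const_mul
      (K * c ^ i.natAbs)
  exact abs_nonpos_iff.1 (ge_of_tendsto' hlim fun n => key n i t ht)


/-! ### Inversion of Stieltjes transforms -/

lemma resolvent_im (x u ε : ℝ) :
    (((x : ℂ) - (u + ε * Complex.I))⁻¹).im = ε / ((x - u) ^ 2 + ε ^ 2) := by
  rw [Complex.inv_im]
  simp [Complex.normSq_apply, sq]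

lemma integrable_resolvent_of_im_pos (ρ : Measure ℝ) [IsFiniteMeasure ρ] {z : ℂ} (hz : 0 < z.im) :
    Integrable (fun x : ℝ => ((x : ℂ) - z)⁻¹) ρ := by
  refine Integrable.of_bound (C := z.im⁻¹) ?_ (Eventually.of_forall fun x => ?_)
  · exact (by fun_prop : Measurable fun x : ℝ => ((x : ℂ) - z)⁻¹).aestronglyMeasurable
  · rw [norm_inv]
    refine inv_anti₀ hz ?_
    have := Complex.abs_im_le_norm ((x : ℂ) - z)
    simpa [abs_of_pos hz] using this

lemma stieltjes_im (ρ : Measure ℝ) [IsFiniteMeasure ρ] (u : ℝ) {ε : ℝ} (hε : 0 < ε) :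
    (∫ x : ℝ, ((x : ℂ) - (u + ε * Complex.I))⁻¹ ∂ρ).im = ∫ x, ε / ((x - u) ^ 2 + ε ^ 2) ∂ρ := by
  have h := integrable_resolvent_of_im_pos ρ (z := u + ε * Complex.I) (by simpa using hε)
  have h2 : ∫ x : ℝ, (((x : ℂ) - (u + ε * Complex.I))⁻¹).im ∂ρ =
    (∫ x : ℝ, ((x : ℂ) - (u + ε * Complex.I))⁻¹ ∂ρ).im := integral_im h
  rw [← h2]
  simp only [resolvent_im]

lemma integral_mul_poisson {g : ℝ → ℝ} (x : ℝ) {ε : ℝ} (hε : 0 < ε) :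
    ∫ u, g u * (ε / ((x - u) ^ 2 + ε ^ 2)) = ∫ s, g (x + ε * s) * (1 + s ^ 2)⁻¹ := by
  have h1 := integral_add_left_eq_self (μ := (volume : Measure ℝ))
    (fun u => g u * (ε / ((x - u) ^ 2 + ε ^ 2))) x
  rw [← h1]
  have h2 := Measure.integral_comp_mul_left
    (fun u => g (x + u) * (ε / ((x - (x + u)) ^ 2 + ε ^ 2))) ε
  rw [abs_of_pos (inv_pos.2 hε), smul_eq_mul] at h2
  rw [← mul_inv_cancel_left₀ hε.ne' (∫ u, g (x + u) * (ε / ((x - (x + u)) ^ 2 + ε ^ 2))), ← h2,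
    ← integral_const_mul]
  refine integral_congr_ae (Eventually.of_forall fun s => ?_)
  beta_reduce
  have : (1 + s ^ 2) ≠ 0 := by positivity
  field_simp
  ring

/-- The kernels are π times an approximate identity: after exchanging the integrals and substituting
u = x + εs, the inner integral is that of g (x + εs) / (1 + s²), and dominated convergence applies
twice. -/
lemma tendsto_poisson (ρ : Measure ℝ) [IsFiniteMeasure ρ] {g : ℝ → ℝ} (hg : Continuous g)
    (hgs : HasCompactSupport g) :
    Tendsto (fun ε : ℝ => ∫ u, g u * ∫ x, ε / ((x - u) ^ 2 + ε ^ 2) ∂ρ) (𝓝[>] 0)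
      (𝓝 (Real.pi * ∫ x, g x ∂ρ)) := by
  obtain ⟨C, hC⟩ := hg.bounded_above_of_compact_support hgs
  have hC0 : 0 ≤ C := (norm_nonneg _).trans (hC 0)
  have hbd : ∀ ε x s : ℝ, ‖g (x + ε * s) * (1 + s ^ 2)⁻¹‖ ≤ C * (1 + s ^ 2)⁻¹ := fun ε x s => by
    rw [norm_mul, Real.norm_of_nonneg (by positivity : 0 ≤ (1 + s ^ 2)⁻¹)]
    exact mul_le_mul_of_nonneg_right (hC _) (by positivity)
  have hInt : Integrable fun s : ℝ => C * (1 + s ^ 2)⁻¹ := integrable_inv_one_add_sq.const_mul C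
  have hcont : ∀ ε x : ℝ, Continuous fun s => g (x + ε * s) * (1 + s ^ 2)⁻¹ := fun ε x => by
    refine (hg.comp (by fun_prop)).mul (Continuous.inv₀ (by fun_prop) fun s => by positivity)
  have hswap : ∀ ε : ℝ, 0 < ε → ∫ u, g u * ∫ x, ε / ((x - u) ^ 2 + ε ^ 2) ∂ρ =
      ∫ x, (∫ s, g (x + ε * s) * (1 + s ^ 2)⁻¹) ∂ρ := by
    intro ε hε
    simp only [← integral_const_mul]
    rw [integral_integral_swap]
    · simp only [integral_mul_poisson _ hε]
    · have h1 : Integrable (fun p : ℝ × ℝ => g p.1 * ε⁻¹) (volume.prod ρ) :=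
        (hg.integrable_of_hasCompactSupport hgs).mul_prod (integrable_const ε⁻¹)
      refine h1.mono ?_ (Eventually.of_forall fun p => ?_)
      · have := hg.measurable
        exact (by unfold Function.uncurry; fun_prop : Measurable (Function.uncurry fun u x : ℝ => g u *
          (ε / ((x - u) ^ 2 + ε ^ 2)))).aestronglyMeasurable
      · rw [Function.uncurry, norm_mul, norm_mul]
        refine mul_le_mul_of_nonneg_left ?_ (norm_nonneg _)
        rw [Real.norm_of_nonneg (by positivity), Real.norm_of_nonneg (by positivity),
          div_le_iff₀ (by positivity)]
        have : 0 ≤ ε⁻¹ * (p.2 - p.1) ^ 2 := by positivity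
        have h3 : ε⁻¹ * ε ^ 2 = ε := by field_simp
        nlinarith
  have hlim : Tendsto (fun ε : ℝ => ∫ x, (∫ s, g (x + ε * s) * (1 + s ^ 2)⁻¹) ∂ρ) (𝓝[>] 0)
      (𝓝 (∫ x, Real.pi * g x ∂ρ)) := by
    refine tendsto_integral_filter_of_dominated_convergence (fun _ => C * Real.pi) ?_ ?_ ?_ ?_
    · refine Eventually.of_forall fun ε => ?_
      refine (StronglyMeasurable.integral_prod_right' (f := fun p : ℝ × ℝ =>
        g (p.1 + ε * p.2) * (1 + p.2 ^ 2)⁻¹) ?_).aestronglyMeasurable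
      have := hg.measurable
      exact (by fun_prop : Measurable fun p : ℝ × ℝ =>
        g (p.1 + ε * p.2) * (1 + p.2 ^ 2)⁻¹).stronglyMeasurable
    · refine Eventually.of_forall fun ε => Eventually.of_forall fun x => ?_
      refine (norm_integral_le_of_norm_le hInt (Eventually.of_forall (hbd ε x))).trans_eq ?_
      rw [integral_const_mul, integral_univ_inv_one_add_sq]
    · exact integrable_const _
    · refine Eventually.of_forall fun x => ?_
      have : Tendsto (fun ε : ℝ => ∫ s, g (x + ε * s) * (1 + s ^ 2)⁻¹) (𝓝[>] 0)
          (𝓝 (∫ s, g x * (1 + s ^ 2)⁻¹)) := by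
        refine tendsto_integral_filter_of_dominated_convergence _
          (Eventually.of_forall fun ε => (hcont ε x).aestronglyMeasurable)
          (Eventually.of_forall fun ε => Eventually.of_forall (hbd ε x)) hInt
          (Eventually.of_forall fun s => ?_)
        have h : Continuous fun ε : ℝ => g (x + ε * s) * (1 + s ^ 2)⁻¹ := by fun_prop
        have := h.tendsto 0
        simp only [zero_mul, add_zero] at this
        exact this.mono_left nhdsWithin_le_nhds
      rwa [integral_const_mul, integral_univ_inv_one_add_sq, mul_comm] at this
  rw [integral_const_mul] at hlim
  refine hlim.congr' ?_
  filter_upwards [self_mem_nhdsWithin] with ε hε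
  exact (hswap ε hε).symm

/-- The closed upper half-plane without the points of `S` on the real axis. -/
def upperClosed (S : Set ℝ) : Set ℂ := {z | 0 ≤ z.im ∧ ∀ s ∈ S, z ≠ s}

section Inversion

variable {ρ : Measure ℝ} [IsFiniteMeasure ρ] {S : Set ℝ} {H : ℂ → ℂ}

lemma tendsto_boundary (hc : ContinuousOn H (upperClosed S)) {x : ℝ} (hx : x ∉ S) :
    Tendsto (fun ε : ℝ => H (x + ε * Complex.I)) (𝓝[>] 0) (𝓝 (H x)) := by
  have h1 : Tendsto H (𝓝[upperClosed S] (x : ℂ)) (𝓝 (H x)) :=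
    hc x ⟨by simp, fun s hs h => hx (by rwa [Complex.ofReal_inj.1 h])⟩
  refine h1.comp (tendsto_nhdsWithin_iff.2 ⟨?_, ?_⟩)
  · have : Continuous fun ε : ℝ => (x : ℂ) + ε * Complex.I := by fun_prop
    simpa using (this.tendsto 0).mono_left nhdsWithin_le_nhds
  · filter_upwards [self_mem_nhdsWithin] with ε hε
    have hε' : 0 < ε := hε
    refine ⟨by simpa using hε'.le, fun s _ h => ?_⟩
    have := congrArg Complex.im h
    simp at this
    exact hε'.ne' this

variable (hH : ∀ z : ℂ, 0 < z.im → ∫ x : ℝ, ((x : ℂ) - z)⁻¹ ∂ρ = H z)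
  (hc : ContinuousOn H (upperClosed S))

include hH hc

/-- Above the axis the imaginary part is a Poisson integral of a positive measure, and this survives
in the limit. -/
lemma boundary_im_nonneg {x : ℝ} (hx : x ∉ S) : 0 ≤ (H x).im := by
  refine ge_of_tendsto ((Complex.continuous_im.tendsto _).comp (tendsto_boundary hc hx)) ?_
  filter_upwards [self_mem_nhdsWithin] with ε hε
  have hε' : 0 < ε := hε
  rw [Function.comp, ← hH _ (by simpa using hε'), stieltjes_im ρ x hε']
  exact integral_nonneg fun y => by positivity

/-- The Poisson integrals of ρ tested against g converge to both sides: to the left by the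
approximate identity, to the right because H is bounded on the compact strip over K. -/
lemma pi_mul_integral_eq {g : ℝ → ℝ} (hg : Continuous g) {K : Set ℝ} (hK : IsCompact K)
    (hgK : ∀ x ∉ K, g x = 0) (hKS : Disjoint K S) :
    Real.pi * ∫ x, g x ∂ρ = ∫ x, g x * (H x).im := by
  have hgs : HasCompactSupport g := HasCompactSupport.intro hK hgK
  refine tendsto_nhds_unique (tendsto_poisson ρ hg hgs) ?_
  set φ : ℝ × ℝ → ℂ := fun p => p.1 + p.2 * Complex.I
  have hφ : Continuous φ := by fun_prop
  have hKI : IsCompact (K ×ˢ Set.Icc (0 : ℝ) 1) := hK.prod isCompact_Icc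
  have hmaps : Set.MapsTo φ (K ×ˢ Set.Icc (0 : ℝ) 1) (upperClosed S) := by
    rintro ⟨x, ε⟩ ⟨hx, hε⟩
    refine ⟨by simpa [φ] using hε.1, fun s hs h => ?_⟩
    have h1 := congrArg Complex.re h
    simp [φ] at h1
    exact Set.disjoint_left.1 hKS hx (h1 ▸ hs)
  have hcomp : ContinuousOn (fun p => H (φ p)) (K ×ˢ Set.Icc (0 : ℝ) 1) :=
    hc.comp hφ.continuousOn hmaps
  obtain ⟨C, hC⟩ := hKI.exists_bound_of_continuousOn hcomp
  have hIoc : ∀ᶠ ε : ℝ in 𝓝[>] 0, ε ∈ Set.Ioc (0 : ℝ) 1 := Ioc_mem_nhdsGT one_pos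
  have main : Tendsto (fun ε : ℝ => ∫ u, g u * (H (u + ε * Complex.I)).im) (𝓝[>] 0)
      (𝓝 (∫ x, g x * (H x).im)) := by
    refine tendsto_integral_filter_of_dominated_convergence (fun u => |g u| * C) ?_ ?_ ?_ ?_
    · filter_upwards [hIoc] with ε hε
      refine (Continuous.mul hg (Complex.continuous_im.comp ?_)).aestronglyMeasurable
      refine hc.comp_continuous (by fun_prop) fun u => ⟨by simpa using hε.1.le, fun s _ h => ?_⟩
      have := congrArg Complex.im h
      simp at this
      exact hε.1.ne' this
    · filter_upwards [hIoc] with ε hε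
      refine Eventually.of_forall fun u => ?_
      rw [norm_mul, Real.norm_eq_abs]
      by_cases hu : u ∈ K
      · refine mul_le_mul_of_nonneg_left ?_ (abs_nonneg _)
        exact (Complex.abs_im_le_norm _).trans (hC (u, ε) ⟨hu, hε.1.le, hε.2⟩)
      · simp [hgK u hu]
    · exact ((hg.integrable_of_hasCompactSupport hgs).abs).mul_const C
    · refine Eventually.of_forall fun u => ?_
      by_cases hu : u ∈ K
      · exact ((Complex.continuous_im.tendsto _).comp
          (tendsto_boundary hc (Set.disjoint_left.1 hKS hu))).const_mul _
      · simp [hgK u hu]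
  refine main.congr' ?_
  filter_upwards [self_mem_nhdsWithin] with ε hε
  have hε' : 0 < ε := hε
  refine integral_congr_ae (Eventually.of_forall fun u => ?_)
  beta_reduce
  rw [← stieltjes_im ρ u hε', hH _ (by simpa using hε')]

/-- The indicator of K is approximated by thickened indicators, all supported in a closed thickening
K' which still avoids S. -/
lemma pi_mul_measureReal_compact (hS : IsClosed S) {K : Set ℝ} (hK : IsCompact K)
    (hKS : Disjoint K S) : Real.pi * ρ.real K = ∫ x in K, (H x).im := by
  obtain ⟨δ, hδ, hδS⟩ := hK.exists_cthickening_subset_open hS.isOpen_compl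
    (Set.disjoint_left.1 hKS)
  set K' := Metric.cthickening δ K
  have hK' : IsCompact K' := hK.cthickening
  have hK'S : Disjoint K' S := Set.disjoint_left.2 fun x hx => hδS hx
  set δs : ℕ → ℝ := fun n => δ / (n + 1)
  have hδs : ∀ n, 0 < δs n := fun n => by positivity
  have hδlim : Tendsto δs atTop (𝓝 0) := by
    have := (tendsto_one_div_add_atTop_nhds_zero_nat (𝕜 := ℝ)).const_mul δ
    simpa [δs, div_eq_mul_inv] using this
  set g : ℕ → ℝ → ℝ := fun n x => (thickenedIndicator (hδs n) K x : ℝ)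
  have hgc : ∀ n, Continuous (g n) := fun n =>
    NNReal.continuous_coe.comp (thickenedIndicator (hδs n) K).continuous
  have hg1 : ∀ n x, ‖g n x‖ ≤ 1 := fun n x => by
    rw [Real.norm_of_nonneg (NNReal.coe_nonneg _)]
    exact_mod_cast thickenedIndicator_le_one (hδs n) K x
  have hgK : ∀ n, ∀ x ∉ K', g n x = 0 := fun n x hx => by
    have : x ∉ Metric.thickening (δs n) K := fun h => hx
      (Metric.thickening_subset_cthickening_of_le
        (div_le_self hδ.le (by linarith [(Nat.cast_nonneg n : (0 : ℝ) ≤ n)])) K h)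
    simp only [g]; rw [thickenedIndicator_zero (hδs n) K this]; rfl
  have hglim : ∀ x, Tendsto (fun n => g n x) atTop (𝓝 (K.indicator (fun _ => (1 : ℝ)) x)) := by
    intro x
    have h1 := (tendsto_pi_nhds.1 (thickenedIndicator_tendsto_indicator_closure hδs hδlim K)) x
    rw [hK.isClosed.closure_eq] at h1
    have h2 := (NNReal.continuous_coe.tendsto _).comp h1
    have h3 : ((K.indicator (fun _ => (1 : NNReal)) x : NNReal) : ℝ) =
        K.indicator (fun _ => (1 : ℝ)) x := by
      by_cases hx : x ∈ K <;> simp [hx]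
    rwa [h3] at h2
  have hHc : ContinuousOn (fun x : ℝ => (H x).im) K' := by
    refine Complex.continuous_im.comp_continuousOn (hc.comp (by fun_prop) fun x hx => ?_)
    refine ⟨by simp, fun s hs h => ?_⟩
    exact Set.disjoint_left.1 hK'S hx (Complex.ofReal_inj.1 h ▸ hs)
  have hL : Tendsto (fun n => Real.pi * ∫ x, g n x ∂ρ) atTop (𝓝 (Real.pi * ρ.real K)) := by
    refine Tendsto.const_mul _ ?_
    rw [← integral_indicator_one hK.measurableSet]
    exact tendsto_integral_of_dominated_convergence (fun _ => (1 : ℝ))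
      (fun n => (hgc n).aestronglyMeasurable) (integrable_const _)
      (fun n => Eventually.of_forall (hg1 n)) (Eventually.of_forall hglim)
  have hR : Tendsto (fun n => ∫ x, g n x * (H x).im) atTop (𝓝 (∫ x in K, (H x).im)) := by
    have h1 : ∀ n, ∫ x, g n x * (H x).im = ∫ x in K', g n x * (H x).im := fun n =>
      (setIntegral_eq_integral_of_forall_compl_eq_zero fun x hx => by simp [hgK n x hx]).symm
    have h2 : ∫ x in K, (H x).im = ∫ x in K', K.indicator (fun _ => (1 : ℝ)) x * (H x).im := by
      rw [← integral_indicator hK.measurableSet, ← setIntegral_eq_integral_of_forall_compl_eq_zero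
        (s := K')]
      · refine integral_congr_ae (Eventually.of_forall fun x => ?_)
        by_cases hx : x ∈ K <;> simp [hx]
      · intro x hx
        have : x ∉ K := fun h => hx (Metric.self_subset_cthickening K h)
        simp [this]
    simp only [h1, h2]
    have hint : IntegrableOn (fun x : ℝ => (H x).im) K' := hHc.integrableOn_compact hK'
    refine tendsto_integral_of_dominated_convergence (fun x => ‖(H x).im‖)
      (fun n => (hgc n).aestronglyMeasurable.mul hint.aestronglyMeasurable) hint.norm
      (fun n => Eventually.of_forall fun x => ?_)
      (Eventually.of_forall fun x => (hglim x).mul_const _)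
    rw [norm_mul]
    exact mul_le_of_le_one_left (norm_nonneg _) (hg1 n x)
  refine tendsto_nhds_unique hL (hR.congr fun n => ?_)
  exact (pi_mul_integral_eq hH hc (hgc n) hK' (hgK n) hK'S).symm

/-- **Stieltjes inversion**: off the exceptional set, the measure has the density `Im H / π`. -/
theorem restrict_compl_eq_withDensity (hS : S.Finite) :
    ρ.restrict Sᶜ = volume.withDensity fun x : ℝ => ENNReal.ofReal ((H x).im / Real.pi) := by
  have hScl : IsClosed S := hS.isClosed
  have hvol : volume S = 0 := hS.measure_zero _
  set ν := volume.withDensity fun x : ℝ => ENNReal.ofReal ((H x).im / Real.pi) with hν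
  have hcomp : ∀ K : Set ℝ, IsCompact K → Disjoint K S → ν K = ρ K := by
    intro K hK hKS
    have hHc : ContinuousOn (fun x : ℝ => (H x).im / Real.pi) K := by
      refine (Complex.continuous_im.comp_continuousOn (hc.comp (by fun_prop) fun x hx => ?_)).div_const _
      refine ⟨by simp, fun s hs h => ?_⟩
      exact Set.disjoint_left.1 hKS hx (Complex.ofReal_inj.1 h ▸ hs)
    rw [hν, withDensity_apply _ hK.measurableSet, ← ofReal_integral_eq_lintegral_ofReal
      (hHc.integrableOn_compact hK), integral_div, ← pi_mul_measureReal_compact hH hc hScl hK hKS,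
      mul_div_cancel_left₀ _ Real.pi_ne_zero, ofReal_measureReal]
    refine (ae_restrict_mem hK.measurableSet).mono fun x hx => ?_
    exact div_nonneg (boundary_im_nonneg hH hc (Set.disjoint_left.1 hKS hx)) Real.pi_pos.le
  have hνS : ν S = 0 := withDensity_absolutelyContinuous _ _ hvol
  -- Compact sets avoiding S exhaust its complement, and ν agrees with ρ on each of them, so the
  -- total mass of ν is bounded by that of ρ. Finiteness is needed for the inner regularity used at
  -- the end.
  have hfin : IsFiniteMeasure ν := by
    set K : ℕ → Set ℝ := fun n => Metric.closedBall 0 n ∩ {x | ∀ s ∈ S, 1 / ((n : ℝ) + 1) ≤ |x - s|}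
    have hKc : ∀ n, IsCompact (K n) := fun n => by
      refine (isCompact_closedBall 0 (n : ℝ)).inter_right ?_
      have : {x : ℝ | ∀ s ∈ S, 1 / ((n : ℝ) + 1) ≤ |x - s|} =
        ⋂ s ∈ S, {x : ℝ | 1 / ((n : ℝ) + 1) ≤ |x - s|} := by ext; simp
      rw [this]
      exact isClosed_biInter fun s _ => isClosed_le continuous_const (by fun_prop)
    have hKS : ∀ n, Disjoint (K n) S := fun n => Set.disjoint_left.2 fun x hx hs => by
      have := hx.2 x hs
      simp at this
      linarith [(Nat.cast_nonneg n : (0 : ℝ) ≤ n)]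
    have hmono : Monotone K := fun m n hmn x hx => by
      refine ⟨Metric.closedBall_subset_closedBall (by exact_mod_cast hmn) hx.1, fun s hs => ?_⟩
      refine le_trans ?_ (hx.2 s hs)
      have : (m : ℝ) ≤ n := by exact_mod_cast hmn
      gcongr
    have hU : ⋃ n, K n = Sᶜ := by
      refine Set.Subset.antisymm (Set.iUnion_subset fun n x hx => Set.disjoint_left.1 (hKS n) hx) ?_
      intro x hx
      obtain ⟨δ, hδ, hball⟩ := Metric.isOpen_iff.1 hScl.isOpen_compl x hx
      obtain ⟨n1, hn1⟩ := exists_nat_ge |x|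
      obtain ⟨n2, hn2⟩ := exists_nat_one_div_lt hδ
      refine Set.mem_iUnion.2 ⟨max n1 n2, ?_, fun s hs => ?_⟩
      · rw [mem_closedBall_zero_iff, Real.norm_eq_abs]
        exact hn1.trans (by exact_mod_cast le_max_left _ _)
      · have h1 : δ ≤ |x - s| := by
          by_contra! h
          exact hball (by rw [Metric.mem_ball, Real.dist_eq, abs_sub_comm]; exact h) hs
        have h2 : (n2 : ℝ) ≤ (max n1 n2 : ℕ) := by exact_mod_cast le_max_right _ _
        refine le_trans ?_ (hn2.le.trans h1)
        gcongr
    refine ⟨?_⟩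
    have h1 : ν Set.univ = ν Sᶜ := by
      rw [← Set.union_compl_self S]
      exact le_antisymm ((measure_union_le _ _).trans (by simp [hνS]))
        (measure_mono Set.subset_union_right)
    rw [h1, ← hU, hmono.measure_iUnion]
    refine (iSup_le fun n => ?_).trans_lt (measure_lt_top ρ Set.univ)
    rw [hcomp _ (hKc n) (hKS n)]
    exact measure_mono (Set.subset_univ _)
  ext E hE
  have hEm : MeasurableSet (E ∩ Sᶜ) := hE.inter hScl.measurableSet.compl
  rw [Measure.restrict_apply hE]
  have h1 : ν E = ν (E ∩ Sᶜ) := by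
    refine le_antisymm ?_ (measure_mono Set.inter_subset_left)
    have : E ⊆ (E ∩ Sᶜ) ∪ S := fun x hx => by by_cases h : x ∈ S <;> simp [hx, h]
    exact (measure_mono this).trans ((measure_union_le _ _).trans (by simp [hνS]))
  rw [h1, hEm.measure_eq_iSup_isCompact_of_ne_top (measure_ne_top ρ _),
    hEm.measure_eq_iSup_isCompact_of_ne_top (measure_ne_top ν _)]
  refine iSup_congr fun K => iSup_congr fun hK => iSup_congr fun hKc => ?_
  exact (hcomp K hKc (Set.disjoint_left.2 fun x hx => (hK hx).2)).symm

omit hc in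
-- The kernel -iε / (x - x₀ - iε) has modulus at most 1 and tends to the indicator of {x₀}.
lemma tendsto_mass (x₀ : ℝ) :
    Tendsto (fun ε : ℝ => -(ε * Complex.I) * H (x₀ + ε * Complex.I)) (𝓝[>] 0)
      (𝓝 (ρ.real {x₀} : ℂ)) := by
  have h1 : Tendsto (fun ε : ℝ => ∫ x : ℝ, -(ε * Complex.I) * ((x : ℂ) - (x₀ + ε * Complex.I))⁻¹ ∂ρ)
      (𝓝[>] 0) (𝓝 (∫ x, ({x₀} : Set ℝ).indicator (fun _ => (1 : ℂ)) x ∂ρ)) := by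
    have hne : ∀ x ε : ℝ, 0 < ε → (x : ℂ) - (x₀ + ε * Complex.I) ≠ 0 := fun x ε hε h => by
      have := congrArg Complex.im h
      simp at this
      exact hε.ne' this
    refine tendsto_integral_filter_of_dominated_convergence (fun _ => (1 : ℝ)) ?_ ?_
      (integrable_const _) ?_
    · refine Eventually.of_forall fun ε => ?_
      exact (by fun_prop : Measurable fun x : ℝ =>
        -(ε * Complex.I) * ((x : ℂ) - (x₀ + ε * Complex.I))⁻¹).aestronglyMeasurable
    · filter_upwards [self_mem_nhdsWithin] with ε hε
      have hε' : 0 < ε := hε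
      refine Eventually.of_forall fun x => ?_
      rw [norm_mul, norm_inv, norm_neg, norm_mul, Complex.norm_I, mul_one, Complex.norm_real,
        Real.norm_of_nonneg hε'.le, mul_inv_le_iff₀ (norm_pos_iff.2 (hne x ε hε')), one_mul]
      have := Complex.abs_im_le_norm ((x : ℂ) - (x₀ + ε * Complex.I))
      simpa [abs_of_pos hε'] using this
    · refine Eventually.of_forall fun x => ?_
      by_cases hx : x = x₀
      · subst hx
        refine tendsto_const_nhds.congr' ?_
        filter_upwards [self_mem_nhdsWithin] with ε hε
        have := hne x ε hε
        simp only [Set.mem_singleton_iff, Set.indicator_of_mem]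
        rw [sub_add_cancel_left] at this ⊢
        exact (mul_inv_cancel₀ this).symm
      · have hx' : (x : ℂ) - x₀ ≠ 0 := fun h => hx (by exact_mod_cast sub_eq_zero.1 h)
        have hc : ContinuousAt (fun ε : ℝ => -(ε * Complex.I) *
            ((x : ℂ) - (x₀ + ε * Complex.I))⁻¹) 0 := by
          refine ContinuousAt.mul (by fun_prop) (ContinuousAt.inv₀ (by fun_prop) ?_)
          simpa using hx'
        have := hc.tendsto
        simp only [Complex.ofReal_zero, zero_mul, neg_zero] at this
        simpa [hx] using this.mono_left nhdsWithin_le_nhds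
  have h2 : ∫ x, ({x₀} : Set ℝ).indicator (fun _ => (1 : ℂ)) x ∂ρ = (ρ.real {x₀} : ℂ) := by
    rw [integral_indicator (measurableSet_singleton _)]
    simp [measureReal_def]
  rw [h2] at h1
  refine h1.congr' ?_
  filter_upwards [self_mem_nhdsWithin] with ε hε
  rw [integral_const_mul, hH _ (by simpa using hε)]

end Inversion


/-! ### Scalar spectral measures of a self-adjoint operator -/

section Spectral

variable {H : Type*} [NormedAddCommGroup H] [InnerProductSpace ℂ H] [CompleteSpace H]

open CompactlySupported in
-- Riesz–Markov for the functional f ↦ ⟨v, f(J) v⟩ on the compact spectrum, which is positive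
-- because f(J) is a positive operator for f ≥ 0; the measure is then pushed forward to ℝ.
lemma exists_spectral_measure {J : H →L[ℂ] H} (hJ : IsSelfAdjoint J) (v : H) :
    ∃ ρ : Measure ℝ, IsFiniteMeasure ρ ∧ ρ (spectrum ℝ J)ᶜ = 0 ∧
      ∀ f : ℝ → ℝ, ContinuousOn f (spectrum ℝ J) →
        ∫ x, f x ∂ρ = (inner ℂ v (cfc f J v)).re := by
  have hcs : IsCompact (spectrum ℝ J) := ContinuousFunctionalCalculus.isCompact_spectrum J
  have : CompactSpace (spectrum ℝ J) := isCompact_iff_compactSpace.1 hcs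
  let Λ₀ : C_c(spectrum ℝ J, ℝ) →ₗ[ℝ] ℝ :=
    { toFun := fun f => (inner ℂ v (cfcHom hJ (f : C(spectrum ℝ J, ℝ)) v)).re
      map_add' := fun f g => by
        have : ((f + g : C_c(spectrum ℝ J, ℝ)) : C(spectrum ℝ J, ℝ)) =
          (f : C(spectrum ℝ J, ℝ)) + (g : C(spectrum ℝ J, ℝ)) := rfl
        rw [this, map_add, add_apply, inner_add_right, Complex.add_re]
      map_smul' := fun c f => by
        have : ((c • f : C_c(spectrum ℝ J, ℝ)) : C(spectrum ℝ J, ℝ)) =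
          c • (f : C(spectrum ℝ J, ℝ)) := rfl
        rw [this, map_smul]
        simp [inner_smul_right_eq_smul] }
  let Λ : C_c(spectrum ℝ J, ℝ) →ₚ[ℝ] ℝ := PositiveLinearMap.mk₀ Λ₀ fun f hf => by
    have h1 : (0 : H →L[ℂ] H) ≤ cfcHom hJ (f : C(spectrum ℝ J, ℝ)) := by
      rw [cfcHom_nonneg_iff]
      exact fun x => hf x
    have h2 := (ContinuousLinearMap.nonneg_iff_isPositive _).1 h1
    have := h2.inner_nonneg_right v
    exact (Complex.le_def.1 this).1
  have hemb : MeasurableEmbedding (Subtype.val : spectrum ℝ J → ℝ) :=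
    MeasurableEmbedding.subtype_coe hcs.measurableSet
  refine ⟨(RealRMK.rieszMeasure Λ).map Subtype.val, ?_, ?_, ?_⟩
  · infer_instance
  · rw [hemb.map_apply]
    have : (Subtype.val : spectrum ℝ J → ℝ) ⁻¹' (spectrum ℝ J)ᶜ = ∅ := by ext x; simp
    rw [this, measure_empty]
  · intro f hf
    rw [hemb.integral_map, cfc_apply f J hJ hf]
    exact RealRMK.integral_rieszMeasure Λ
      (CompactlySupportedContinuousMap.continuousMapEquiv ⟨_, hf.domRestrict⟩)

/-- The spectral measure of the vector `v`. -/
def spectralMeasure {J : H →L[ℂ] H} (hJ : IsSelfAdjoint J) (v : H) : Measure ℝ :=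
  (exists_spectral_measure hJ v).choose

instance {J : H →L[ℂ] H} (hJ : IsSelfAdjoint J) (v : H) :
    IsFiniteMeasure (spectralMeasure hJ v) :=
  (exists_spectral_measure hJ v).choose_spec.1

variable {J : H →L[ℂ] H} (hJ : IsSelfAdjoint J)

lemma spectralMeasure_compl (v : H) : spectralMeasure hJ v (spectrum ℝ J)ᶜ = 0 :=
  (exists_spectral_measure hJ v).choose_spec.2.1

lemma integral_spectralMeasure (v : H) {f : ℝ → ℝ} (hf : ContinuousOn f (spectrum ℝ J)) :
    ∫ x, f x ∂(spectralMeasure hJ v) = (inner ℂ v (cfc f J v)).re :=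
  (exists_spectral_measure hJ v).choose_spec.2.2 f hf

lemma integrable_spectralMeasure (v : H) {f : ℝ → ℝ} (hf : ContinuousOn f (spectrum ℝ J)) :
    Integrable f (spectralMeasure hJ v) := by
  have hcs : IsCompact (spectrum ℝ J) := ContinuousFunctionalCalculus.isCompact_spectrum J
  have h := hf.integrableOn_compact (μ := spectralMeasure hJ v) hcs
  rwa [IntegrableOn, Measure.restrict_eq_self_of_ae_mem] at h
  rw [ae_iff]
  exact spectralMeasure_compl hJ v

/-- The Stieltjes transform of a spectral measure, from a solution of the resolvent equation. -/
lemma stieltjes_spectralMeasure {v g : H} {z : ℂ} (hz : ∀ x ∈ spectrum ℝ J, (x : ℂ) ≠ z)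
    (hg : J g - z • g = v) :
    ∫ x : ℝ, ((x : ℂ) - z)⁻¹ ∂(spectralMeasure hJ v) = inner ℂ v g := by
  have hcont : ContinuousOn (fun x : ℝ => ((x : ℂ) - z)⁻¹) (spectrum ℝ J) :=
    ContinuousOn.inv₀ (by fun_prop) fun x hx => sub_ne_zero.2 (hz x hx)
  -- The functional calculus is real, so the resolvent function is split into real and imaginary
  -- parts. The two real identities contained in (f₁ + i f₂)(x - z) = 1 identify g with f₁(J) v + i
  -- f₂(J) v.
  set f₁ : ℝ → ℝ := fun x => (((x : ℂ) - z)⁻¹).re with hf₁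
  set f₂ : ℝ → ℝ := fun x => (((x : ℂ) - z)⁻¹).im with hf₂
  have h₁ : ContinuousOn f₁ (spectrum ℝ J) := Complex.continuous_re.comp_continuousOn hcont
  have h₂ : ContinuousOn f₂ (spectrum ℝ J) := Complex.continuous_im.comp_continuousOn hcont
  have hre : ∀ x ∈ spectrum ℝ J, f₁ x * (x - z.re) + f₂ x * z.im = 1 ∧
      f₂ x * (x - z.re) - f₁ x * z.im = 0 := fun x hx => by
    have h := inv_mul_cancel₀ (sub_ne_zero.2 (hz x hx))
    have e1 := congrArg Complex.re h
    have e2 := congrArg Complex.im h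
    rw [Complex.mul_re] at e1
    rw [Complex.mul_im] at e2
    simp only [Complex.sub_re, Complex.sub_im, Complex.ofReal_re, Complex.ofReal_im,
      Complex.one_re, Complex.one_im] at e1 e2
    constructor
    · simp only [hf₁, hf₂]; linarith
    · simp only [hf₁, hf₂]; linarith
  have hlin : cfc (fun x : ℝ => x - z.re) J = J - (z.re : ℂ) • (1 : H →L[ℂ] H) := by
    rw [cfc_sub _ _ J, cfc_id' ℝ J, cfc_const z.re J]
    congr 1
  have hone : cfc f₁ J * (J - (z.re : ℂ) • (1 : H →L[ℂ] H)) + (z.im : ℂ) • cfc f₂ J = 1 := by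
    rw [← hlin, ← cfc_mul f₁ _ J h₁ (by fun_prop)]
    have : (z.im : ℂ) • cfc f₂ J = cfc (fun x => z.im * f₂ x) J := by
      rw [cfc_const_mul _ _ J h₂]; ext y; simp
    rw [this, ← cfc_add (a := J) (fun x => f₁ x * (x - z.re)) (fun x => z.im * f₂ x)
        (h₁.mul (by fun_prop)) (continuousOn_const.mul h₂),
      ← cfc_const_one ℝ J]
    refine cfc_congr fun x hx => ?_
    have := (hre x hx).1
    linarith
  have htwo : cfc f₂ J * (J - (z.re : ℂ) • (1 : H →L[ℂ] H)) = (z.im : ℂ) • cfc f₁ J := by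
    rw [← hlin, ← cfc_mul f₂ _ J h₂ (by fun_prop)]
    have : (z.im : ℂ) • cfc f₁ J = cfc (fun x => z.im * f₁ x) J := by
      rw [cfc_const_mul _ _ J h₁]; ext y; simp
    rw [this]
    refine cfc_congr fun x hx => ?_
    have := (hre x hx).2
    linarith
  have hv : v = (J - (z.re : ℂ) • (1 : H →L[ℂ] H)) g - (z.im * Complex.I) • g := by
    rw [← hg]
    have hz : z = z.re + z.im * Complex.I := (Complex.re_add_im z).symm
    conv_lhs => rw [hz]
    simp only [sub_apply, smul_apply, one_apply_eq_self, add_smul]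
    abel
  have hgv : g = cfc f₁ J v + Complex.I • cfc f₂ J v := by
    have e1 : cfc f₁ J v = g - (z.im : ℂ) • cfc f₂ J g - (z.im * Complex.I) • cfc f₁ J g := by
      have := congrArg (fun T : H →L[ℂ] H => T g) hone
      simp only [add_apply, mul_apply_eq_comp, smul_apply, one_apply_eq_self] at this
      rw [hv, map_sub, map_smul, eq_sub_of_add_eq this]
    have e2 : cfc f₂ J v = (z.im : ℂ) • cfc f₁ J g - (z.im * Complex.I) • cfc f₂ J g := by
      have := congrArg (fun T : H →L[ℂ] H => T g) htwo
      simp only [mul_apply_eq_comp, smul_apply] at this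
      rw [hv, map_sub, map_smul, ← this]
    rw [e1, e2, smul_sub, smul_smul, smul_smul]
    have : Complex.I * (z.im * Complex.I) = -z.im := by
      rw [mul_left_comm, Complex.I_mul_I]; ring
    rw [this, neg_smul, mul_comm Complex.I]
    abel
  have hreal : ∀ f : ℝ → ℝ, inner ℂ v (cfc f J v) = ((inner ℂ v (cfc f J v)).re : ℂ) := fun f => by
    have hs : IsSelfAdjoint (cfc f J) := IsSelfAdjoint.cfc
    have := (ContinuousLinearMap.isSelfAdjoint_iff_isSymmetric.1 hs).coe_re_inner_apply_self v
    have h2 := inner_conj_symm (𝕜 := ℂ) v (cfc f J v)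
    have h3 : inner ℂ (cfc f J v) v = inner ℂ v (cfc f J v) :=
      (ContinuousLinearMap.isSelfAdjoint_iff_isSymmetric.1 hs) v v
    rw [h3] at h2
    exact (Complex.conj_eq_iff_re.1 h2).symm
  have hgen : Integrable (fun x : ℝ => ((x : ℂ) - z)⁻¹) (spectralMeasure hJ v) := by
    have i1 := (integrable_spectralMeasure hJ v h₁).ofReal (𝕜 := ℂ)
    have i2 := ((integrable_spectralMeasure hJ v h₂).ofReal (𝕜 := ℂ)).mul_const Complex.I
    refine (i1.add i2).congr (Eventually.of_forall fun x => ?_)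
    exact Complex.re_add_im _
  rw [← integral_re_add_im hgen]
  conv_rhs => rw [hgv, inner_add_right, inner_smul_right, hreal f₁, hreal f₂,
    ← integral_spectralMeasure hJ v h₁, ← integral_spectralMeasure hJ v h₂]
  simp only [RCLike.I_to_complex]
  rw [mul_comm Complex.I]
  rfl

end Spectral


/-! ### The symmetrised generator on `ℓ²(ℤ)` -/

/-- The Hilbert space `ℓ²(ℤ)`. -/
abbrev L2Z : Type := lp (fun _ : ℤ => ℂ) 2

lemma memℓp_two_iff {f : ℤ → ℂ} : Memℓp f 2 ↔ Summable fun i => ‖f i‖ ^ 2 := by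
  rw [memℓp_gen_iff (by norm_num)]
  norm_num

lemma l2z_norm_sq (f : L2Z) : ‖f‖ ^ 2 = ∑' i, ‖f i‖ ^ 2 := by
  have := lp.norm_rpow_eq_tsum (p := 2) (by norm_num) f
  norm_num at this
  exact this

/-- Multiplication by a bounded real sequence. -/
def mulOp {a : ℤ → ℝ} {c : ℝ} (h : ∀ i, |a i| ≤ c) : L2Z →L[ℂ] L2Z :=
  have hle : ∀ (f : L2Z) i, ‖(a i : ℂ) * f i‖ ^ 2 ≤ c ^ 2 * ‖f i‖ ^ 2 := fun f i => by
    rw [norm_mul, Complex.norm_real, mul_pow, Real.norm_eq_abs]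
    exact mul_le_mul_of_nonneg_right (pow_le_pow_left₀ (abs_nonneg _) (h i) 2) (by positivity)
  have hs : ∀ f : L2Z, Summable fun i => ‖(a i : ℂ) * f i‖ ^ 2 := fun f =>
    Summable.of_nonneg_of_le (fun _ => by positivity) (hle f)
      ((memℓp_two_iff.1 (lp.memℓp f)).mul_left _)
  LinearMap.mkContinuous
    { toFun := fun f => ⟨fun i => a i * f i, memℓp_two_iff.2 (hs f)⟩
      map_add' := fun f g => by ext i; exact mul_add _ _ _
      map_smul' := fun z f => by ext i; simp [mul_left_comm] } c fun f => by
    have hc : 0 ≤ c := (abs_nonneg _).trans (h 0)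
    refine le_of_sq_le_sq ?_ (by positivity)
    rw [mul_pow, l2z_norm_sq, l2z_norm_sq, ← tsum_mul_left]
    exact (hs f).tsum_le_tsum (hle f) ((memℓp_two_iff.1 (lp.memℓp f)).mul_left _)

@[simp] lemma mulOp_apply {a : ℤ → ℝ} {c : ℝ} (h : ∀ i, |a i| ≤ c) (f : L2Z) (i : ℤ) :
    mulOp h f i = a i * f i := rfl

/-- The shift `f ↦ f (· + k)`. -/
def shiftOp (k : ℤ) : L2Z →L[ℂ] L2Z :=
  LinearMap.mkContinuous
    { toFun := fun f => ⟨fun i => f (i + k), memℓp_two_iff.2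
        ((memℓp_two_iff.1 (lp.memℓp f)).comp_injective (add_left_injective k))⟩
      map_add' := fun f g => by ext i; rfl
      map_smul' := fun z f => by ext i; simp } 1 fun f => by
    refine le_of_sq_le_sq ?_ (by positivity)
    rw [one_mul, l2z_norm_sq, l2z_norm_sq]
    exact ((Equiv.addRight k).tsum_eq fun i => ‖f i‖ ^ 2).le

@[simp] lemma shiftOp_apply (k : ℤ) (f : L2Z) (i : ℤ) : shiftOp k f i = f (i + k) := rfl

lemma adjoint_mulOp {a : ℤ → ℝ} {c : ℝ} (h : ∀ i, |a i| ≤ c) : star (mulOp h) = mulOp h := by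
  rw [ContinuousLinearMap.star_eq_adjoint]
  refine ((ContinuousLinearMap.eq_adjoint_iff _ _).2 fun f g => ?_).symm
  rw [lp.inner_eq_tsum, lp.inner_eq_tsum]
  refine tsum_congr fun i => ?_
  simp only [mulOp_apply, RCLike.inner_apply, map_mul, Complex.conj_ofReal]
  ring

lemma adjoint_shiftOp (k : ℤ) : star (shiftOp k) = shiftOp (-k) := by
  rw [ContinuousLinearMap.star_eq_adjoint]
  refine ((ContinuousLinearMap.eq_adjoint_iff _ _).2 fun f g => ?_).symm
  rw [lp.inner_eq_tsum, lp.inner_eq_tsum, ← (Equiv.addRight k).tsum_eq]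
  refine tsum_congr fun i => ?_
  simp

/-- Rates that are positive and bounded. -/
structure BoundedRates (b d : ℤ → ℝ) (M : ℝ) : Prop where
  birth_pos : ∀ n, 0 < b n
  death_pos : ∀ n, 0 < d n
  birth_le : ∀ n, b n ≤ M
  death_le : ∀ n, d n ≤ M

namespace BoundedRates

variable {b d : ℤ → ℝ} {M : ℝ} (h : BoundedRates b d M)
include h

lemma abs_sqrt_birth_le (i : ℤ) : |√(b i)| ≤ √M := by
  rw [abs_of_nonneg (Real.sqrt_nonneg _)]
  exact Real.sqrt_le_sqrt (h.birth_le i)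

lemma abs_sqrt_death_le (i : ℤ) : |√(d (i + 1))| ≤ √M := by
  rw [abs_of_nonneg (Real.sqrt_nonneg _)]
  exact Real.sqrt_le_sqrt (h.death_le _)

/-- The difference operator with `(D f) i = √(b i) f i - √(d (i + 1)) f (i + 1)`. -/
def diffOp : L2Z →L[ℂ] L2Z :=
  mulOp h.abs_sqrt_birth_le - mulOp h.abs_sqrt_death_le * shiftOp 1

/-- The negative of the symmetrised generator of the process. -/
def jacobi : L2Z →L[ℂ] L2Z := star h.diffOp * h.diffOp

lemma isSelfAdjoint_jacobi : IsSelfAdjoint h.jacobi := IsSelfAdjoint.star_mul_self _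

/-- This is what the factorisation through `diffOp` is for: it places the supports of all spectral
measures in [0, ∞). -/
lemma spectrum_jacobi_nonneg : ∀ x ∈ spectrum ℝ h.jacobi, 0 ≤ x :=
  spectrum_star_mul_self_nonneg

lemma jacobi_apply (f : L2Z) (i : ℤ) :
    h.jacobi f i = ((b i + d i : ℝ) : ℂ) * f i - (√(b i) * √(d (i + 1)) : ℝ) * f (i + 1) -
      (√(d i) * √(b (i - 1)) : ℝ) * f (i - 1) := by
  have hstar : star h.diffOp =
      mulOp h.abs_sqrt_birth_le - shiftOp (-1) * mulOp h.abs_sqrt_death_le := by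
    rw [diffOp, star_sub, star_mul, adjoint_mulOp, adjoint_mulOp, adjoint_shiftOp]
  have e1 : ((b i : ℝ) : ℂ) = (√(b i) : ℂ) * √(b i) := by
    rw [← Complex.ofReal_mul, Real.mul_self_sqrt (h.birth_pos i).le]
  have e2 : ((d i : ℝ) : ℂ) = (√(d i) : ℂ) * √(d i) := by
    rw [← Complex.ofReal_mul, Real.mul_self_sqrt (h.death_pos i).le]
  rw [jacobi, hstar, diffOp]
  simp only [mul_apply_eq_comp, sub_apply, lp.coeFn_sub, Pi.sub_apply, mulOp_apply, shiftOp_apply]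
  rw [← sub_eq_add_neg, sub_add_cancel]
  push_cast
  rw [e1, e2]
  ring

lemma potential_pos (i : ℤ) : 0 < potential b d i := by
  cases i with
  | ofNat n =>
    exact Finset.prod_pos fun m _ => div_pos (h.birth_pos _) (h.death_pos _)
  | negSucc n =>
    exact Finset.prod_pos fun m _ => div_pos (h.death_pos _) (h.birth_pos _)

/-- Detailed balance across the edge from i to i + 1. -/
lemma potential_succ (i : ℤ) :
    potential b d (i + 1) * d (i + 1) = potential b d i * b i := by
  cases i with
  | ofNat n =>
    have e : (Int.ofNat n) + 1 = Int.ofNat (n + 1) := rfl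
    have hd := (h.death_pos ((n : ℤ) + 1)).ne'
    rw [e]
    simp only [potential, Finset.prod_range_succ]
    simp only [Int.ofNat_eq_natCast, Nat.cast_add, Nat.cast_one]
    field_simp
  | negSucc n =>
    cases n with
    | zero =>
      have hb := (h.birth_pos (-1)).ne'
      have e : Int.negSucc 0 + 1 = Int.ofNat 0 := rfl
      rw [e]
      simp [potential, hb]
    | succ n =>
      have e : Int.negSucc (n + 1) + 1 = Int.negSucc n := rfl
      have e1 : Int.negSucc (n + 1) = -((n + 1 : ℕ) : ℤ) - 1 := by omega
      have e2 : Int.negSucc n = -((n + 1 : ℕ) : ℤ) := rfl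
      have hb := (h.birth_pos (-((n + 1 : ℕ) : ℤ) - 1)).ne'
      rw [e]
      simp only [potential, Finset.prod_range_succ _ (n + 1)]
      rw [e1, e2]
      field_simp

lemma sqrt_potential_pos (i : ℤ) : 0 < √(potential b d i) := Real.sqrt_pos.2 (h.potential_pos i)

lemma sqrt_potential_succ (i : ℤ) :
    √(potential b d (i + 1)) * √(d (i + 1)) = √(potential b d i) * √(b i) := by
  rw [← Real.sqrt_mul (h.potential_pos _).le, ← Real.sqrt_mul (h.potential_pos _).le,
    h.potential_succ]

/-- Dividing by √π undoes the symmetrisation and leaves minus the generator acting on R; resolvent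
equations can then be solved without square roots. -/
lemma jacobi_apply_of_eq {f : L2Z} {R : ℤ → ℂ} (hf : ∀ i, f i = √(potential b d i) * R i) (i : ℤ) :
    h.jacobi f i = √(potential b d i) *
      ((b i + d i) * R i - b i * R (i + 1) - d i * R (i - 1)) := by
  rw [jacobi_apply, hf, hf, hf]
  have e1 : √(b i) * √(d (i + 1)) * √(potential b d (i + 1)) = √(potential b d i) * b i := by
    rw [mul_assoc, mul_comm √(d (i + 1)), h.sqrt_potential_succ, mul_left_comm,
      Real.mul_self_sqrt (h.birth_pos i).le]
  have e2 : √(d i) * √(b (i - 1)) * √(potential b d (i - 1)) = √(potential b d i) * d i := by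
    have := h.sqrt_potential_succ (i - 1)
    rw [sub_add_cancel] at this
    rw [mul_assoc, mul_comm √(b (i - 1)), ← this, mul_left_comm,
      Real.mul_self_sqrt (h.death_pos i).le]
  have e1' := congrArg (fun x : ℝ => (x : ℂ)) e1
  have e2' := congrArg (fun x : ℝ => (x : ℂ)) e2
  push_cast at e1' e2' ⊢
  linear_combination (-R (i + 1)) * e1' - R (i - 1) * e2'

omit h in
/-- The normalised basis vectors `π_i^{-1/2} e_i`. -/
def basisVec (b d : ℤ → ℝ) (i : ℤ) : L2Z := lp.single 2 i ((√(potential b d i))⁻¹ : ℂ)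

omit h in
lemma basisVec_apply (b d : ℤ → ℝ) (i j : ℤ) :
    basisVec b d i j = if j = i then ((√(potential b d i))⁻¹ : ℂ) else 0 := by
  rw [basisVec, lp.single_apply, Pi.single_apply]

omit h in
lemma inner_basisVec (b d : ℤ → ℝ) (i : ℤ) (f : L2Z) :
    inner ℂ (basisVec b d i) f = (√(potential b d i))⁻¹ * f i := by
  rw [basisVec, lp.inner_single_left, RCLike.inner_apply]
  simp [mul_comm]

lemma inner_basisVec_basisVec (i j : ℤ) :
    inner ℂ (basisVec b d i) (basisVec b d j) = if i = j then ((potential b d i)⁻¹ : ℂ) else 0 := by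
  rw [inner_basisVec, basisVec_apply]
  split_ifs with hij
  · subst hij
    rw [Complex.ofReal_inv, ← mul_inv, ← Complex.ofReal_mul,
      Real.mul_self_sqrt (h.potential_pos i).le]
  · simp

/-- The normalisation by π^{-1/2} makes the coefficients those of row j of the generator. Hence the
vectors obey both the recurrence of the polynomials and the backward equation. -/
lemma jacobi_basisVec (j : ℤ) :
    h.jacobi (basisVec b d j) = ((b j + d j : ℝ) : ℂ) • basisVec b d j -
      (b j : ℂ) • basisVec b d (j + 1) - (d j : ℂ) • basisVec b d (j - 1) := by
  have hne : ∀ i, (√(potential b d i) : ℂ) ≠ 0 := fun i => by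
    exact_mod_cast (h.sqrt_potential_pos i).ne'
  have key : ∀ i j, basisVec b d j i = √(potential b d i) *
      (if i = j then ((potential b d j)⁻¹ : ℂ) else 0) := fun i j => by
    rw [basisVec_apply]
    split_ifs with hij
    · subst hij
      have : ((potential b d i : ℝ) : ℂ) = √(potential b d i) * √(potential b d i) := by
        rw [← Complex.ofReal_mul, Real.mul_self_sqrt (h.potential_pos i).le]
      rw [this]
      have := hne i
      field_simp
    · simp
  have hp : ∀ i, ((potential b d i : ℝ) : ℂ) ≠ 0 := fun i => by
    exact_mod_cast (h.potential_pos i).ne'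
  have hbd : ∀ i : ℤ, ((potential b d i : ℝ) : ℂ)⁻¹ * d (i + 1) =
      ((potential b d (i + 1) : ℝ) : ℂ)⁻¹ * b i := fun i => by
    have := h.potential_succ i
    rw [inv_mul_eq_div, inv_mul_eq_div, div_eq_div_iff (hp _) (hp _)]
    rw [← Complex.ofReal_mul, ← Complex.ofReal_mul]
    congr 1; linarith
  ext i
  rw [h.jacobi_apply_of_eq (fun i => key i j)]
  simp only [lp.coeFn_sub, lp.coeFn_smul, Pi.sub_apply, Pi.smul_apply, smul_eq_mul, key i]
  rcases eq_or_ne i j with rfl | h1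
  · simp [show ¬ i = i - 1 by omega]
    ring
  rcases eq_or_ne i (j + 1) with rfl | h2
  · have := hbd j
    simp only [if_true, show ¬ j + 1 + 1 = j by omega, show ¬ j + 1 = j - 1 by omega,
      show ¬ j + 1 = j by omega, add_sub_cancel_right, if_false]
    linear_combination (-(√(potential b d (j + 1)) : ℂ)) * this
  rcases eq_or_ne i (j - 1) with rfl | h3
  · have := hbd (j - 1)
    rw [sub_add_cancel] at this
    simp only [if_true, show ¬ j - 1 - 1 = j by omega, show ¬ j - 1 = j + 1 by omega,
      show ¬ j - 1 = j by omega, sub_add_cancel, if_false]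
    linear_combination (√(potential b d (j - 1)) : ℂ) * this
  have h4 : i + 1 ≠ j := by omega
  have h5 : i - 1 ≠ j := by omega
  simp [h1, h2, h3, h4, h5]

end BoundedRates


/-! ### Uniqueness of Laplace transforms -/

lemma vectorIntegral_toSignedMeasure (ρ : Measure ℝ) [IsFiniteMeasure ρ] (f : ℝ → ℝ) :
    ∫ᵛ x, f x ∂•ρ.toSignedMeasure = ∫ x, f x ∂ρ := by
  have h : (ContinuousLinearMap.lsmul ℝ ℝ : ℝ →L[ℝ] ℝ →L[ℝ] ℝ) =
      (ContinuousLinearMap.lsmul ℝ ℝ).flip := by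
    ext; simp
  rw [h]
  exact VectorMeasure.integral_toSignedMeasure

/-- Push forward to [0, 1] by x ↦ e^{-x}: Laplace transforms at natural numbers become moments, and
polynomials form a separating algebra of functions on [0, 1]. The map -log recovers the original
measures. -/
lemma measure_eq_of_laplace {μ ν : Measure ℝ} [IsFiniteMeasure μ] [IsFiniteMeasure ν]
    (hμ : μ (Set.Iio 0) = 0) (hν : ν (Set.Iio 0) = 0)
    (h : ∀ t : ℝ, 0 ≤ t → ∫ x, Real.exp (-x * t) ∂μ = ∫ x, Real.exp (-x * t) ∂ν) : μ = ν := by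
  set φ : ℝ → unitInterval := fun x => Set.projIcc 0 1 zero_le_one (Real.exp (-x)) with hφdef
  have hφ : Continuous φ := continuous_projIcc.comp (by fun_prop)
  have hφv : ∀ x : ℝ, 0 ≤ x → (φ x : ℝ) = Real.exp (-x) := fun x hx => by
    rw [hφdef]
    simp only
    rw [Set.projIcc_of_mem zero_le_one ⟨(Real.exp_pos _).le, Real.exp_le_one_iff.2 (by linarith)⟩]
  let A : StarSubalgebra ℝ (BoundedContinuousFunction unitInterval ℝ) :=
    { carrier := {g | ∃ p : ℝ[X], ∀ x, g x = p.eval (x : ℝ)}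
      mul_mem' := by
        rintro a b ⟨p, hp⟩ ⟨q, hq⟩
        exact ⟨p * q, fun x => by simp [hp, hq]⟩
      add_mem' := by
        rintro a b ⟨p, hp⟩ ⟨q, hq⟩
        exact ⟨p + q, fun x => by simp [hp, hq]⟩
      algebraMap_mem' := fun r => ⟨C r, fun x => by simp⟩
      star_mem' := by
        rintro a ⟨p, hp⟩
        exact ⟨p, fun x => by simp [hp]⟩ }
  have hint : ∀ (κ : Measure ℝ) [IsFiniteMeasure κ], κ (Set.Iio 0) = 0 → ∀ p : ℝ[X],
      ∫ x, p.eval (φ x : ℝ) ∂κ =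
        ∑ n ∈ Finset.range (p.natDegree + 1), p.coeff n * ∫ x, Real.exp (-x * n) ∂κ := by
    intro κ _ hκ p
    have hae : ∀ᵐ x ∂κ, 0 ≤ x := by rw [ae_iff]; simpa [Set.Iio] using hκ
    simp only [← integral_const_mul]
    rw [← integral_finsetSum]
    · refine integral_congr_ae (hae.mono fun x hx => ?_)
      beta_reduce
      rw [eval_eq_sum_range, hφv x hx]
      refine Finset.sum_congr rfl fun n _ => ?_
      rw [← Real.exp_nat_mul, mul_comm (n : ℝ)]
    · refine fun n _ => Integrable.const_mul ?_ _
      refine Integrable.of_bound (C := 1) (by fun_prop) (hae.mono fun x hx => ?_)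
      rw [Real.norm_of_nonneg (Real.exp_pos _).le, Real.exp_le_one_iff]
      have : 0 ≤ x * (n : ℝ) := by positivity
      linarith
  have key : μ.map φ = ν.map φ := by
    refine ext_of_forall_mem_subalgebra_integral_eq_of_polish (𝕜 := ℝ) (A := A) ?_ ?_
    · intro x y hxy
      let X₀ : BoundedContinuousFunction unitInterval ℝ :=
        BoundedContinuousFunction.mkOfCompact ⟨fun x => (x : ℝ), by fun_prop⟩
      refine ⟨fun x => (x : ℝ), ⟨X₀, ⟨X₀, ⟨X, fun x => by simp [X₀]⟩, rfl⟩, rfl⟩, ?_⟩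
      exact fun hh => hxy (Subtype.ext hh)
    · rintro g ⟨p, hp⟩
      rw [integral_map hφ.aemeasurable g.continuous.aestronglyMeasurable,
        integral_map hφ.aemeasurable g.continuous.aestronglyMeasurable]
      simp only [hp]
      rw [hint μ hμ, hint ν hν]
      refine Finset.sum_congr rfl fun n _ => ?_
      rw [h n (Nat.cast_nonneg n)]
  have hback : ∀ (κ : Measure ℝ), κ (Set.Iio 0) = 0 →
      (κ.map φ).map (fun y : unitInterval => -Real.log y) = κ := by
    intro κ hκ
    have hae : ∀ᵐ x ∂κ, 0 ≤ x := by rw [ae_iff]; simpa [Set.Iio] using hκ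
    rw [Measure.map_map (by fun_prop) hφ.measurable]
    conv_rhs => rw [← Measure.map_id (μ := κ)]
    refine Measure.map_congr (hae.mono fun x hx => ?_)
    simp [hφv x hx]
  rw [← hback μ hμ, ← hback ν hν, key]

lemma variation_Iio {s : SignedMeasure ℝ} (hs : ∀ E, MeasurableSet E → E ⊆ Set.Iio 0 → s E = 0) :
    s.variation (Set.Iio 0) = 0 :=
  (VectorMeasure.variation_apply_eq_zero measurableSet_Iio).2 fun t ht hm => hs t hm ht

instance isFiniteMeasure_variation (s : SignedMeasure ℝ) : IsFiniteMeasure s.variation := by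
  rw [← SignedMeasure.totalVariation_eq_variation]; infer_instance

lemma signedMeasure_eq_sub (s : SignedMeasure ℝ) :
    s = s.toJordanDecomposition.posPart.toSignedMeasure -
      s.toJordanDecomposition.negPart.toSignedMeasure :=
  (SignedMeasure.toSignedMeasure_toJordanDecomposition s).symm

lemma integrable_laplace {s : SignedMeasure ℝ}
    (hs : ∀ E, MeasurableSet E → E ⊆ Set.Iio 0 → s E = 0) {t : ℝ} (ht : 0 ≤ t) :
    s.Integrable fun x => Real.exp (-x * t) := by
  have hae : ∀ᵐ x ∂s.variation, 0 ≤ x := by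
    rw [ae_iff]; simpa [Set.Iio] using variation_Iio hs
  refine Integrable.of_bound (C := 1) (by fun_prop) (hae.mono fun x hx => ?_)
  rw [Real.norm_of_nonneg (Real.exp_pos _).le, Real.exp_le_one_iff]
  have : 0 ≤ x * t := by positivity
  linarith

lemma vectorIntegral_eq_sub {s : SignedMeasure ℝ} {f : ℝ → ℝ} (hf : s.Integrable f) :
    ∫ᵛ x, f x ∂•s = ∫ x, f x ∂s.toJordanDecomposition.posPart -
      ∫ x, f x ∂s.toJordanDecomposition.negPart := by
  rw [VectorMeasure.Integrable, ← SignedMeasure.totalVariation_eq_variation,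
    SignedMeasure.totalVariation, integrable_add_measure] at hf
  conv_lhs => rw [signedMeasure_eq_sub s]
  rw [VectorMeasure.integral_sub_vectorMeasure, vectorIntegral_toSignedMeasure,
    vectorIntegral_toSignedMeasure]
  · rw [VectorMeasure.Integrable, Measure.variation_toSignedMeasure]; exact hf.1
  · rw [VectorMeasure.Integrable, Measure.variation_toSignedMeasure]; exact hf.2

/-- Moving the negative Jordan parts to the opposite sides turns the claim into one about positive
measures. -/
lemma signedMeasure_eq_of_laplace {s₁ s₂ : SignedMeasure ℝ}
    (h₁ : ∀ E, MeasurableSet E → E ⊆ Set.Iio 0 → s₁ E = 0)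
    (h₂ : ∀ E, MeasurableSet E → E ⊆ Set.Iio 0 → s₂ E = 0)
    (h : ∀ t : ℝ, 0 ≤ t →
      ∫ᵛ x, Real.exp (-x * t) ∂•s₁ = ∫ᵛ x, Real.exp (-x * t) ∂•s₂) : s₁ = s₂ := by
  set p₁ := s₁.toJordanDecomposition.posPart
  set n₁ := s₁.toJordanDecomposition.negPart
  set p₂ := s₂.toJordanDecomposition.posPart
  set n₂ := s₂.toJordanDecomposition.negPart
  have z₁ := variation_Iio h₁
  have z₂ := variation_Iio h₂
  rw [← SignedMeasure.totalVariation_eq_variation, SignedMeasure.totalVariation,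
    Measure.add_apply, add_eq_zero] at z₁ z₂
  have hsum : p₁ + n₂ = p₂ + n₁ := by
    refine measure_eq_of_laplace ?_ ?_ fun t ht => ?_
    · rw [Measure.add_apply, z₁.1, z₂.2, add_zero]
    · rw [Measure.add_apply, z₂.1, z₁.2, add_zero]
    · have i₁ := integrable_laplace h₁ ht
      have i₂ := integrable_laplace h₂ ht
      have e := h t ht
      rw [vectorIntegral_eq_sub i₁, vectorIntegral_eq_sub i₂] at e
      rw [VectorMeasure.Integrable, ← SignedMeasure.totalVariation_eq_variation,
        SignedMeasure.totalVariation, integrable_add_measure] at i₁ i₂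
      rw [integral_add_measure i₁.1 i₂.2, integral_add_measure i₂.1 i₁.2]
      linarith
  rw [signedMeasure_eq_sub s₁, signedMeasure_eq_sub s₂, sub_eq_sub_iff_add_eq_add,
    ← Measure.toSignedMeasure_add, ← Measure.toSignedMeasure_add]
  exact Measure.toSignedMeasure_congr hsum

/-! ### The Karlin–McGregor representation -/

/-- A self-adjoint operator `J` on a Hilbert space with vectors `f i` on which it acts as the
negative of the generator of the birth-death process, in the normalisation `⟪f i, f i⟫ = 1 / π i`. -/
structure JacobiModel (b d : ℤ → ℝ) (M : ℝ) {H : Type*} [NormedAddCommGroup H]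
    [InnerProductSpace ℂ H] [CompleteSpace H] (J : H →L[ℂ] H) (f : ℤ → H) : Prop where
  rates : BoundedRates b d M
  isSelfAdjoint : IsSelfAdjoint J
  spectrum_nonneg : ∀ x ∈ spectrum ℝ J, 0 ≤ x
  map_vec : ∀ j, J (f j) = ((b j + d j : ℝ) : ℂ) • f j - (b j : ℂ) • f (j + 1) -
    (d j : ℂ) • f (j - 1)
  inner_vec : ∀ i j, inner ℂ (f i) (f j) = if i = j then ((potential b d i)⁻¹ : ℂ) else 0

lemma BoundedRates.jacobiModel {b d : ℤ → ℝ} {M : ℝ} (h : BoundedRates b d M) :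
    JacobiModel b d M h.jacobi (BoundedRates.basisVec b d) :=
  ⟨h, h.isSelfAdjoint_jacobi, h.spectrum_jacobi_nonneg, h.jacobi_basisVec,
    h.inner_basisVec_basisVec⟩

namespace JacobiModel

variable {b d : ℤ → ℝ} {M : ℝ} {H : Type*} [NormedAddCommGroup H]
    [InnerProductSpace ℂ H] [CompleteSpace H] {J : H →L[ℂ] H} {f : ℤ → H}

/-- The two generating vectors, in the states `0` and `-1`. -/
def genVec (f : ℤ → H) (k : Fin 2) : H := f (if k = 0 then 0 else -1)

/-- The semigroup generated by `-J`. -/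
def semigroup (J : H →L[ℂ] H) (t : ℝ) : H →L[ℂ] H := NormedSpace.exp (t • (-J))

/-- The spectral form of the transition probabilities. -/
def spectralProb (b d : ℤ → ℝ) (J : H →L[ℂ] H) (f : ℤ → H) (i j : ℤ) (t : ℝ) : ℝ :=
  potential b d j * (inner ℂ (f i) (semigroup J t (f j))).re

variable (h : JacobiModel b d M J f)
include h

/-- Both sides satisfy the same three-term recurrence with nonvanishing outer coefficients and agree
at 0 and -1. -/
lemma vec_eq_sum {Q : Fin 2 → ℤ → ℝ[X]} (hQ : IsGeneratedFamily b d Q) (i : ℤ) :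
    f i = ∑ k, cfc (fun x => (Q k i).eval x) J (genVec f k) := by
  have hJ := h.isSelfAdjoint
  simp only [cfc_polynomial _ J hJ]
  set V : ℤ → H := fun i => ∑ k, aeval J (Q k i) (genVec f k) with hV
  have hsm : ∀ (r : ℝ) (T : H →L[ℂ] H) (v : H),
      (algebraMap ℝ (H →L[ℂ] H) r * T) v = r • T v := fun r T v => by
    rw [Algebra.algebraMap_eq_smul_one, smul_mul_assoc, one_mul]; rfl
  have hrec : ∀ i, -(J (V i)) = b i • V (i + 1) - (b i + d i) • V i + d i • V (i - 1) := by
    intro i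
    simp only [hV, map_sum, Finset.smul_sum, ← Finset.sum_neg_distrib, ← Finset.sum_sub_distrib,
      ← Finset.sum_add_distrib]
    refine Finset.sum_congr rfl fun k _ => ?_
    have := congrArg (fun p => aeval J p (genVec f k)) (hQ.recurrence k i)
    simp only [map_neg, map_mul, map_add, map_sub, aeval_X, aeval_C, add_apply, sub_apply,
      neg_apply, hsm, add_mul] at this
    rw [mul_apply_eq_comp] at this
    rw [add_smul]
    exact this
  have hrec2 : ∀ i, -(J (f i)) =
      b i • f (i + 1) - (b i + d i) • f i + d i • f (i - 1) := by
    intro i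
    rw [h.map_vec]
    simp only [Complex.coe_smul]
    abel
  have key : ∀ i : ℤ, f i = V i ∧ f (i - 1) = V (i - 1) := by
    intro i
    induction i using Int.induction_on with
    | zero =>
      constructor
      · simp [hV, hQ.first_zero, hQ.second_zero, genVec]
      · simp [hV, hQ.first_neg_one, hQ.second_neg_one, genVec]
    | succ i ih =>
      rw [add_sub_cancel_right]
      refine ⟨?_, ih.1⟩
      have e1 := hrec i
      have e2 := hrec2 i
      rw [ih.1, ih.2, e1] at e2
      have e3 : b i • V (i + 1) = b i • f (i + 1) := by
        simpa using e2
      exact (smul_right_injective _ (h.rates.birth_pos i).ne' e3).symm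
    | pred i ih =>
      refine ⟨ih.2, ?_⟩
      have e1 := hrec (-i - 1)
      have e2 := hrec2 (-i - 1)
      rw [sub_add_cancel] at e1 e2
      rw [ih.1, ih.2, e1] at e2
      have e3 : d (-i - 1) • V (-i - 1 - 1) = d (-i - 1) • f (-i - 1 - 1) := by
        simpa using e2
      exact (smul_right_injective _ (h.rates.death_pos _).ne' e3).symm
  exact (key i).1

lemma semigroup_eq_cfc (t : ℝ) : semigroup J t = cfc (fun x => Real.exp (-x * t)) J := by
  have hJ := h.isSelfAdjoint
  have h1 : t • (-J) = cfc (fun x : ℝ => -t * x) J := by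
    rw [cfc_const_mul_id (-t) J hJ, smul_neg, neg_smul]
  have h2 : IsSelfAdjoint (cfc (fun x : ℝ => -t * x) J) := IsSelfAdjoint.cfc
  rw [semigroup, h1, ← CFC.real_exp_eq_normedSpace_exp h2,
    ← cfc_comp' Real.exp (fun x : ℝ => -t * x) J]
  refine cfc_congr fun x _ => ?_
  simp [mul_comm]

lemma spectralProb_zero (i j : ℤ) : spectralProb b d J f i j 0 = if i = j then 1 else 0 := by
  rw [spectralProb, semigroup, zero_smul, NormedSpace.exp_zero, one_apply_eq_self,
    h.inner_vec]
  split_ifs with hij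
  · subst hij
    rw [← Complex.ofReal_inv, Complex.ofReal_re, mul_inv_cancel₀ (h.rates.potential_pos i).ne']
  · simp

/-- Self-adjointness moves J from the semigroup onto `f i`, where it acts by the rates of state i;
this yields the backward rather than the forward equation. -/
lemma hasDerivAt_spectralProb (i j : ℤ) (t : ℝ) :
    HasDerivAt (spectralProb b d J f i j) (b i * spectralProb b d J f (i + 1) j t -
      (b i + d i) * spectralProb b d J f i j t + d i * spectralProb b d J f (i - 1) j t) t := by
  have h1 := hasDerivAt_exp_smul_const' (-J) t
  set L : (H →L[ℂ] H) →L[ℝ] ℝ := Complex.reCLM.comp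
    (((innerSL ℂ (f i)).comp
      (ContinuousLinearMap.apply ℂ H (f j))).restrictScalars ℝ) with hL
  have hLv : ∀ T, L T = (inner ℂ (f i) (T (f j))).re := fun T => rfl
  have h2 := (L.hasFDerivAt.comp_hasDerivAt t h1).const_mul (potential b d j)
  convert! h2 using 1
  rw [hLv, mul_apply_eq_comp, neg_apply, inner_neg_right]
  have hsym := (ContinuousLinearMap.isSelfAdjoint_iff_isSymmetric.1 h.isSelfAdjoint)
    (f i) (semigroup J t (f j))
  have hsym' : inner ℂ (f i) (J (semigroup J t (f j))) =
    inner ℂ (J (f i)) (semigroup J t (f j)) := hsym.symm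
  change _ = potential b d j * (-(inner ℂ (f i) (J (semigroup J t (f j))))).re
  rw [hsym', h.map_vec, inner_sub_left, inner_sub_left, inner_smul_left, inner_smul_left,
    inner_smul_left]
  simp only [spectralProb, semigroup, Complex.conj_ofReal, Complex.neg_re, Complex.sub_re,
    Complex.re_ofReal_mul]
  ring

lemma continuous_spectralProb (i j : ℤ) : Continuous (spectralProb b d J f i j) :=
  continuous_iff_continuousAt.2 fun t => (h.hasDerivAt_spectralProb i j t).continuousAt

/-- Variation of constants with the integrating factor of the diagonal rate. -/
lemma spectralProb_backward (i j : ℤ) (t : ℝ) :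
    spectralProb b d J f i j t = (if i = j then 1 else 0) * Real.exp (-((b i + d i) * t)) +
      ∫ r in (0 : ℝ)..t, Real.exp (-((b i + d i) * (t - r))) *
        (b i * spectralProb b d J f (i + 1) j r + d i * spectralProb b d J f (i - 1) j r) := by
  have hc := h.continuous_spectralProb
  have hderiv : ∀ r, HasDerivAt (fun r => Real.exp (-((b i + d i) * (t - r))) *
      spectralProb b d J f i j r) (Real.exp (-((b i + d i) * (t - r))) *
        (b i * spectralProb b d J f (i + 1) j r + d i * spectralProb b d J f (i - 1) j r)) r := by
    intro r
    have h1 : HasDerivAt (fun r => -((b i + d i) * (t - r))) (b i + d i) r := by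
      have := (((hasDerivAt_id r).const_sub t).const_mul (b i + d i)).neg
      simpa [Pi.neg_def] using this
    convert! h1.exp.mul (h.hasDerivAt_spectralProb i j r) using 1
    ring
  have := intervalIntegral.integral_eq_sub_of_hasDerivAt (a := 0) (b := t) (fun r _ => hderiv r)
    (Continuous.intervalIntegrable (by have := hc (i + 1) j; have := hc (i - 1) j; fun_prop) _ _)
  rw [this, h.spectralProb_zero]
  simp

lemma norm_vec (i : ℤ) : ‖f i‖ = (√(potential b d i))⁻¹ := by
  have h1 := inner_self_eq_norm_sq_to_K (𝕜 := ℂ) (f i)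
  rw [h.inner_vec, if_pos rfl, ← Complex.ofReal_inv] at h1
  have h2 : (potential b d i)⁻¹ = ‖f i‖ ^ 2 := by
    rw [← RCLike.ofReal_pow] at h1
    exact Complex.ofReal_injective h1
  rw [← Real.sqrt_inv, h2, Real.sqrt_sq (norm_nonneg _)]

/-- The Karlin–McGregor formula in operator form. -/
theorem transProb_eq_spectralProb {K c : ℝ} (hc : 1 ≤ c)
    (hgrow : ∀ i, (√(potential b d i))⁻¹ ≤ K * c ^ i.natAbs) (i j : ℤ) {t : ℝ} (ht : 0 ≤ t) :
    transProb b d i j t = spectralProb b d J f i j t := by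
  have hsc : Continuous fun r : ℝ => ‖semigroup J r‖ := by
    have : Continuous fun r : ℝ => semigroup J r :=
      continuous_iff_continuousAt.2 fun r =>
        (hasDerivAt_exp_smul_const' (-J) r).continuousAt
    exact this.norm
  obtain ⟨B, hB⟩ := (isCompact_Icc (a := (0 : ℝ)) (b := t)).exists_bound_of_continuousOn
    hsc.continuousOn
  have hK : 0 ≤ K := by
    have := (inv_nonneg.2 (Real.sqrt_nonneg (potential b d 0))).trans (hgrow 0)
    simpa using this
  have hB0 : 0 ≤ B := (norm_nonneg _).trans (hB 0 ⟨le_rfl, ht⟩)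
  set C := potential b d j * (K * (B * ‖f j‖)) with hC
  have hC0 : 0 ≤ C := by have := (h.rates.potential_pos j).le; positivity
  -- The difference solves the homogeneous integral equation. The vector `f i` has norm π_i^{-1/2},
  -- which may grow geometrically, so uniqueness is needed in the class weighted by c^|i| and not
  -- only for bounded families.
  have hzero := backward_unique h.rates.birth_pos h.rates.death_pos h.rates.birth_le h.rates.death_le
    (G := fun i t => transProb b d i j t - spectralProb b d J f i j t) (T := t) (K := 1 + C) hc ?_ ?_
    i t ⟨ht, le_rfl⟩
  · exact sub_eq_zero.1 hzero
  · intro i r hr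
    have h1 : |transProb b d i j r| ≤ c ^ i.natAbs := by
      rw [transProb, abs_of_nonneg measureReal_nonneg]
      exact measureReal_le_one.trans (one_le_pow₀ hc)
    have h2 : |spectralProb b d J f i j r| ≤ C * c ^ i.natAbs := by
      rw [spectralProb, abs_mul, abs_of_pos (h.rates.potential_pos j), hC, mul_assoc]
      refine mul_le_mul_of_nonneg_left ?_ (h.rates.potential_pos j).le
      have hBr : ‖semigroup J r‖ ≤ B := by simpa using hB r hr
      calc |(inner ℂ (f i) (semigroup J r (f j))).re|
          ≤ ‖inner ℂ (f i) (semigroup J r (f j))‖ := Complex.abs_re_le_norm _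
        _ ≤ ‖f i‖ * ‖semigroup J r (f j)‖ := norm_inner_le_norm _ _
        _ ≤ (K * c ^ i.natAbs) * (B * ‖f j‖) := by
            refine mul_le_mul ((h.norm_vec i).trans_le (hgrow i)) ?_ (norm_nonneg _)
              (by positivity)
            exact (ContinuousLinearMap.le_opNorm _ _).trans
              (mul_le_mul_of_nonneg_right hBr (norm_nonneg _))
        _ = _ := by ring
    calc _ ≤ |transProb b d i j r| + |spectralProb b d J f i j r| := abs_sub _ _
      _ ≤ _ := by linarith
  · intro i r hr
    have e1 := stateIn_backward h.rates.birth_pos h.rates.death_pos i hr.1 {j}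
    have e2 := h.spectralProb_backward i j r
    have hP : ∀ k s, transProb b d k j s = noiseLaw.real (stateIn b d k s {j}) := fun k s => rfl
    simp only [← hP] at e1
    rw [e1, e2]
    simp only [Set.mem_singleton_iff]
    have hPm : ∀ k, Measurable fun s => transProb b d k j s := fun k =>
      (measurable_stateIn b d k {j}).ennreal_toReal
    have i1 : IntervalIntegrable (fun s => Real.exp (-((b i + d i) * (r - s))) *
        (b i * transProb b d (i + 1) j s + d i * transProb b d (i - 1) j s)) volume 0 r := by
      have hcc : IntervalIntegrable (fun s => Real.exp (-((b i + d i) * (r - s))) * (b i + d i))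
          volume 0 r := Continuous.intervalIntegrable (by fun_prop) _ _
      refine hcc.mono_fun (by have := hPm (i + 1); have := hPm (i - 1); fun_prop)
        (Eventually.of_forall fun s => ?_)
      have hb := h.rates.birth_pos i
      have hd := h.rates.death_pos i
      have p1 : 0 ≤ transProb b d (i + 1) j s := measureReal_nonneg
      have p2 : 0 ≤ transProb b d (i - 1) j s := measureReal_nonneg
      have p3 : transProb b d (i + 1) j s ≤ 1 := measureReal_le_one
      have p4 : transProb b d (i - 1) j s ≤ 1 := measureReal_le_one
      beta_reduce
      rw [Real.norm_of_nonneg (by positivity), Real.norm_of_nonneg (by positivity)]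
      gcongr
      · exact mul_le_of_le_one_right hb.le p3
      · exact mul_le_of_le_one_right hd.le p4
    have i2 : IntervalIntegrable (fun s => Real.exp (-((b i + d i) * (r - s))) *
        (b i * spectralProb b d J f (i + 1) j s + d i * spectralProb b d J f (i - 1) j s)) volume 0 r := by
      have := h.continuous_spectralProb (i + 1) j
      have := h.continuous_spectralProb (i - 1) j
      exact Continuous.intervalIntegrable (by fun_prop) _ _
    rw [add_sub_add_left_eq_sub, ← intervalIntegral.integral_sub i1 i2]
    refine intervalIntegral.integral_congr fun s _ => ?_
    ring

end JacobiModel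


/-! ### Existence and uniqueness of the spectral matrix -/

/-- Two spectral matrices of the same process coincide. -/
lemma IsSpectralMatrix.unique {b d : ℤ → ℝ} {Q : Fin 2 → ℤ → ℝ[X]} (hQ : IsGeneratedFamily b d Q)
    (hpot : ∀ i, potential b d i ≠ 0) {Ψ₁ Ψ₂ : Fin 2 → Fin 2 → SignedMeasure ℝ}
    (h₁ : IsSpectralMatrix b d Q Ψ₁) (h₂ : IsSpectralMatrix b d Q Ψ₂) : Ψ₁ = Ψ₂ := by
  -- In the states 0 and -1 the polynomials are 0 or 1, so exactly one entry of the matrix survives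
  -- in the formula.
  have key : ∀ Ψ, IsSpectralMatrix b d Q Ψ → ∀ k l : Fin 2, ∀ t : ℝ, 0 ≤ t →
      ∫ᵛ x, Real.exp (-x * t) ∂•(Ψ k l) =
        transProb b d (if k = 0 then 0 else -1) (if l = 0 then 0 else -1) t /
          potential b d (if l = 0 then 0 else -1) := by
    intro Ψ hΨ k l t ht
    rw [hΨ.karlinMcGregor _ _ t ht, mul_div_cancel_left₀ _ (hpot _)]
    fin_cases k <;> fin_cases l <;>
      simp [Fin.sum_univ_two, hQ.first_zero, hQ.second_zero, hQ.first_neg_one, hQ.second_neg_one]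
  funext k l
  refine signedMeasure_eq_of_laplace (h₁.support k l) (h₂.support k l) fun t ht => ?_
  rw [key _ h₁ k l t ht, key _ h₂ k l t ht]

namespace JacobiModel

variable {b d : ℤ → ℝ} {M : ℝ} {H : Type*} [NormedAddCommGroup H]
    [InnerProductSpace ℂ H] [CompleteSpace H] {J : H →L[ℂ] H} {f : ℤ → H}

variable (h : JacobiModel b d M J f)
include h

/-- The matrix of spectral measures of the two generating vectors. -/
def specMat (k l : Fin 2) : SignedMeasure ℝ :=
  if k = l then (spectralMeasure h.isSelfAdjoint (genVec f k)).toSignedMeasure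
  else (1 / 2 : ℝ) •
    ((spectralMeasure h.isSelfAdjoint (genVec f 0 + genVec f 1)).toSignedMeasure -
      (spectralMeasure h.isSelfAdjoint (genVec f 0)).toSignedMeasure -
      (spectralMeasure h.isSelfAdjoint (genVec f 1)).toSignedMeasure)

lemma specMat_zero : h.specMat 0 0 =
    (spectralMeasure h.isSelfAdjoint (genVec f 0)).toSignedMeasure := rfl

lemma specMat_one : h.specMat 1 1 =
    (spectralMeasure h.isSelfAdjoint (genVec f 1)).toSignedMeasure := rfl

lemma specMat_off {k l : Fin 2} (hkl : k ≠ l) : h.specMat k l = (1 / 2 : ℝ) •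
    ((spectralMeasure h.isSelfAdjoint (genVec f 0 + genVec f 1)).toSignedMeasure -
      (spectralMeasure h.isSelfAdjoint (genVec f 0)).toSignedMeasure -
      (spectralMeasure h.isSelfAdjoint (genVec f 1)).toSignedMeasure) := if_neg hkl

lemma specMat_symm (k l : Fin 2) : h.specMat k l = h.specMat l k := by
  rcases eq_or_ne k l with rfl | hkl
  · rfl
  · rw [h.specMat_off hkl, h.specMat_off hkl.symm]

lemma integrable_toSigned (v : H) {φ : ℝ → ℝ} (hφ : ContinuousOn φ (spectrum ℝ J)) :
    (spectralMeasure h.isSelfAdjoint v).toSignedMeasure.Integrable φ := by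
  rw [VectorMeasure.Integrable, Measure.variation_toSignedMeasure]
  exact integrable_spectralMeasure h.isSelfAdjoint v hφ

lemma integrable_specMat (k l : Fin 2) {φ : ℝ → ℝ} (hφ : ContinuousOn φ (spectrum ℝ J)) :
    (h.specMat k l).Integrable φ := by
  have hi := fun v => h.integrable_toSigned v hφ
  rw [specMat]
  split_ifs
  · exact hi _
  · exact (((hi _).sub_vectorMeasure (hi _)).sub_vectorMeasure (hi _)).smul_vectorMeasure _

omit h in
lemma re_inner_symm {A : H →L[ℂ] H} (hA : IsSelfAdjoint A) (u v : H) :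
    (inner ℂ u (A v)).re = (inner ℂ v (A u)).re := by
  have := (ContinuousLinearMap.isSelfAdjoint_iff_isSymmetric.1 hA) v u
  have h2 : inner ℂ v (A u) = inner ℂ (A v) u := this.symm
  rw [h2, ← inner_conj_symm, Complex.conj_re]

lemma integral_specMat (k l : Fin 2) {φ : ℝ → ℝ} (hφ : ContinuousOn φ (spectrum ℝ J)) :
    ∫ᵛ x, φ x ∂•(h.specMat k l) = (inner ℂ (genVec f k) (cfc φ J (genVec f l))).re := by
  have hi := fun v => h.integrable_toSigned v hφ
  have hv : ∀ v, ∫ᵛ x, φ x ∂•(spectralMeasure h.isSelfAdjoint v).toSignedMeasure =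
      (inner ℂ v (cfc φ J v)).re := fun v => by
    rw [vectorIntegral_toSignedMeasure, integral_spectralMeasure _ _ hφ]
  have hs := re_inner_symm (IsSelfAdjoint.cfc (f := φ) (a := J)) (genVec f 0) (genVec f 1)
  rcases eq_or_ne k l with rfl | hkl
  · rw [specMat, if_pos rfl, hv]
  · rw [h.specMat_off hkl, VectorMeasure.integral_smul_vectorMeasure,
      VectorMeasure.integral_sub_vectorMeasure ((hi _).sub_vectorMeasure (hi _)) (hi _),
      VectorMeasure.integral_sub_vectorMeasure (hi _) (hi _), hv, hv, hv]
    simp only [map_add, inner_add_left, inner_add_right, Complex.add_re, smul_eq_mul]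
    rw [← hs]
    have : (inner ℂ (genVec f k) (cfc φ J (genVec f l))).re =
        (inner ℂ (genVec f 0) (cfc φ J (genVec f 1))).re := by
      fin_cases k <;> fin_cases l
      · exact absurd rfl hkl
      · rfl
      · exact hs.symm
      · exact absurd rfl hkl
    rw [this]
    ring

lemma spectralMeasure_Iio (v : H) {E : Set ℝ} (hE : E ⊆ Set.Iio 0) :
    spectralMeasure h.isSelfAdjoint v E = 0 := by
  have hsub : E ⊆ (spectrum ℝ J)ᶜ := fun x hx hxs =>
    absurd (h.spectrum_nonneg x hxs) (not_le.2 (hE hx))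
  exact measure_mono_null hsub (spectralMeasure_compl h.isSelfAdjoint v)

lemma specMat_support (k l : Fin 2) {E : Set ℝ} (hm : MeasurableSet E) (hE : E ⊆ Set.Iio 0) :
    h.specMat k l E = 0 := by
  have hv : ∀ v, (spectralMeasure h.isSelfAdjoint v).toSignedMeasure E = 0 := fun v => by
    rw [Measure.toSignedMeasure_apply_measurable hm, measureReal_def, h.spectralMeasure_Iio v hE]
    rfl
  rw [specMat]
  split_ifs
  · exact hv _
  · simp [hv]

/-- Polarisation, checked on Laplace transforms. Through it positivity, densities and atoms of the
matrix reduce to statements about the positive measure of a single vector. -/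
lemma specMat_quadratic (x y : ℝ) :
    x ^ 2 • h.specMat 0 0 + (2 * x * y) • h.specMat 0 1 + y ^ 2 • h.specMat 1 1 =
      (spectralMeasure h.isSelfAdjoint
        ((x : ℂ) • genVec f 0 + (y : ℂ) • genVec f 1)).toSignedMeasure := by
  refine signedMeasure_eq_of_laplace ?_ ?_ fun t _ => ?_
  · intro E hm hE
    simp [h.specMat_support _ _ hm hE]
  · intro E hm hE
    rw [Measure.toSignedMeasure_apply_measurable hm, measureReal_def, h.spectralMeasure_Iio _ hE]
    rfl
  · have hφ : ContinuousOn (fun x : ℝ => Real.exp (-x * t)) (spectrum ℝ J) := by fun_prop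
    have hi := fun k l => h.integrable_specMat k l hφ
    have hs := re_inner_symm (IsSelfAdjoint.cfc (f := fun x : ℝ => Real.exp (-x * t)) (a := J))
      (genVec f 0) (genVec f 1)
    rw [VectorMeasure.integral_add_vectorMeasure
        (((hi _ _).smul_vectorMeasure _).add_vectorMeasure ((hi _ _).smul_vectorMeasure _))
        ((hi _ _).smul_vectorMeasure _),
      VectorMeasure.integral_add_vectorMeasure ((hi _ _).smul_vectorMeasure _)
        ((hi _ _).smul_vectorMeasure _),
      VectorMeasure.integral_smul_vectorMeasure, VectorMeasure.integral_smul_vectorMeasure,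
      VectorMeasure.integral_smul_vectorMeasure, h.integral_specMat _ _ hφ,
      h.integral_specMat _ _ hφ, h.integral_specMat _ _ hφ, vectorIntegral_toSignedMeasure,
      integral_spectralMeasure _ _ hφ]
    simp only [map_add, map_smul, inner_add_left, inner_add_right, inner_smul_left,
      inner_smul_right, Complex.conj_ofReal, Complex.add_re, Complex.re_ofReal_mul, smul_eq_mul]
    rw [← hs]
    ring

lemma posSemidef_specMat {E : Set ℝ} (hm : MeasurableSet E) :
    (Matrix.of fun k l => h.specMat k l E : Matrix (Fin 2) (Fin 2) ℝ).PosSemidef := by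
  refine Matrix.PosSemidef.of_dotProduct_mulVec_nonneg ?_ fun x => ?_
  · ext k l
    simp [h.specMat_symm k l]
  · have h1 := congrArg (fun s : SignedMeasure ℝ => s E) (h.specMat_quadratic (x 0) (x 1))
    simp only [add_apply, smul_apply, smul_eq_mul,
      Measure.toSignedMeasure_apply_measurable hm] at h1
    have h2 : star x ⬝ᵥ (Matrix.of fun k l => h.specMat k l E : Matrix (Fin 2) (Fin 2) ℝ).mulVec x =
        x 0 ^ 2 * h.specMat 0 0 E + 2 * x 0 * x 1 * h.specMat 0 1 E + x 1 ^ 2 * h.specMat 1 1 E := by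
      simp [dotProduct, Matrix.mulVec, Fin.sum_univ_two]
      rw [h.specMat_symm 1 0]
      ring
    rw [h2, h1]
    exact measureReal_nonneg

/-- Expand both basis vectors in the two generating vectors, move the self-adjoint operator Q_i^k(J)
across the inner product and multiply the functions of J. -/
theorem isSpectralMatrix_specMat {Q : Fin 2 → ℤ → ℝ[X]} (hQ : IsGeneratedFamily b d Q)
    {K c : ℝ} (hc : 1 ≤ c) (hgrow : ∀ i, (√(potential b d i))⁻¹ ≤ K * c ^ i.natAbs) :
    IsSpectralMatrix b d Q h.specMat where
  posSemidef E hm := h.posSemidef_specMat hm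
  support k l E hm hE := h.specMat_support k l hm hE
  integrable i j t _ k l := h.integrable_specMat k l (by fun_prop)
  karlinMcGregor i j t ht := by
    rw [h.transProb_eq_spectralProb hc hgrow i j ht, spectralProb, h.semigroup_eq_cfc,
      h.vec_eq_sum hQ i, h.vec_eq_sum hQ j]
    congr 1
    rw [sum_inner, Complex.re_sum]
    refine Finset.sum_congr rfl fun k _ => ?_
    rw [map_sum, inner_sum, Complex.re_sum]
    refine Finset.sum_congr rfl fun l _ => ?_
    rw [h.integral_specMat k l (by fun_prop)]
    have hs : IsSelfAdjoint (cfc (fun x => (Q k i).eval x) J) := IsSelfAdjoint.cfc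
    have h1 := (ContinuousLinearMap.isSelfAdjoint_iff_isSymmetric.1 hs) (genVec f k)
      (cfc (fun x => Real.exp (-x * t)) J (cfc (fun x => (Q l j).eval x) J (genVec f l)))
    have h2 : cfc (fun x => Real.exp (-x * t) * ((Q k i).eval x * (Q l j).eval x)) J =
        cfc (fun x => (Q k i).eval x) J *
          (cfc (fun x => Real.exp (-x * t)) J * cfc (fun x => (Q l j).eval x) J) := by
      rw [← cfc_mul _ _ J, ← cfc_mul _ _ J]
      refine cfc_congr fun x _ => ?_
      ring
    rw [h2, mul_apply_eq_comp, mul_apply_eq_comp]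
    exact congrArg Complex.re h1

end JacobiModel


/-! ### The decaying root of the characteristic equation -/

/-- `w` is the root of `p w² - (p + q - z) w + q = 0` with `|w|² ≤ q / p` and `0 ≤ Im w`. -/
structure IsDecayRoot (p q : ℝ) (z w : ℂ) : Prop where
  eq : p * w ^ 2 - (p + q - z) * w + q = 0
  normSq_le : p * Complex.normSq w ≤ q
  im_nonneg : 0 ≤ w.im

section Root

variable {p q : ℝ} (hp : 0 < p) (hq : 0 < q)

include hq in
lemma char_root_ne_zero {z w : ℂ} (h : p * w ^ 2 - (p + q - z) * w + q = 0) : w ≠ 0 := by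
  rintro rfl
  simp [hq.ne'] at h

include hq in
-- Imaginary part of the equation multiplied by the conjugate of w. For Im z > 0 it says that w
-- satisfies p|w|² < q exactly when Im w > 0, which ties decay to the half-plane.
lemma char_root_im {z w : ℂ} (h : p * w ^ 2 - (p + q - z) * w + q = 0) :
    w.im * (q - p * Complex.normSq w) = z.im * Complex.normSq w := by
  have h0 := char_root_ne_zero hq h
  have h1 : p * w * Complex.normSq w + q * (starRingEnd ℂ) w =
      (p + q - z) * Complex.normSq w := by
    rw [Complex.normSq_eq_conj_mul_self]
    linear_combination (starRingEnd ℂ) w * h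
  have h2 := congrArg Complex.im h1
  simp [Complex.mul_im] at h2
  linarith

include hp hq in
-- The two roots have product q / p, so on the circle p|w|² = q the conjugate of w is the other
-- root.
lemma char_root_conj {z w : ℂ} (h : p * w ^ 2 - (p + q - z) * w + q = 0)
    (hn : p * Complex.normSq w = q) :
    p * (starRingEnd ℂ) w ^ 2 - (p + q - z) * (starRingEnd ℂ) w + q = 0 := by
  have h0 := char_root_ne_zero hq h
  have e : (p : ℂ) * ((starRingEnd ℂ) w * w) = q := by
    rw [← Complex.normSq_eq_conj_mul_self, ← Complex.ofReal_mul, hn]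
  have hw2 : w ^ 2 ≠ 0 := pow_ne_zero 2 h0
  have hpc : (p : ℂ) ≠ 0 := by exact_mod_cast hp.ne'
  apply mul_left_cancel₀ (mul_ne_zero hpc hw2)
  set u := (starRingEnd ℂ) w
  linear_combination (q : ℂ) * h + (p * u * w + q - (p + q - z) * w) * e

include hp hq in
-- The product of the roots is q / p, so one of them satisfies the modulus bound. If its imaginary
-- part is negative, `char_root_im` forces it onto the critical circle, and its conjugate is a root
-- as well.
lemma exists_isDecayRoot {z : ℂ} (hz : 0 ≤ z.im) : ∃ w, IsDecayRoot p q z w := by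
  have hpc : (p : ℂ) ≠ 0 := by exact_mod_cast hp.ne'
  have main : ∀ w : ℂ, p * w ^ 2 - (p + q - z) * w + q = 0 → p * Complex.normSq w ≤ q →
      ∃ w, IsDecayRoot p q z w := by
    intro w hw hn
    rcases le_or_gt 0 w.im with him | him
    · exact ⟨w, hw, hn, him⟩
    · have h1 := char_root_im hq hw
      have h2 : 0 ≤ z.im * Complex.normSq w := mul_nonneg hz (Complex.normSq_nonneg _)
      have h3 : p * Complex.normSq w = q := by nlinarith
      exact ⟨_, char_root_conj hp hq hw h3, by rw [Complex.normSq_conj]; exact hn,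
        by simpa using him.le⟩
  obtain ⟨s, hs⟩ := IsAlgClosed.exists_pow_nat_eq ((p + q - z) ^ 2 - 4 * p * q : ℂ) two_pos
  set w₁ := (p + q - z + s) / (2 * p) with hw₁
  set w₂ := (p + q - z - s) / (2 * p) with hw₂
  have h1 : p * w₁ ^ 2 - (p + q - z) * w₁ + q = 0 := by
    rw [hw₁]; field_simp; linear_combination hs
  have h2 : p * w₂ ^ 2 - (p + q - z) * w₂ + q = 0 := by
    rw [hw₂]; field_simp; linear_combination hs
  have h3 : (p : ℂ) * (w₁ * w₂) = q := by
    rw [hw₁, hw₂]; field_simp; linear_combination -hs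
  rcases le_or_gt (p * Complex.normSq w₁) q with h | h
  · exact main w₁ h1 h
  · refine main w₂ h2 ?_
    have h4 := congrArg Complex.normSq h3
    simp only [map_mul, Complex.normSq_ofReal] at h4
    have h5 : 0 ≤ Complex.normSq w₂ := Complex.normSq_nonneg _
    by_contra! h6
    nlinarith [mul_lt_mul'' h h6 hq.le hq.le]

include hp hq in
-- Distinct decay roots would have product q / p, hence both lie on the critical circle and are
-- conjugate; with nonnegative imaginary parts both are real, so they coincide. The condition on Im
-- w selects the boundary value from above when the roots are conjugate.
lemma IsDecayRoot.unique {z w w' : ℂ} (h : IsDecayRoot p q z w) (h' : IsDecayRoot p q z w') :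
    w = w' := by
  by_contra hne
  have hpc : (p : ℂ) ≠ 0 := by exact_mod_cast hp.ne'
  have h0 := char_root_ne_zero hq h.eq
  have e1 : (p : ℂ) * (w + w') = p + q - z := by
    have : (w - w') * (p * (w + w') - (p + q - z)) = 0 := by linear_combination h.eq - h'.eq
    exact sub_eq_zero.1 ((mul_eq_zero.1 this).resolve_left (sub_ne_zero.2 hne))
  have e2 : (p : ℂ) * (w * w') = q := by linear_combination w * e1 - h.eq
  have e3 := congrArg Complex.normSq e2
  simp only [map_mul, Complex.normSq_ofReal] at e3
  have n1 := h.normSq_le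
  have n2 := h'.normSq_le
  have p1 : 0 ≤ Complex.normSq w := Complex.normSq_nonneg _
  have p2 : 0 ≤ Complex.normSq w' := Complex.normSq_nonneg _
  have n3 : p * Complex.normSq w = q := by
    refine le_antisymm n1 ?_
    by_contra! hlt
    have := mul_lt_mul_of_lt_of_le_of_nonneg_of_pos hlt n2 (by positivity) hq
    nlinarith
  have e4 : w' = (starRingEnd ℂ) w := by
    apply mul_left_cancel₀ (mul_ne_zero hpc h0)
    rw [mul_assoc, mul_assoc, e2, Complex.mul_conj, ← Complex.ofReal_mul, n3]
  have e5 : w.im = 0 := by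
    have := h'.im_nonneg
    rw [e4, Complex.conj_im] at this
    linarith [h.im_nonneg]
  exact hne (by rw [e4]; exact (Complex.conj_eq_iff_im.2 e5).symm)

open Classical in
/-- The decaying root, for `z` in the closed upper half-plane. -/
def decayRoot (p q : ℝ) (z : ℂ) : ℂ := if h : ∃ w, IsDecayRoot p q z w then h.choose else 0

include hp hq in
lemma isDecayRoot_decayRoot {z : ℂ} (hz : 0 ≤ z.im) : IsDecayRoot p q z (decayRoot p q z) := by
  have h := exists_isDecayRoot hp hq hz
  rw [decayRoot, dif_pos h]
  exact h.choose_spec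

include hp hq in
lemma decayRoot_eq {z w : ℂ} (h : IsDecayRoot p q z w) : decayRoot p q z = w := by
  have h' : ∃ w, IsDecayRoot p q z w := ⟨w, h⟩
  rw [decayRoot, dif_pos h']
  exact h'.choose_spec.unique hp hq h

include hq in
lemma IsDecayRoot.strict {z w : ℂ} (h : IsDecayRoot p q z w) (hz : 0 < z.im) :
    p * Complex.normSq w < q ∧ 0 < w.im := by
  have h0 := char_root_ne_zero hq h.eq
  have h1 := char_root_im hq h.eq
  have h2 : 0 < z.im * Complex.normSq w := mul_pos hz (Complex.normSq_pos.2 h0)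
  have h3 := h.normSq_le
  have h4 := h.im_nonneg
  rw [← h1] at h2
  constructor
  · refine lt_of_le_of_ne h3 fun e => ?_
    rw [e] at h2; simp at h2
  · refine lt_of_le_of_ne h4 fun e => ?_
    rw [← e] at h2; simp at h2

include hp hq in
-- The roots stay in a compact disc and the defining conditions are closed, so each cluster point is
-- a decay root and uniqueness identifies it. This gives continuity up to the real axis without
-- choosing a branch of the square root.
lemma continuousOn_decayRoot : ContinuousOn (decayRoot p q) {z | 0 ≤ z.im} := by
  intro z₀ hz₀
  set K : Set ℂ := Metric.closedBall 0 √(q / p)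
  refine (isCompact_closedBall (0 : ℂ) √(q / p)).tendsto_nhds_of_unique_mapClusterPt ?_ ?_
  · filter_upwards [self_mem_nhdsWithin] with z hz
    have := (isDecayRoot_decayRoot hp hq hz).normSq_le
    rw [mem_closedBall_zero_iff]
    apply Real.le_sqrt_of_sq_le
    rw [← Complex.normSq_eq_norm_sq, le_div_iff₀ hp, mul_comm]
    exact this
  · intro y _ hy
    obtain ⟨U, hU, hUy⟩ := mapClusterPt_iff_ultrafilter.1 hy
    have hid : Tendsto (fun z : ℂ => z) U (𝓝 z₀) := hU.trans nhdsWithin_le_nhds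
    have hmem : ∀ᶠ z in (U : Filter ℂ), 0 ≤ z.im := hU self_mem_nhdsWithin
    refine (decayRoot_eq hp hq ⟨?_, ?_, ?_⟩).symm
    · have ht : Tendsto (fun z => p * decayRoot p q z ^ 2 - (p + q - z) * decayRoot p q z + q) U
          (𝓝 (p * y ^ 2 - (p + q - z₀) * y + q)) :=
        (((hUy.pow 2).const_mul _).sub ((hid.const_sub _).mul hUy)).add_const _
      refine tendsto_nhds_unique ht (tendsto_const_nhds.congr' ?_)
      filter_upwards [hmem] with z hz
      exact (isDecayRoot_decayRoot hp hq hz).eq.symm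
    · have ht := ((Complex.continuous_normSq.tendsto y).comp hUy).const_mul p
      refine le_of_tendsto ht ?_
      filter_upwards [hmem] with z hz
      exact (isDecayRoot_decayRoot hp hq hz).normSq_le
    · refine ge_of_tendsto ((Complex.continuous_im.tendsto y).comp hUy) ?_
      filter_upwards [hmem] with z hz
      exact (isDecayRoot_decayRoot hp hq hz).im_nonneg

lemma rootPlus_sq_of_neg {z : ℝ} (hp : 0 < p) (hq : 0 < q) (hz : z < 0) :
    rootPlus p q z ^ 2 = (p + q - z) ^ 2 - 4 * p * q := by
  rw [rootPlus, Real.sq_sqrt]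
  nlinarith [sq_nonneg (p - q)]

include hp hq in
/-- The decaying root at a negative real point. -/
lemma real_root {z : ℝ} (hz : z < 0) :
    let w := (p + q - z - rootPlus p q z) / (2 * p)
    p * w ^ 2 - (p + q - z) * w + q = 0 ∧ 0 < w ∧ w < 1 ∧ p * w ^ 2 < q := by
  intro w
  have hs := rootPlus_sq_of_neg hp hq hz
  have hs0 : 0 ≤ rootPlus p q z := Real.sqrt_nonneg _
  set s := rootPlus p q z
  have hw : 2 * p * w = p + q - z - s := by simp only [w]; field_simp; rfl
  have hpq : 0 < p * q := mul_pos hp hq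
  have hspos : 0 < s := by
    refine lt_of_le_of_ne hs0 fun e => ?_
    rw [← e] at hs
    nlinarith [sq_nonneg (p - q)]
  have h1 : s < p + q - z := by
    by_contra! hle
    have := mul_self_le_mul_self (by linarith : 0 ≤ p + q - z) hle
    nlinarith
  have e1 : p * w ^ 2 - (p + q - z) * w + q = 0 := by
    have : 4 * p * (p * w ^ 2 - (p + q - z) * w + q) = 0 := by
      linear_combination (2 * p * w - (p + q - z) - s) * hw + hs
    exact (mul_eq_zero.1 this).resolve_left (by positivity)
  have e2 : 0 < w := by
    have : 0 < 2 * p * w := by rw [hw]; linarith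
    exact pos_of_mul_pos_right this (by positivity)
  have e3 : w < 1 := by
    have : q - p - z < s := by
      by_contra! hle
      have := mul_self_le_mul_self hs0 hle
      nlinarith
    nlinarith
  refine ⟨e1, e2, e3, ?_⟩
  have : p * w ^ 2 = q - s * w := by linear_combination e1 + w * hw - 2 * e1
  nlinarith [mul_pos hspos e2]

end Root

/-! ### The process with two regimes -/

section TwoRegimes

variable {lam mu al be : ℝ} (hlam : 0 < lam) (hmu : 0 < mu) (hal : 0 < al) (hbe : 0 < be)

lemma birth_ofNat (n : ℕ) : birth lam be (n : ℤ) = lam := by simp [birth]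
lemma death_ofNat (n : ℕ) : death mu al (n : ℤ) = mu := by simp [death]
lemma birth_neg {n : ℤ} (hn : n < 0) : birth lam be n = be := by simp [birth, hn]
lemma death_neg {n : ℤ} (hn : n < 0) : death mu al n = al := by simp [death, hn]
lemma birth_nonneg {n : ℤ} (hn : 0 ≤ n) : birth lam be n = lam := by simp [birth, hn]
lemma death_nonneg {n : ℤ} (hn : 0 ≤ n) : death mu al n = mu := by simp [death, hn]

lemma potential_ofNat (n : ℕ) :
    potential (birth lam be) (death mu al) n = (lam / mu) ^ n := by
  change ∏ m ∈ Finset.range n, birth lam be (m : ℤ) / death mu al ((m : ℤ) + 1) = _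
  rw [Finset.prod_congr rfl (g := fun _ => lam / mu), Finset.prod_const, Finset.card_range]
  intro m _
  rw [birth_ofNat, death_nonneg (by omega)]

lemma potential_negSucc (n : ℕ) :
    potential (birth lam be) (death mu al) (Int.negSucc n) = mu / be * (al / be) ^ n := by
  change ∏ m ∈ Finset.range (n + 1), death mu al (-(m : ℤ)) / birth lam be (-(m : ℤ) - 1) = _
  have h0 : death mu al (-((0 : ℕ) : ℤ)) / birth lam be (-((0 : ℕ) : ℤ) - 1) = mu / be := by
    rw [death_nonneg (by simp), birth_neg (by simp)]
  rw [Finset.prod_range_succ', mul_comm, h0, Finset.prod_congr rfl (g := fun _ => al / be),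
    Finset.prod_const, Finset.card_range]
  intro m _
  rw [death_neg (by push_cast; omega), birth_neg (by push_cast; omega)]

lemma sqrt_pow_eq {x : ℝ} (hx : 0 ≤ x) (n : ℕ) : √(x ^ n) = √x ^ n := by
  rw [← Real.sqrt_sq (pow_nonneg (Real.sqrt_nonneg x) n), ← pow_mul, mul_comm, pow_mul,
    Real.sq_sqrt hx]

include hlam hmu hal hbe

lemma boundedRates :
    BoundedRates (birth lam be) (death mu al) (lam + mu + al + be) where
  birth_pos n := by unfold birth; split_ifs <;> assumption
  death_pos n := by unfold death; split_ifs <;> assumption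
  birth_le n := by unfold birth; split_ifs <;> linarith
  death_le n := by unfold death; split_ifs <;> linarith

lemma potential_growth : ∃ K c : ℝ, 1 ≤ c ∧ ∀ i,
    (√(potential (birth lam be) (death mu al) i))⁻¹ ≤ K * c ^ i.natAbs := by
  set c := max 1 (max √(mu / lam) √(be / al)) with hc
  set K := max 1 √(be / mu) with hK
  have hc1 : 1 ≤ c := le_max_left _ _
  have hK1 : 1 ≤ K := le_max_left _ _
  refine ⟨K, c, hc1, fun i => ?_⟩
  rw [← Real.sqrt_inv]
  cases i with
  | ofNat n =>
    have e : (potential (birth lam be) (death mu al) (Int.ofNat n))⁻¹ = (mu / lam) ^ n := by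
      have := potential_ofNat (lam := lam) (mu := mu) (al := al) (be := be) n
      rw [Int.ofNat_eq_natCast, this, ← inv_pow, inv_div]
    rw [e, sqrt_pow_eq (by positivity)]
    calc √(mu / lam) ^ n ≤ c ^ n :=
          pow_le_pow_left₀ (Real.sqrt_nonneg _) ((le_max_left _ _).trans (le_max_right _ _)) _
      _ ≤ K * c ^ n := le_mul_of_one_le_left (by positivity) hK1
  | negSucc n =>
    rw [potential_negSucc, mul_inv, ← inv_pow, inv_div, inv_div,
      Real.sqrt_mul (by positivity), sqrt_pow_eq (by positivity)]
    have h1 : √(be / al) ^ n ≤ c ^ (n + 1) :=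
      (pow_le_pow_left₀ (Real.sqrt_nonneg _) ((le_max_right _ _).trans (le_max_right _ _)) _).trans
        (pow_le_pow_right₀ hc1 n.le_succ)
    exact mul_le_mul (le_max_right _ _) h1 (by positivity) (by positivity)

end TwoRegimes

/-- Coordinates of the resolvent applied to `x f₀ + y f₋₁`, divided by `√π`. -/
def resolventCoord (mu x y : ℝ) (w v : ℂ) : ℤ → ℂ
  | Int.ofNat n => (x + y * v) * w ^ (n + 1) / (mu * (1 - v * w))
  | Int.negSucc n => (x * w + y) * v ^ (n + 1) / (mu * (1 - v * w))

/-! ### Explicit resolvent on the two half-lines -/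

section Resolvent

variable {lam mu al be : ℝ} (hlam : 0 < lam) (hmu : 0 < mu) (hal : 0 < al) (hbe : 0 < be)
include hlam hmu hal hbe

/-- On each half-line π times the squared modulus is geometric, with ratio λ|w|²/μ or α|v|²/β; the
two hypotheses say exactly that these are less than 1. -/
lemma memℓp_resolventCoord (x y : ℝ) {w v : ℂ} (hw : lam * Complex.normSq w < mu)
    (hv : al * Complex.normSq v < be) :
    Memℓp (fun i => (√(potential (birth lam be) (death mu al) i) : ℂ) *
      resolventCoord mu x y w v i) 2 := by
  rw [memℓp_two_iff]
  have hb := boundedRates hlam hmu hal hbe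
  have hsq : ∀ i, ‖(√(potential (birth lam be) (death mu al) i) : ℂ) *
      resolventCoord mu x y w v i‖ ^ 2 =
      potential (birth lam be) (death mu al) i * ‖resolventCoord mu x y w v i‖ ^ 2 := fun i => by
    rw [norm_mul, mul_pow, Complex.norm_real, Real.norm_eq_abs, sq_abs,
      Real.sq_sqrt (hb.potential_pos i).le]
  simp only [hsq]
  refine Summable.of_nat_of_neg_add_one ?_ ?_
  · have hg : Summable fun n : ℕ => (lam / mu * Complex.normSq w) ^ n := by
      refine summable_geometric_of_lt_one
        (mul_nonneg (by positivity) (Complex.normSq_nonneg _)) ?_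
      rw [div_mul_eq_mul_div, div_lt_one hmu]; exact hw
    refine (hg.mul_left (‖(x + y * v) / (mu * (1 - v * w))‖ ^ 2 * Complex.normSq w)).congr
      fun n => ?_
    rw [potential_ofNat]
    change _ = _ * ‖(x + y * v) * w ^ (n + 1) / (mu * (1 - v * w))‖ ^ 2
    rw [mul_div_right_comm, norm_mul, norm_pow, Complex.normSq_eq_norm_sq]
    ring
  · have hg : Summable fun n : ℕ => (al / be * Complex.normSq v) ^ n := by
      refine summable_geometric_of_lt_one
        (mul_nonneg (by positivity) (Complex.normSq_nonneg _)) ?_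
      rw [div_mul_eq_mul_div, div_lt_one hbe]; exact hv
    refine (hg.mul_left (mu / be * ‖(x * w + y) / (mu * (1 - v * w))‖ ^ 2 *
      Complex.normSq v)).congr fun n => ?_
    have e : -((n : ℤ) + 1) = Int.negSucc n := by omega
    rw [e, potential_negSucc]
    change _ = _ * ‖(x * w + y) * v ^ (n + 1) / (mu * (1 - v * w))‖ ^ 2
    rw [mul_div_right_comm, norm_mul, norm_pow, Complex.normSq_eq_norm_sq]
    ring

/-- The Stieltjes transform of the spectral measure of `x f₀ + y f₋₁`. -/
theorem stieltjes_quadratic (x y : ℝ) {z w v : ℂ}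
    (hwe : lam * w ^ 2 - (lam + mu - z) * w + mu = 0)
    (hve : al * v ^ 2 - (al + be - z) * v + be = 0)
    (hw : lam * Complex.normSq w < mu) (hv : al * Complex.normSq v < be) (hvw : 1 - v * w ≠ 0)
    (hz : ∀ t : ℝ, 0 ≤ t → (t : ℂ) ≠ z) :
    ∫ t : ℝ, ((t : ℂ) - z)⁻¹ ∂(spectralMeasure
      (boundedRates hlam hmu hal hbe).jacobiModel.isSelfAdjoint
      ((x : ℂ) • JacobiModel.genVec (BoundedRates.basisVec (birth lam be) (death mu al)) 0 +
        (y : ℂ) • JacobiModel.genVec (BoundedRates.basisVec (birth lam be) (death mu al)) 1)) =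
      (x ^ 2 * w + 2 * x * y * (v * w) + y ^ 2 * v) / (mu * (1 - v * w)) := by
  set hb := boundedRates hlam hmu hal hbe
  set R := resolventCoord mu x y w v with hR
  set g : L2Z := ⟨_, memℓp_resolventCoord hlam hmu hal hbe x y hw hv⟩ with hg
  have hgi : ∀ i, g i = √(potential (birth lam be) (death mu al) i) * R i := fun i => rfl
  have hwv : 1 - w * v ≠ 0 := by rwa [mul_comm]
  have hmuc : (mu : ℂ) ≠ 0 := by exact_mod_cast hmu.ne'
  have hbec : (be : ℂ) ≠ 0 := by exact_mod_cast hbe.ne'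
  have hRn : ∀ n : ℕ, R n = (x + y * v) * w ^ (n + 1) / (mu * (1 - v * w)) := fun n => rfl
  have hRm : ∀ n : ℕ, R (-(n : ℤ) - 1) = (x * w + y) * v ^ (n + 1) / (mu * (1 - v * w)) :=
    fun n => by
    have e : -(n : ℤ) - 1 = Int.negSucc n := by omega
    rw [e]
    rfl
  have hR0 : R 0 = (x + y * v) * w / (mu * (1 - v * w)) := by simpa using hRn 0
  have hRm1 : R (-1) = (x * w + y) * v / (mu * (1 - v * w)) := by simpa using hRm 0
  have hp0 : potential (birth lam be) (death mu al) 0 = 1 := by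
    simpa using potential_ofNat (lam := lam) (mu := mu) (al := al) (be := be) 0
  have hpm1 : potential (birth lam be) (death mu al) (-1) = mu / be := by
    simpa using potential_negSucc (lam := lam) (mu := mu) (al := al) (be := be) 0
  -- Inside each half-line the powers of w or v solve the homogeneous equation. The prefactors are
  -- matched so that only 0 and -1 carry a source; the value y β/μ reflects π_{-1} = μ/β.
  have hrec : ∀ i : ℤ, ((birth lam be i : ℂ) + death mu al i) * R i - birth lam be i * R (i + 1) -
      death mu al i * R (i - 1) - z * R i =
      if i = 0 then (x : ℂ) else if i = -1 then (y * be / mu : ℂ) else 0 := by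
    intro i
    rcases lt_trichotomy i 0 with hi | rfl | hi
    · rw [birth_neg hi, death_neg hi]
      rcases eq_or_ne i (-1) with rfl | hi'
      · have h2 : R (-1 - 1) = (x * w + y) * v ^ 2 / (mu * (1 - v * w)) := hRm 1
        rw [show (-1 : ℤ) + 1 = 0 by norm_num, hR0, hRm1, h2]
        simp only [neg_eq_zero, one_ne_zero, if_false, if_true]
        field_simp
        linear_combination (-(x * w + y)) * hve
      · obtain ⟨n, rfl⟩ : ∃ n : ℕ, i = -((n + 1 : ℕ) : ℤ) - 1 := ⟨(-i - 2).toNat, by omega⟩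
        have e1 : -((n + 1 : ℕ) : ℤ) - 1 + 1 = -(n : ℤ) - 1 := by push_cast; ring
        have e2 : -((n + 1 : ℕ) : ℤ) - 1 - 1 = -((n + 2 : ℕ) : ℤ) - 1 := by push_cast; ring
        rw [e1, e2, hRm, hRm, hRm, if_neg (by omega), if_neg hi']
        field_simp
        linear_combination (-(x * w + y) * v ^ (n + 1)) * hve
    · have h2 : R (0 + 1) = (x + y * v) * w ^ 2 / (mu * (1 - v * w)) := hRn 1
      rw [h2, zero_sub, hR0, hRm1, birth_nonneg le_rfl, death_nonneg le_rfl]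
      simp only [if_true]
      field_simp
      linear_combination (-(x + y * v)) * hwe
    · obtain ⟨n, rfl⟩ : ∃ n : ℕ, i = ((n + 1 : ℕ) : ℤ) := ⟨(i - 1).toNat, by omega⟩
      have e1 : ((n + 1 : ℕ) : ℤ) + 1 = ((n + 2 : ℕ) : ℤ) := by push_cast; ring
      have e2 : ((n + 1 : ℕ) : ℤ) - 1 = (n : ℤ) := by push_cast; ring
      rw [e1, e2, hRn, hRn, hRn, birth_ofNat, death_ofNat, if_neg (by omega), if_neg (by omega)]
      field_simp
      linear_combination (-(x + y * v) * w ^ (n + 1)) * hwe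
  have hsol : hb.jacobi g - z • g =
      ((x : ℂ) • JacobiModel.genVec (BoundedRates.basisVec (birth lam be) (death mu al)) 0 +
        (y : ℂ) • JacobiModel.genVec (BoundedRates.basisVec (birth lam be) (death mu al)) 1) := by
    ext i
    have h1 := hb.jacobi_apply_of_eq hgi i
    have h2 : (hb.jacobi g - z • g) i = hb.jacobi g i - z * g i := rfl
    have h3 : ((x : ℂ) • JacobiModel.genVec (BoundedRates.basisVec (birth lam be) (death mu al)) 0 +
        (y : ℂ) • JacobiModel.genVec (BoundedRates.basisVec (birth lam be) (death mu al)) 1) i =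
        x * BoundedRates.basisVec (birth lam be) (death mu al) 0 i +
        y * BoundedRates.basisVec (birth lam be) (death mu al) (-1) i := rfl
    rw [h2, h1, hgi, h3, BoundedRates.basisVec_apply, BoundedRates.basisVec_apply]
    have h4 := hrec i
    have h5 : (√(potential (birth lam be) (death mu al) i) : ℂ) *
        ((birth lam be i + death mu al i) * R i - birth lam be i * R (i + 1) -
          death mu al i * R (i - 1)) - z * (√(potential (birth lam be) (death mu al) i) * R i) =
        √(potential (birth lam be) (death mu al) i) *
        (if i = 0 then (x : ℂ) else if i = -1 then (y * be / mu : ℂ) else 0) := by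
      rw [← h4]; ring
    rw [h5]
    rcases eq_or_ne i 0 with rfl | hi0
    · simp [hp0]
    rcases eq_or_ne i (-1) with rfl | hi1
    · have hpos : 0 < √(mu / be) := Real.sqrt_pos.2 (by positivity)
      have hne : (√(mu / be) : ℂ) ≠ 0 := by exact_mod_cast hpos.ne'
      have hsq : (√(mu / be) : ℂ) * √(mu / be) = mu / be := by
        rw [← Complex.ofReal_mul, Real.mul_self_sqrt (by positivity), Complex.ofReal_div]
      simp only [hpm1, neg_eq_zero, one_ne_zero, if_false, if_true, mul_zero, zero_add]
      rw [eq_mul_inv_iff_mul_eq₀ hne]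
      have : (√(mu / be) : ℂ) * (y * be / mu) * √(mu / be) =
        (√(mu / be) * √(mu / be)) * (y * be / mu) := by ring
      rw [this, hsq]
      field_simp
    · simp [hi0, hi1]
  rw [stieltjes_spectralMeasure hb.isSelfAdjoint_jacobi (z := z) (g := g)
    (fun t ht => hz t (hb.spectrum_jacobi_nonneg t ht)) hsol, inner_add_left, inner_smul_left,
    inner_smul_left]
  have h0 : inner ℂ (JacobiModel.genVec (BoundedRates.basisVec (birth lam be) (death mu al)) 0) g =
      R 0 := by
    have := BoundedRates.inner_basisVec (birth lam be) (death mu al) 0 g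
    rw [hgi, ← mul_assoc, ← Complex.ofReal_mul, inv_mul_cancel₀ (hb.sqrt_potential_pos _).ne',
      Complex.ofReal_one, one_mul] at this
    exact this
  have h1 : inner ℂ (JacobiModel.genVec (BoundedRates.basisVec (birth lam be) (death mu al)) 1) g =
      R (-1) := by
    have := BoundedRates.inner_basisVec (birth lam be) (death mu al) (-1) g
    rw [hgi, ← mul_assoc, ← Complex.ofReal_mul, inv_mul_cancel₀ (hb.sqrt_potential_pos _).ne',
      Complex.ofReal_one, one_mul] at this
    exact this
  rw [h0, h1, hR0, hRm1, Complex.conj_ofReal, Complex.conj_ofReal]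
  field_simp
  ring

end Resolvent


/-! ### Location of the atoms -/

section Critical

variable {lam mu al be : ℝ} (hlam : 0 < lam) (hmu : 0 < mu) (hal : 0 < al) (hbe : 0 < be)
include hlam hmu hal hbe

omit hlam hbe in
-- Multiplying the inequalities by α and μ chains αλ(α-μ)² < αμ(β-λ)² < βμ(α-μ)².
lemma cross_lt (h1 : constOne lam mu al be < 0) (h2 : 0 < constTwo lam mu al be) :
    al * lam < be * mu := by
  unfold constOne at h1
  unfold constTwo at h2
  have h3 : al * (lam * (al - mu) ^ 2) < al * (mu * (be - lam) ^ 2) :=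
    mul_lt_mul_of_pos_left (by linarith) hal
  have h4 : mu * (al * (be - lam) ^ 2) < mu * (be * (al - mu) ^ 2) :=
    mul_lt_mul_of_pos_left (by linarith) hmu
  have h5 : (al * lam) * (al - mu) ^ 2 < (be * mu) * (al - mu) ^ 2 := by linarith
  exact lt_of_mul_lt_mul_right h5 (sq_nonneg _)

omit hlam in
-- The missing sign pattern α > μ, β < λ would give αλ > βμ, contrary to `cross_lt`.
lemma zetaCondition_iff : ZetaCondition lam mu al be ↔
    al ≠ mu ∧ be ≠ lam ∧ constOne lam mu al be < 0 ∧ 0 < constTwo lam mu al be := by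
  constructor
  · rintro (⟨h1, h2, h3, h4⟩ | ⟨h1, h2, h3, h4⟩ | ⟨h1, h2, h3, h4⟩)
    · exact ⟨h1.ne', h2.ne', h3, h4⟩
    · exact ⟨h1.ne, h2.ne', h3, h4⟩
    · exact ⟨h1.ne, h2.ne, h3, h4⟩
  · rintro ⟨h1, h2, h3, h4⟩
    rcases lt_or_gt_of_ne h1 with h1 | h1 <;> rcases lt_or_gt_of_ne h2 with h2 | h2
    · exact Or.inr (Or.inr ⟨h1, h2, h3, h4⟩)
    · exact Or.inr (Or.inl ⟨h1, h2, h3, h4⟩)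
    · have := cross_lt hmu hal h3 h4
      nlinarith [mul_lt_mul'' h1 h2 hmu.le hbe.le]
    · exact Or.inl ⟨h1, h2, h3, h4⟩

omit hlam in
-- If the sum vanished, then β - λ = α - μ, and the two sign conditions would read λ < μ and α < β,
-- making the sum negative.
lemma sum_ne_zero_of_zetaCondition (h : ZetaCondition lam mu al be) :
    al - be + lam - mu ≠ 0 := by
  obtain ⟨_, _, h3, h4⟩ := (zetaCondition_iff hmu hal hbe).1 h
  intro h0
  have e : be - lam = al - mu := by linarith
  unfold constOne at h3
  unfold constTwo at h4
  rw [e] at h3 h4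
  have h5 : lam < mu := by
    have : lam * (al - mu) ^ 2 < mu * (al - mu) ^ 2 := by linarith
    exact lt_of_mul_lt_mul_right this (sq_nonneg _)
  have h6 : al < be := by
    have : al * (al - mu) ^ 2 < be * (al - mu) ^ 2 := by linarith
    exact lt_of_mul_lt_mul_right this (sq_nonneg _)
  linarith

omit hlam in
lemma zeta_ne_zero (h : ZetaCondition lam mu al be) : zeta lam mu al be ≠ 0 := by
  obtain ⟨h1, h2, h3, h4⟩ := (zetaCondition_iff hmu hal hbe).1 h
  have h5 := cross_lt hmu hal h3 h4
  have h6 := sum_ne_zero_of_zetaCondition hmu hal hbe h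
  exact div_ne_zero (mul_ne_zero h6 (by linarith))
    (mul_ne_zero (sub_ne_zero.2 h2.symm) (sub_ne_zero.2 h1))

omit hlam hmu hal hbe in
-- Insert v = 1/w in the second equation and subtract the first: the unknown x drops out, and the
-- remaining quadratic in w factors as (w - 1)((β-λ)w - (α-μ)).
lemma critical_point {x w v : ℝ} (hw : lam * w ^ 2 - (lam + mu - x) * w + mu = 0)
    (hv : al * v ^ 2 - (al + be - x) * v + be = 0) (hvw : v * w = 1) :
    (w = 1 ∧ x = 0) ∨ (be - lam) * w = al - mu := by
  have e1 : (w - 1) * ((be - lam) * w - (al - mu)) = 0 := by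
    linear_combination -hw + w ^ 2 * hv + (-al * (v * w + 1) + (al + be - x) * w) * hvw
  rcases mul_eq_zero.1 e1 with h | h
  · have h1 : w = 1 := by linarith
    subst h1
    exact Or.inl ⟨rfl, by linarith⟩
  · exact Or.inr (by linarith)

omit hlam hmu hal hbe in
lemma critical_eq_zeta {x w : ℝ} (hw : lam * w ^ 2 - (lam + mu - x) * w + mu = 0)
    (hw0 : w ≠ 0) (hbl : be ≠ lam) (h : (be - lam) * w = al - mu) :
    al ≠ mu ∧ w = (al - mu) / (be - lam) ∧ x = zeta lam mu al be := by
  have hbl' : be - lam ≠ 0 := sub_ne_zero.2 hbl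
  have ham : al - mu ≠ 0 := by rw [← h]; exact mul_ne_zero hbl' hw0
  have hlb : lam - be ≠ 0 := sub_ne_zero.2 hbl.symm
  refine ⟨sub_ne_zero.1 ham, by rw [← h]; field_simp, ?_⟩
  rw [zeta, eq_div_iff (mul_ne_zero hlb ham), ← h]
  have : al = (be - lam) * w + mu := by linarith
  rw [this]
  linear_combination (lam - be) * (be - lam) * hw

omit hlam hmu hal hbe in
lemma zeta_char_root (hal' : al ≠ mu) (hbl : be ≠ lam) :
    lam * ((al - mu) / (be - lam)) ^ 2 - (lam + mu - zeta lam mu al be) * ((al - mu) / (be - lam)) +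
      mu = 0 ∧
    al * ((be - lam) / (al - mu)) ^ 2 - (al + be - zeta lam mu al be) * ((be - lam) / (al - mu)) +
      be = 0 := by
  have hbl' : be - lam ≠ 0 := sub_ne_zero.2 hbl
  have ham : al - mu ≠ 0 := sub_ne_zero.2 hal'
  have hlb : lam - be ≠ 0 := sub_ne_zero.2 hbl.symm
  unfold zeta
  constructor <;> field_simp <;> ring

end Critical

lemma decayRoot_real {p q : ℝ} (hp : 0 < p) (hq : 0 < q) {x w : ℝ}
    (h : p * w ^ 2 - (p + q - x) * w + q = 0) (hw : p * w ^ 2 ≤ q) : decayRoot p q x = w := by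
  refine decayRoot_eq hp hq ⟨by exact_mod_cast h, ?_, by simp⟩
  rw [Complex.normSq_ofReal, ← sq]
  exact hw

lemma decayRoot_zero {p q : ℝ} (hp : 0 < p) (hq : 0 < q) :
    decayRoot p q 0 = (min 1 (q / p) : ℝ) := by
  have h := decayRoot_real hp hq (x := 0) (w := min 1 (q / p))
  simp only [Complex.ofReal_zero] at h
  apply h
  · rcases min_choice 1 (q / p) with e | e <;> rw [e]
    · ring
    · field_simp; ring
  · rcases le_total 1 (q / p) with e | e
    · rw [min_eq_left e]
      rw [le_div_iff₀ hp] at e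
      linarith
    · rw [min_eq_right e]
      rw [div_le_iff₀ hp] at e
      field_simp
      linarith

/-- From vw = 1 the number v|w|² is the conjugate of w; since both imaginary parts are nonnegative
they vanish. A decay root at a nonreal z would have positive imaginary part, so z is real and the
transform is singular only on the axis. -/
lemma IsDecayRoot.mul_eq_one {p q p' q' : ℝ} (hq : 0 < q) {z w v : ℂ}
    (hw : IsDecayRoot p q z w) (hv : IsDecayRoot p' q' z v) (h : v * w = 1) (hz : 0 ≤ z.im) :
    z.im = 0 ∧ w.im = 0 ∧ v.im = 0 := by
  have hw0 := char_root_ne_zero hq hw.eq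
  have hpos : 0 < Complex.normSq w := Complex.normSq_pos.2 hw0
  have h1 : v * Complex.normSq w = (starRingEnd ℂ) w := by
    rw [Complex.normSq_eq_conj_mul_self]
    linear_combination (starRingEnd ℂ) w * h
  have h2 := congrArg Complex.im h1
  simp only [Complex.im_mul_ofReal, Complex.conj_im] at h2
  have h3 := hw.im_nonneg
  have h4 := hv.im_nonneg
  have h5 : w.im = 0 := le_antisymm (by nlinarith [mul_nonneg h4 hpos.le]) h3
  refine ⟨?_, h5, ?_⟩
  · by_contra hne
    exact (hw.strict hq (lt_of_le_of_ne hz (Ne.symm hne))).2.ne' h5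
  · rw [h5, neg_zero] at h2
    exact (mul_eq_zero.1 h2).resolve_right hpos.ne'

/-! ### The boundary values of the Stieltjes transforms -/

/-- The Stieltjes transform of the spectral measure of `x f₀ + y f₋₁`. -/
def transform (lam mu al be x y : ℝ) (z : ℂ) : ℂ :=
  (x ^ 2 * decayRoot lam mu z + 2 * x * y * (decayRoot al be z * decayRoot lam mu z) +
    y ^ 2 * decayRoot al be z) / (mu * (1 - decayRoot al be z * decayRoot lam mu z))

/-- The real points where the transforms may be singular. -/
def criticalSet (lam mu al be : ℝ) : Finset ℝ :=
  {0, zeta lam mu al be, edgeMinus lam mu, edgePlus lam mu}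

lemma edge_factor {u v : ℝ} (hu : 0 ≤ u) (hv : 0 ≤ v) (x : ℝ) :
    (u + v - x) ^ 2 - 4 * u * v = (x - edgeMinus u v) * (x - edgePlus u v) := by
  have h1 := Real.sq_sqrt hu
  have h2 := Real.sq_sqrt hv
  unfold edgeMinus edgePlus
  linear_combination (2 * x - (√u ^ 2 - √v ^ 2 + u - v)) * h1 +
    (2 * x + (√u ^ 2 - √v ^ 2 + u - v)) * h2

section Transform

variable {lam mu al be : ℝ} (hlam : 0 < lam) (hmu : 0 < mu) (hal : 0 < al) (hbe : 0 < be)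
include hlam hmu hal hbe

/-- For state-dependent rates this is `critical_point`. For equal rates the modulus bounds together
with vw = 1 force λw² = μ, so the discriminant vanishes and x is an edge of the spectrum; this is
why the edges belong to `criticalSet`. -/
lemma mem_criticalSet {x : ℝ} (h : decayRoot al be x * decayRoot lam mu x = 1) :
    ∃ w v : ℝ, decayRoot lam mu x = w ∧ decayRoot al be x = v ∧ v * w = 1 ∧
      lam * w ^ 2 - (lam + mu - x) * w + mu = 0 ∧ al * v ^ 2 - (al + be - x) * v + be = 0 ∧
      lam * w ^ 2 ≤ mu ∧ al * v ^ 2 ≤ be ∧ x ∈ criticalSet lam mu al be ∧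
      (¬ (al = mu ∧ be = lam) → x = 0 ∨ x = zeta lam mu al be) := by
  have hz : 0 ≤ (x : ℂ).im := by simp
  have hw := isDecayRoot_decayRoot hlam hmu hz
  have hv := isDecayRoot_decayRoot hal hbe hz
  obtain ⟨-, hwi, hvi⟩ := hw.mul_eq_one hmu hv h hz
  obtain ⟨w, hw'⟩ : ∃ w : ℝ, decayRoot lam mu x = w :=
    ⟨(decayRoot lam mu x).re, Complex.ext rfl (by simpa using hwi)⟩
  obtain ⟨v, hv'⟩ : ∃ v : ℝ, decayRoot al be x = v :=
    ⟨(decayRoot al be x).re, Complex.ext rfl (by simpa using hvi)⟩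
  rw [hw'] at hw h
  rw [hv'] at hv h
  have h1 : v * w = 1 := by exact_mod_cast h
  have h2 : lam * w ^ 2 - (lam + mu - x) * w + mu = 0 := by exact_mod_cast hw.eq
  have h3 : al * v ^ 2 - (al + be - x) * v + be = 0 := by exact_mod_cast hv.eq
  have h4 := hw.normSq_le
  have h5 := hv.normSq_le
  rw [Complex.normSq_ofReal, ← sq] at h4 h5
  have hw0 : w ≠ 0 := right_ne_zero_of_mul_eq_one h1
  have key : ¬ (al = mu ∧ be = lam) → x = 0 ∨ x = zeta lam mu al be := by
    intro hne
    rcases critical_point h2 h3 h1 with h6 | h6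
    · exact Or.inl h6.2
    · have hbl : be ≠ lam := by
        rintro rfl
        exact hne ⟨by linarith, rfl⟩
      exact Or.inr (critical_eq_zeta h2 hw0 hbl h6).2.2
  refine ⟨w, v, hw', hv', h1, h2, h3, h4, h5, ?_, key⟩
  by_cases hs : al = mu ∧ be = lam
  · obtain ⟨rfl, rfl⟩ := hs
    have e1 : be * w ^ 2 = al := by
      have : be = be * w ^ 2 * v ^ 2 := by
        have : (v * w) ^ 2 = 1 := by rw [h1]; ring
        linear_combination -be * this
      nlinarith [sq_nonneg v]
    have e2 : (x - edgeMinus be al) * (x - edgePlus be al) = 0 := by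
      rw [← edge_factor hbe.le hal.le]
      have : w ^ 2 * ((be + al - x) ^ 2 - 4 * be * al) = 0 := by
        linear_combination (-(be * w ^ 2 + al + (be + al - x) * w)) * h2 + (be * w ^ 2 - al) * e1
      exact (mul_eq_zero.1 this).resolve_left (pow_ne_zero 2 hw0)
    simp only [criticalSet, Finset.mem_insert, Finset.mem_singleton]
    rcases mul_eq_zero.1 e2 with h | h
    · exact Or.inr (Or.inr (Or.inl (by linarith)))
    · exact Or.inr (Or.inr (Or.inr (by linarith)))
  · simp only [criticalSet, Finset.mem_insert, Finset.mem_singleton]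
    rcases key hs with h | h
    · exact Or.inl h
    · exact Or.inr (Or.inl h)

lemma one_sub_ne_zero_of_im_pos {z : ℂ} (hz : 0 < z.im) :
    1 - decayRoot al be z * decayRoot lam mu z ≠ 0 := by
  intro h
  have := (isDecayRoot_decayRoot hlam hmu hz.le).mul_eq_one hmu
    (isDecayRoot_decayRoot hal hbe hz.le) (by linear_combination -h) hz.le
  exact hz.ne' this.1

/-- The denominator vanishes only where vw = 1, and those points are real by
`IsDecayRoot.mul_eq_one`. -/
lemma continuousOn_transform {S : Set ℝ}
    (hS : ∀ x : ℝ, decayRoot al be x * decayRoot lam mu x = 1 → x ∈ S) (x y : ℝ) :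
    ContinuousOn (transform lam mu al be x y) (upperClosed S) := by
  have hsub : upperClosed S ⊆ {z | 0 ≤ z.im} := fun z hz => hz.1
  have hw := (continuousOn_decayRoot hlam hmu).mono hsub
  have hv := (continuousOn_decayRoot hal hbe).mono hsub
  refine ContinuousOn.div (by fun_prop) (by fun_prop) fun z hz => ?_
  refine mul_ne_zero (by exact_mod_cast hmu.ne') fun h => ?_
  have h1 := (isDecayRoot_decayRoot hlam hmu hz.1).mul_eq_one hmu
    (isDecayRoot_decayRoot hal hbe hz.1) (by linear_combination -h) hz.1
  have e : z = (z.re : ℂ) := Complex.ext rfl (by simpa using h1.1)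
  rw [e] at h
  exact hz.2 z.re (hS z.re (by linear_combination -h)) e

end Transform


/-! ### Atoms of the spectral measures -/

section Mass

variable {lam mu al be : ℝ} (hlam : 0 < lam) (hmu : 0 < mu) (hal : 0 < al) (hbe : 0 < be)
  {ρ : Measure ℝ} [IsFiniteMeasure ρ] {x y : ℝ}
  (hH : ∀ z : ℂ, 0 < z.im → ∫ t : ℝ, ((t : ℂ) - z)⁻¹ ∂ρ = transform lam mu al be x y z)
include hlam hmu hal hbe hH

lemma mass_of_regular {x₀ : ℝ} (h : decayRoot al be x₀ * decayRoot lam mu x₀ ≠ 1) :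
    ρ.real {x₀} = 0 := by
  have hc := continuousOn_transform hlam hmu hal hbe
    (S := {x : ℝ | decayRoot al be x * decayRoot lam mu x = 1}) (fun _ h => h) x y
  have h1 := tendsto_boundary hc (x := x₀) h
  have h2 : Tendsto (fun ε : ℝ => -(ε * Complex.I)) (𝓝[>] 0) (𝓝 0) := by
    have : Continuous fun ε : ℝ => -((ε : ℂ) * Complex.I) := by fun_prop
    simpa using (this.tendsto 0).mono_left nhdsWithin_le_nhds
  have h3 := tendsto_nhds_unique (tendsto_mass hH x₀) (h2.mul h1)
  rw [zero_mul] at h3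
  exact_mod_cast h3

omit hlam hmu hal hbe hH in
lemma tendsto_vertical {p q : ℝ} (hp : 0 < p) (hq : 0 < q) (x₀ : ℝ) :
    Tendsto (fun ε : ℝ => decayRoot p q (x₀ + ε * Complex.I)) (𝓝[>] 0) (𝓝 (decayRoot p q x₀)) :=
  tendsto_boundary (S := ∅) (by
    have := continuousOn_decayRoot hp hq
    simpa [upperClosed] using this) (by simp)

/-- The relation satisfied by the mass at a critical point. -/
lemma mass_relation {x₀ w v : ℝ} (hw : decayRoot lam mu x₀ = w) (hv : decayRoot al be x₀ = v)
    (h1 : v * w = 1) :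
    ρ.real {x₀} * mu * (v * (mu - lam * w ^ 2) + w * (be - al * v ^ 2)) =
      w * (x + y * v) ^ 2 * ((be - al * v ^ 2) * (mu - lam * w ^ 2)) := by
  have hW := tendsto_vertical hlam hmu x₀
  have hV := tendsto_vertical hal hbe x₀
  rw [hw] at hW
  rw [hv] at hV
  have hz : 0 ≤ (x₀ : ℂ).im := by simp
  have hwe := (isDecayRoot_decayRoot hlam hmu hz).eq
  have hve := (isDecayRoot_decayRoot hal hbe hz).eq
  rw [hw] at hwe
  rw [hv] at hve
  have h1c : (v : ℂ) * w = 1 := by exact_mod_cast h1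
  have hA := (hV.mul_const (v : ℂ)).const_mul (al : ℂ) |>.const_sub (be : ℂ)
  have hB := (hW.mul_const (w : ℂ)).const_mul (lam : ℂ) |>.const_sub (mu : ℂ)
  have hN := ((hW.const_mul ((x : ℂ) ^ 2)).add ((hV.mul hW).const_mul (2 * x * y : ℂ))).add
    (hV.const_mul ((y : ℂ) ^ 2))
  have hL := ((tendsto_mass hH x₀).mul_const (mu : ℂ)).mul
    (((hV.mul_const (v : ℂ)).mul (hW.mul hB)).add (hW.mul hA))
  have hR := hN.mul (hA.mul hB)
  -- The relation is kept cross-multiplied, since the factors β - αv² and μ - λw² may vanish.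
  have hLR := tendsto_nhds_unique (hL.congr' ?_) hR
  · have : ((ρ.real {x₀} * mu * (v * (mu - lam * w ^ 2) + w * (be - al * v ^ 2)) : ℝ) : ℂ) =
        (w * (x + y * v) ^ 2 * ((be - al * v ^ 2) * (mu - lam * w ^ 2)) : ℝ) := by
      push_cast
      linear_combination hLR + (-(ρ.real {x₀} : ℂ) * mu * (mu - lam * w ^ 2) * v -
        (be - al * v ^ 2) * (mu - lam * w ^ 2) * y ^ 2 * v) * h1c
    exact_mod_cast this
  · filter_upwards [self_mem_nhdsWithin] with ε hε
    have hε' : 0 < ε := hε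
    set z : ℂ := x₀ + ε * Complex.I with hzdef
    have hzi : 0 < z.im := by simpa [hzdef] using hε'
    have hWe := (isDecayRoot_decayRoot hlam hmu hzi.le).eq
    have hVe := (isDecayRoot_decayRoot hal hbe hzi.le).eq
    have hne := one_sub_ne_zero_of_im_pos hlam hmu hal hbe hzi
    have hmuc : (mu : ℂ) ≠ 0 := by exact_mod_cast hmu.ne'
    set W := decayRoot lam mu z
    set V := decayRoot al be z
    -- Subtracting the characteristic equations at z and x₀ gives exact difference quotients for
    -- both roots. They combine into a multiple of z - x₀ equal to a multiple of 1 - VW, so no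
    -- derivative of a root is needed.
    have e1 : (z - x₀) * W * w = (W - w) * (mu - lam * (W * w)) := by
      linear_combination w * hWe - W * hwe
    have e2 : (z - x₀) * V * v = (V - v) * (be - al * (V * v)) := by
      linear_combination v * hVe - V * hve
    have e3 : -(ε * Complex.I) = -(z - x₀) := by rw [hzdef]; ring
    have key : -(z - x₀) * (V * v * (W * (mu - lam * (W * w))) + W * (be - al * (V * v))) =
        (1 - V * W) * ((be - al * (V * v)) * (mu - lam * (W * w))) := by
      linear_combination (-W * (mu - lam * (W * w))) * e2 - v * (be - al * (V * v)) * e1 +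
        (z - x₀) * W * (be - al * (V * v)) * h1c + (be - al * (V * v)) * (mu - lam * (W * w)) * h1c
    rw [e3, transform]
    change -(z - x₀) * ((x ^ 2 * W + 2 * x * y * (V * W) + y ^ 2 * V) / (mu * (1 - V * W))) * mu * _ = _
    rw [mul_div_assoc', div_mul_eq_mul_div, div_mul_eq_mul_div, div_eq_iff (mul_ne_zero hmuc hne)]
    linear_combination (x ^ 2 * W + 2 * x * y * (V * W) + y ^ 2 * V) * mu * key

/-- No mass at a point where both square roots vanish. -/
lemma mass_of_edge {x₀ w v : ℝ} (hw : decayRoot lam mu x₀ = w) (hv : decayRoot al be x₀ = v)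
    (h1 : v * w = 1) (hA : be - al * v ^ 2 = 0) (hB : mu - lam * w ^ 2 = 0) :
    ρ.real {x₀} = 0 := by
  have hW := tendsto_vertical hlam hmu x₀
  have hV := tendsto_vertical hal hbe x₀
  rw [hw] at hW
  rw [hv] at hV
  have hw0 : w ≠ 0 := right_ne_zero_of_mul_eq_one h1
  have hN := (((hW.const_mul ((x : ℂ) ^ 2)).add ((hV.mul hW).const_mul (2 * x * y : ℂ))).add
    (hV.const_mul ((y : ℂ) ^ 2))).norm
  have hwi : Tendsto (fun ε : ℝ => (decayRoot lam mu (x₀ + ε * Complex.I)).im) (𝓝[>] 0) (𝓝 0) := by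
    have := (Complex.continuous_im.tendsto _).comp hW
    rw [Complex.ofReal_im] at this
    exact this
  have hwn : Tendsto (fun ε : ℝ => Complex.normSq (decayRoot lam mu (x₀ + ε * Complex.I)))
      (𝓝[>] 0) (𝓝 (Complex.normSq w)) := (Complex.continuous_normSq.tendsto _).comp hW
  have hbound := hN.mul ((hwi.div hwn (by simpa using hw0)).const_mul 2)
  rw [zero_div, mul_zero, mul_zero] at hbound
  -- Here βμ = αλ, whence μ|VW|² ≤ λ|W|² and |1 - VW| is at least (μ - λ|W|²)/(2μ). By
  -- `char_root_im`, ε = (Im W / |W|²)(μ - λ|W|²), so ε / (μ|1 - VW|) is at most 2 Im W / |W|²,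
  -- which tends to 0 because the limit w is real.
  have h0 : Tendsto (fun ε : ℝ => -(ε * Complex.I) * transform lam mu al be x y
      (x₀ + ε * Complex.I)) (𝓝[>] 0) (𝓝 0) := by
    refine squeeze_zero_norm' ?_ hbound
    filter_upwards [self_mem_nhdsWithin] with ε hε
    have hε' : 0 < ε := hε
    set z : ℂ := x₀ + ε * Complex.I with hzdef
    have hzi : z.im = ε := by simp [hzdef]
    have hzi' : 0 < z.im := by rw [hzi]; exact hε'
    have hWd := isDecayRoot_decayRoot hlam hmu hzi'.le
    have hVd := isDecayRoot_decayRoot hal hbe hzi'.le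
    have hne := one_sub_ne_zero_of_im_pos hlam hmu hal hbe hzi'
    have hs := hWd.strict hmu hzi'
    have him := char_root_im hmu hWd.eq
    have hWn : 0 < Complex.normSq (decayRoot lam mu z) :=
      Complex.normSq_pos.2 (char_root_ne_zero hmu hWd.eq)
    have hVn := hVd.normSq_le
    have hVn0 : 0 ≤ Complex.normSq (decayRoot al be z) := Complex.normSq_nonneg _
    rw [transform]
    change ‖-(ε * Complex.I) * ((x ^ 2 * decayRoot lam mu z + 2 * x * y * (decayRoot al be z *
      decayRoot lam mu z) + y ^ 2 * decayRoot al be z) / (mu * (1 - decayRoot al be z *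
      decayRoot lam mu z)))‖ ≤ _
    set W := decayRoot lam mu z
    set V := decayRoot al be z
    rw [norm_mul, norm_neg, norm_mul, Complex.norm_I, mul_one, Complex.norm_real, Real.norm_eq_abs,
      abs_of_pos hε', norm_div, norm_mul, Complex.norm_real, Real.norm_eq_abs, abs_of_pos hmu,
      mul_div_assoc', mul_comm ε, mul_div_assoc]
    refine mul_le_mul_of_nonneg_left ?_ (norm_nonneg _)
    set a := Complex.normSq W
    set c := ‖V * W‖ with hc
    have hc0 : 0 ≤ c := norm_nonneg _
    have hc2 : c ^ 2 = Complex.normSq V * a := by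
      rw [hc, ← Complex.normSq_eq_norm_sq, map_mul]
    have hvw2 : v ^ 2 * w ^ 2 = 1 := by rw [← mul_pow, h1, one_pow]
    have hc3 : mu * c ^ 2 ≤ lam * a := by
      have e1 : be * mu = al * lam := by
        linear_combination mu * hA + al * v ^ 2 * hB + al * lam * hvw2
      have e2 : al * (mu * c ^ 2) ≤ al * (lam * a) := by
        rw [hc2]
        nlinarith [mul_le_mul_of_nonneg_left (mul_le_mul_of_nonneg_right hVn hWn.le) hmu.le]
      exact le_of_mul_le_mul_left e2 hal
    have hn : 1 - c ≤ ‖1 - V * W‖ := by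
      have := norm_sub_norm_le (1 : ℂ) (V * W)
      rwa [norm_one] at this
    have hc1 : c < 1 := by
      by_contra! hge
      have := mul_le_mul_of_nonneg_left (one_le_pow₀ hge (n := 2)) hmu.le
      linarith [hs.1]
    have hn2 : mu - lam * a ≤ 2 * (mu * ‖1 - V * W‖) := by
      nlinarith [mul_nonneg hmu.le (sq_nonneg (1 - c))]
    have hpos : 0 < mu * ‖1 - V * W‖ := mul_pos hmu (norm_pos_iff.2 hne)
    have e3 : ε = W.im / a * (mu - lam * a) := by
      rw [div_mul_eq_mul_div, eq_div_iff hWn.ne', him, hzi]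
    have h4 := mul_le_mul_of_nonneg_left hn2 (div_nonneg hs.2.le hWn.le)
    rw [div_le_iff₀ hpos]
    change ε ≤ 2 * (W.im / a) * _
    linarith
  have h3 := tendsto_nhds_unique (tendsto_mass hH x₀) h0
  exact_mod_cast h3

/-- When both inequalities are strict, the eigenvector with coordinates w^n at n and v^{n+1} at -n-1
(before the factor √π) is square summable, and the value is the squared inner product with x f₀ + y
f₋₁ divided by its squared norm. If one inequality is an equality, `mass_relation` gives 0; if both
are, `mass_of_edge` does. -/
lemma mass_of_critical {x₀ w v : ℝ} (hw : decayRoot lam mu x₀ = w) (hv : decayRoot al be x₀ = v)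
    (h1 : v * w = 1) (hA : al * v ^ 2 ≤ be) (hB : lam * w ^ 2 ≤ mu) :
    ρ.real {x₀} = if lam * w ^ 2 < mu ∧ al * v ^ 2 < be then
      (x + y * v) ^ 2 / (mu * (v ^ 2 / (be - al * v ^ 2) + 1 / (mu - lam * w ^ 2))) else 0 := by
  have hrel := mass_relation hlam hmu hal hbe hH hw hv h1
  have hw0 : w ≠ 0 := right_ne_zero_of_mul_eq_one h1
  have hv0 : v ≠ 0 := left_ne_zero_of_mul_eq_one h1
  split_ifs with h
  · have hA' : 0 < be - al * v ^ 2 := by linarith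
    have hB' : 0 < mu - lam * w ^ 2 := by linarith
    have hden : 0 < v ^ 2 / (be - al * v ^ 2) + 1 / (mu - lam * w ^ 2) := by positivity
    rw [eq_div_iff (mul_pos hmu hden).ne']
    have e : v ^ 2 / (be - al * v ^ 2) + 1 / (mu - lam * w ^ 2) =
        v * (v * (mu - lam * w ^ 2) + w * (be - al * v ^ 2)) /
          ((be - al * v ^ 2) * (mu - lam * w ^ 2)) := by
      rw [div_add_div _ _ hA'.ne' hB'.ne']
      congr 1
      linear_combination -(be - al * v ^ 2) * h1
    rw [e, mul_div_assoc', mul_div_assoc', div_eq_iff (mul_pos hA' hB').ne']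
    linear_combination v * hrel + (x + y * v) ^ 2 * ((be - al * v ^ 2) * (mu - lam * w ^ 2)) * h1
  · rcases eq_or_lt_of_le hA with hA0 | hA0
    · rcases eq_or_lt_of_le hB with hB0 | hB0
      · exact mass_of_edge hlam hmu hal hbe hH hw hv h1 (by linarith) (by linarith)
      · have hA1 : be - al * v ^ 2 = 0 := by linarith
        rw [hA1, zero_mul, mul_zero, mul_zero, add_zero] at hrel
        have := (mul_eq_zero.1 hrel).resolve_right (mul_ne_zero hv0 (by linarith))
        exact (mul_eq_zero.1 this).resolve_right hmu.ne'
    · rcases eq_or_lt_of_le hB with hB0 | hB0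
      · have hB1 : mu - lam * w ^ 2 = 0 := by linarith
        rw [hB1, mul_zero, mul_zero, mul_zero, zero_add] at hrel
        have := (mul_eq_zero.1 hrel).resolve_right (mul_ne_zero hw0 (by linarith))
        exact (mul_eq_zero.1 this).resolve_right hmu.ne'
      · exact absurd ⟨hB0, hA0⟩ h

/-- The quadratic form of the matrix of masses at `zeta`. -/
def zetaQuad (lam mu al be x y : ℝ) : ℝ :=
  x ^ 2 * zetaMass lam mu al be 0 0 + 2 * x * y * zetaMass lam mu al be 0 1 +
    y ^ 2 * zetaMass lam mu al be 1 1

open Classical in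
-- A critical point has w = 1, which is the point 0, or (β-λ)w = α-μ. In the second case with β ≠ λ,
-- μ - λw² and β - αv² are -C₁/(β-λ)² and C₂/(α-μ)², so strict decay on both sides is the atom
-- condition at ζ.
theorem mass_eq (x₀ : ℝ) : ρ.real {x₀} =
    (if x₀ = 0 then if lam < mu ∧ al < be then (x + y) ^ 2 * zeroMass lam mu al be else 0 else 0) +
    (if x₀ = zeta lam mu al be then
      if ZetaCondition lam mu al be then zetaQuad lam mu al be x y else 0 else 0) := by
  have hZ0 := zeta_ne_zero (lam := lam) hmu hal hbe
  have hZ := zetaCondition_iff (lam := lam) hmu hal hbe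
  have hzero : lam < mu ∧ al < be → decayRoot lam mu (0 : ℝ) = 1 ∧ decayRoot al be (0 : ℝ) = 1 := by
    rintro ⟨h1, h2⟩
    constructor
    · rw [Complex.ofReal_zero, decayRoot_zero hlam hmu, min_eq_left, Complex.ofReal_one]
      rw [le_div_iff₀ hlam]; linarith
    · rw [Complex.ofReal_zero, decayRoot_zero hal hbe, min_eq_left, Complex.ofReal_one]
      rw [le_div_iff₀ hal]; linarith
  have hzeta : ZetaCondition lam mu al be →
      decayRoot lam mu (zeta lam mu al be) = ((al - mu) / (be - lam) : ℝ) ∧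
      decayRoot al be (zeta lam mu al be) = ((be - lam) / (al - mu) : ℝ) := by
    intro h
    obtain ⟨h1, h2, h3, h4⟩ := hZ.1 h
    obtain ⟨e1, e2⟩ := zeta_char_root (lam := lam) (be := be) h1 h2
    have hp1 : 0 < (be - lam) ^ 2 := by have := sub_ne_zero.2 h2; positivity
    have hp2 : 0 < (al - mu) ^ 2 := by have := sub_ne_zero.2 h1; positivity
    unfold constOne at h3
    unfold constTwo at h4
    constructor
    · refine decayRoot_real hlam hmu e1 ?_
      rw [div_pow, mul_div_assoc', div_le_iff₀ hp1]; linarith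
    · refine decayRoot_real hal hbe e2 ?_
      rw [div_pow, mul_div_assoc', div_le_iff₀ hp2]; linarith
  by_cases hcrit : decayRoot al be x₀ * decayRoot lam mu x₀ = 1
  · obtain ⟨w, v, hw, hv, hvw, hwe, hve, hwn, hvn, -, -⟩ := mem_criticalSet hlam hmu hal hbe hcrit
    rw [mass_of_critical hlam hmu hal hbe hH hw hv hvw hvn hwn]
    have hw0 : w ≠ 0 := right_ne_zero_of_mul_eq_one hvw
    by_cases hw1 : w = 1
    · subst hw1
      have hv1 : v = 1 := by simpa using hvw
      subst hv1
      have hx0 : x₀ = 0 := by linarith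
      subst hx0
      have hz : (if (0 : ℝ) = zeta lam mu al be then
          if ZetaCondition lam mu al be then zetaQuad lam mu al be x y else 0 else 0) = 0 := by
        split_ifs with h1 h2
        · exact absurd h1.symm (hZ0 h2)
        · rfl
        · rfl
      rw [hz, if_pos rfl, add_zero]
      simp only [one_pow, mul_one]
      split_ifs with h
      · have h1 : be - al ≠ 0 := by linarith [h.2]
        have h2 : mu - lam ≠ 0 := by linarith [h.1]
        have h3 : be - al + mu - lam ≠ 0 := by linarith [h.1, h.2]
        have h4 : mu - lam + (be - al) ≠ 0 := by linarith [h.1, h.2]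
        unfold zeroMass
        rw [div_add_div _ _ h1 h2]
        field_simp
        ring
      · rfl
    · have hz : (if x₀ = 0 then if lam < mu ∧ al < be then (x + y) ^ 2 * zeroMass lam mu al be
          else 0 else 0) = 0 := by
        split_ifs with h1 h2
        · rw [h1, (hzero h2).1] at hw
          exact absurd (by exact_mod_cast hw.symm) hw1
        · rfl
        · rfl
      rw [hz, zero_add]
      have hcr := (critical_point hwe hve hvw).resolve_left fun h => hw1 h.1
      by_cases hbl : be = lam
      · have ham : al = mu := by rw [hbl] at hcr; linarith
        have h1 : ¬ ZetaCondition lam mu al be := fun h => (hZ.1 h).2.1 hbl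
        rw [if_neg h1, ite_self, if_neg]
        rintro ⟨h2, h3⟩
        have hvw2 : v ^ 2 * w ^ 2 = 1 := by rw [← mul_pow, hvw, one_pow]
        have : 0 < w ^ 2 := by positivity
        rw [hbl, ham] at h3
        nlinarith
      · obtain ⟨ham, hwz, hxz⟩ := critical_eq_zeta hwe hw0 hbl hcr
        have hbl' : be - lam ≠ 0 := sub_ne_zero.2 hbl
        have ham' : al - mu ≠ 0 := sub_ne_zero.2 ham
        have hvz : v = (be - lam) / (al - mu) := by
          rw [hwz] at hvw
          field_simp at hvw ⊢
          linarith
        rw [if_pos hxz]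
        have hp1 : 0 < (be - lam) ^ 2 := by positivity
        have hp2 : 0 < (al - mu) ^ 2 := by positivity
        have e1 : mu - lam * w ^ 2 = -constOne lam mu al be / (be - lam) ^ 2 := by
          rw [hwz, constOne]; field_simp; ring
        have e2 : be - al * v ^ 2 = constTwo lam mu al be / (al - mu) ^ 2 := by
          rw [hvz, constTwo]; field_simp
        have hiff : (lam * w ^ 2 < mu ∧ al * v ^ 2 < be) ↔ ZetaCondition lam mu al be := by
          rw [hZ, ← sub_pos, ← sub_pos (a := be), e1, e2, div_pos_iff_of_pos_right hp1,
            div_pos_iff_of_pos_right hp2, neg_pos]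
          exact ⟨fun h => ⟨ham, hbl, h.1, h.2⟩, fun h => ⟨h.2.2.1, h.2.2.2⟩⟩
        rw [if_congr hiff rfl rfl]
        split_ifs with h
        · obtain ⟨-, -, h3, h4⟩ := hZ.1 h
          have hs := sum_ne_zero_of_zetaCondition hmu hal hbe h
          -- This difference is the numerator that appears when the two half-line contributions to
          -- the squared norm are added.
          have hdiff : constOne lam mu al be - constTwo lam mu al be =
              -((al - mu) * (be - lam) * (al - be + lam - mu)) := by
            unfold constOne constTwo; ring
          rw [e1, e2, hvz]
          have e3 : ((be - lam) / (al - mu)) ^ 2 / (constTwo lam mu al be / (al - mu) ^ 2) +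
              1 / (-constOne lam mu al be / (be - lam) ^ 2) =
              -((be - lam) ^ 2 * ((al - mu) * (be - lam) * (al - be + lam - mu))) /
                (constOne lam mu al be * constTwo lam mu al be) := by
            have h3' := h3.ne
            have h4' := h4.ne'
            field_simp
            linear_combination hdiff
          rw [e3]
          have h3' := h3.ne
          have h4' := h4.ne'
          simp only [zetaQuad, zetaMass, Matrix.smul_apply, Matrix.of_apply, Matrix.cons_val',
            Matrix.cons_val_zero, Matrix.cons_val_one, Matrix.cons_val_fin_one, smul_eq_mul]
          field_simp
          ring
        · rfl
  · rw [mass_of_regular hlam hmu hal hbe hH hcrit]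
    have hz : (if x₀ = 0 then if lam < mu ∧ al < be then (x + y) ^ 2 * zeroMass lam mu al be
        else 0 else 0) = 0 := by
      split_ifs with h1 h2
      · rw [h1, (hzero h2).1, (hzero h2).2, mul_one] at hcrit
        exact absurd rfl hcrit
      · rfl
      · rfl
    rw [hz, zero_add]
    split_ifs with h1 h2
    · obtain ⟨h3, h4, -, -⟩ := hZ.1 h2
      rw [h1, (hzeta h2).1, (hzeta h2).2, ← Complex.ofReal_mul] at hcrit
      refine absurd ?_ hcrit
      have h3' := sub_ne_zero.2 h3
      have h4' := sub_ne_zero.2 h4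
      norm_cast
      field_simp
    · rfl
    · rfl

end Mass


/-- The density of the absolutely continuous part, from the boundary values of the transforms. -/
def specDensity (lam mu al be : ℝ) (k l : Fin 2) (x : ℝ) : ℝ :=
  ((!![decayRoot lam mu x, decayRoot al be x * decayRoot lam mu x;
      decayRoot al be x * decayRoot lam mu x, decayRoot al be x] : Matrix (Fin 2) (Fin 2) ℂ) k l /
    (mu * (1 - decayRoot al be x * decayRoot lam mu x))).im / Real.pi

lemma transform_im (lam mu al be x y t : ℝ) : (transform lam mu al be x y t).im / Real.pi =
    x ^ 2 * specDensity lam mu al be 0 0 t + 2 * x * y * specDensity lam mu al be 0 1 t +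
      y ^ 2 * specDensity lam mu al be 1 1 t := by
  have h : transform lam mu al be x y t =
      (x ^ 2 : ℝ) * (decayRoot lam mu t / (mu * (1 - decayRoot al be t * decayRoot lam mu t))) +
      (2 * x * y : ℝ) * (decayRoot al be t * decayRoot lam mu t /
        (mu * (1 - decayRoot al be t * decayRoot lam mu t))) +
      (y ^ 2 : ℝ) * (decayRoot al be t / (mu * (1 - decayRoot al be t * decayRoot lam mu t))) := by
    rw [transform]; push_cast; ring
  rw [h, Complex.add_im, Complex.add_im, Complex.im_ofReal_mul, Complex.im_ofReal_mul,
    Complex.im_ofReal_mul]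
  simp only [specDensity, Matrix.of_apply, Matrix.cons_val', Matrix.cons_val_zero,
    Matrix.cons_val_one, Matrix.cons_val_fin_one]
  ring

/-! ### Assembling the spectral matrix from density and atoms -/

section Measure

variable {lam mu al be : ℝ} (hlam : 0 < lam) (hmu : 0 < mu) (hal : 0 < al) (hbe : 0 < be)
include hlam hmu hal hbe

lemma measurable_transform (x y : ℝ) :
    Measurable fun t : ℝ => (transform lam mu al be x y t).im / Real.pi := by
  have hm : ∀ {p q : ℝ}, 0 < p → 0 < q → Measurable fun t : ℝ => decayRoot p q t :=
    fun hp hq => ((continuousOn_decayRoot hp hq).comp_continuous Complex.continuous_ofReal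
      fun t => by simp).measurable
  have h1 := hm hlam hmu
  have h2 := hm hal hbe
  unfold transform
  fun_prop

open Classical in
-- Inversion describes the measure off the finite set of critical points, and the masses are added
-- there one point at a time. Integrability of the density comes for free, since it is nonnegative
-- almost everywhere and bounded in mass by ρ.
theorem measure_apply {ρ : Measure ℝ} [IsFiniteMeasure ρ] {x y : ℝ}
    (hH : ∀ z : ℂ, 0 < z.im → ∫ t : ℝ, ((t : ℂ) - z)⁻¹ ∂ρ = transform lam mu al be x y z) :
    Integrable (fun t : ℝ => (transform lam mu al be x y t).im / Real.pi) ∧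
    ∀ E : Set ℝ, MeasurableSet E → ρ.real E =
      (∫ t in E, (transform lam mu al be x y t).im / Real.pi) +
      ((if 0 ∈ E then if lam < mu ∧ al < be then (x + y) ^ 2 * zeroMass lam mu al be else 0 else 0) +
      (if zeta lam mu al be ∈ E then
        if ZetaCondition lam mu al be then zetaQuad lam mu al be x y else 0 else 0)) := by
  set S := criticalSet lam mu al be with hS
  have hcS : ∀ t : ℝ, decayRoot al be t * decayRoot lam mu t = 1 → t ∈ (S : Set ℝ) := fun t ht => by
    obtain ⟨w, v, -, -, -, -, -, -, -, h, -⟩ := mem_criticalSet hlam hmu hal hbe ht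
    exact h
  have hc := continuousOn_transform hlam hmu hal hbe hcS x y
  have hd := restrict_compl_eq_withDensity hH hc S.finite_toSet
  have hm := measurable_transform hlam hmu hal hbe x y
  have hnn : 0 ≤ᵐ[volume] fun t : ℝ => (transform lam mu al be x y t).im / Real.pi := by
    have : (S : Set ℝ)ᶜ ∈ ae volume := compl_mem_ae_iff.2 (S.finite_toSet.measure_zero _)
    filter_upwards [this] with t ht
    exact div_nonneg (boundary_im_nonneg hH hc ht) Real.pi_pos.le
  have hint : Integrable (fun t : ℝ => (transform lam mu al be x y t).im / Real.pi) := by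
    rw [← lintegral_ofReal_ne_top_iff_integrable hm.aestronglyMeasurable hnn]
    have := congrArg (fun ν : Measure ℝ => ν Set.univ) hd
    simp only [withDensity_apply _ MeasurableSet.univ, Measure.restrict_univ] at this
    rw [← this]
    exact measure_ne_top _ _
  refine ⟨hint, fun E hE => ?_⟩
  have hSm : MeasurableSet (S : Set ℝ) := S.finite_toSet.measurableSet
  have h1 : ρ.real (E \ S) = ∫ t in E, (transform lam mu al be x y t).im / Real.pi := by
    have := congrArg (fun ν : Measure ℝ => ν E) hd
    simp only [withDensity_apply _ hE, Measure.restrict_apply hE] at this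
    rw [integral_eq_lintegral_of_nonneg_ae (ae_restrict_of_ae hnn) hm.aestronglyMeasurable, ← this]
    rfl
  have h2 : E ∩ S = ((S.filter (· ∈ E) : Finset ℝ) : Set ℝ) := by
    ext t; simp [and_comm]
  rw [← measureReal_inter_add_sdiff hSm, h1, add_comm, h2, ← sum_measureReal_singleton]
  congr 1
  simp only [mass_eq hlam hmu hal hbe hH, Finset.sum_add_distrib, Finset.sum_ite_eq',
    Finset.mem_filter]
  have m1 : (0 : ℝ) ∈ S := by simp [hS, criticalSet]
  have m2 : zeta lam mu al be ∈ S := by simp [hS, criticalSet]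
  simp only [m1, m2, true_and]

lemma specMat_apply (E : Set ℝ) (hE : MeasurableSet E) (x y : ℝ) :
    x ^ 2 * (boundedRates hlam hmu hal hbe).jacobiModel.specMat 0 0 E +
      2 * x * y * (boundedRates hlam hmu hal hbe).jacobiModel.specMat 0 1 E +
      y ^ 2 * (boundedRates hlam hmu hal hbe).jacobiModel.specMat 1 1 E =
    (spectralMeasure (boundedRates hlam hmu hal hbe).jacobiModel.isSelfAdjoint
      ((x : ℂ) • JacobiModel.genVec (BoundedRates.basisVec (birth lam be) (death mu al)) 0 +
        (y : ℂ) • JacobiModel.genVec (BoundedRates.basisVec (birth lam be) (death mu al)) 1)).real E := by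
  have h1 := congrArg (fun s : SignedMeasure ℝ => s E)
    ((boundedRates hlam hmu hal hbe).jacobiModel.specMat_quadratic x y)
  simpa only [add_apply, smul_apply, smul_eq_mul,
      Measure.toSignedMeasure_apply_measurable hE] using h1

lemma transform_spectralMeasure (x y : ℝ) (z : ℂ) (hz : 0 < z.im) :
    ∫ t : ℝ, ((t : ℂ) - z)⁻¹ ∂(spectralMeasure
      (boundedRates hlam hmu hal hbe).jacobiModel.isSelfAdjoint
      ((x : ℂ) • JacobiModel.genVec (BoundedRates.basisVec (birth lam be) (death mu al)) 0 +
        (y : ℂ) • JacobiModel.genVec (BoundedRates.basisVec (birth lam be) (death mu al)) 1)) =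
      transform lam mu al be x y z := by
  have hw := isDecayRoot_decayRoot hlam hmu hz.le
  have hv := isDecayRoot_decayRoot hal hbe hz.le
  refine stieltjes_quadratic hlam hmu hal hbe x y hw.eq hv.eq (hw.strict hmu hz).1
    (hv.strict hbe hz).1 (one_sub_ne_zero_of_im_pos hlam hmu hal hbe hz) fun t _ h => ?_
  rw [← h] at hz
  simp at hz

/-- The quadratic forms at (1,0), (0,1) and (1,1) determine the three entries of the symmetric
matrix. -/
theorem specMat_eq (k l : Fin 2) :
    Integrable (specDensity lam mu al be k l) ∧
    (boundedRates hlam hmu hal hbe).jacobiModel.specMat k l =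
      (volume.withDensityᵥ (specDensity lam mu al be k l)) + discretePart lam mu al be k l := by
  classical
  have hA := fun x y => measure_apply hlam hmu hal hbe
    (transform_spectralMeasure hlam hmu hal hbe x y)
  simp only [transform_im] at hA
  set Ψ := (boundedRates hlam hmu hal hbe).jacobiModel.specMat with hΨ
  have i00 : Integrable (specDensity lam mu al be 0 0) := by simpa using (hA 1 0).1
  have i11 : Integrable (specDensity lam mu al be 1 1) := by simpa using (hA 0 1).1
  have i01 : Integrable (specDensity lam mu al be 0 1) := by
    refine ((((hA 1 1).1.sub i00).sub i11).div_const 2).congr (Eventually.of_forall fun t => ?_)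
    simp only [Pi.sub_apply]
    ring
  have key : ∀ E, MeasurableSet E → ∀ x y : ℝ, x ^ 2 * Ψ 0 0 E + 2 * x * y * Ψ 0 1 E +
      y ^ 2 * Ψ 1 1 E = x ^ 2 * (∫ t in E, specDensity lam mu al be 0 0 t) +
        2 * x * y * (∫ t in E, specDensity lam mu al be 0 1 t) +
        y ^ 2 * (∫ t in E, specDensity lam mu al be 1 1 t) +
      ((if 0 ∈ E then if lam < mu ∧ al < be then (x + y) ^ 2 * zeroMass lam mu al be else 0 else 0) +
      (if zeta lam mu al be ∈ E then
        if ZetaCondition lam mu al be then zetaQuad lam mu al be x y else 0 else 0)) := by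
    intro E hE x y
    rw [specMat_apply hlam hmu hal hbe E hE, (hA x y).2 E hE, integral_add, integral_add,
      integral_const_mul, integral_const_mul, integral_const_mul]
    · exact i00.integrableOn.const_mul _
    · exact i01.integrableOn.const_mul _
    · exact (i00.integrableOn.const_mul _).add (i01.integrableOn.const_mul _)
    · exact i11.integrableOn.const_mul _
  have hdisc : ∀ k l, ∀ E, MeasurableSet E → discretePart lam mu al be k l E =
      (if 0 ∈ E then if lam < mu ∧ al < be then zeroMass lam mu al be else 0 else 0) +
      (if zeta lam mu al be ∈ E then
        if ZetaCondition lam mu al be then zetaMass lam mu al be k l else 0 else 0) := by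
    intro k l E hE
    rw [discretePart, add_apply]
    congr 1
    · by_cases h : lam < mu ∧ al < be
      · simp only [if_pos h]
        by_cases h0 : (0 : ℝ) ∈ E <;> simp [h0, hE]
      · simp [h]
    · by_cases h : ZetaCondition lam mu al be
      · simp only [if_pos h]
        by_cases h0 : zeta lam mu al be ∈ E <;> simp [h0, hE]
      · simp [h]
  have e00 : Ψ 0 0 = (volume.withDensityᵥ (specDensity lam mu al be 0 0)) +
      discretePart lam mu al be 0 0 := by
    ext E hE
    have h := key E hE 1 0
    rw [add_apply, withDensityᵥ_apply i00 hE, hdisc _ _ E hE]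
    simpa [zetaQuad] using h
  have e11 : Ψ 1 1 = (volume.withDensityᵥ (specDensity lam mu al be 1 1)) +
      discretePart lam mu al be 1 1 := by
    ext E hE
    have h := key E hE 0 1
    rw [add_apply, withDensityᵥ_apply i11 hE, hdisc _ _ E hE]
    simpa [zetaQuad] using h
  have e01 : Ψ 0 1 = (volume.withDensityᵥ (specDensity lam mu al be 0 1)) +
      discretePart lam mu al be 0 1 := by
    ext E hE
    have h1 := key E hE 1 0
    have h2 := key E hE 0 1
    have h3 := key E hE 1 1
    rw [add_apply, withDensityᵥ_apply i01 hE, hdisc _ _ E hE]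
    simp only [zetaQuad] at h1 h2 h3
    split_ifs at h1 h2 h3 ⊢ <;> linarith
  have hsymm : Ψ 1 0 = Ψ 0 1 := (boundedRates hlam hmu hal hbe).jacobiModel.specMat_symm 1 0
  have hds : specDensity lam mu al be 1 0 = specDensity lam mu al be 0 1 := rfl
  have hdd : discretePart lam mu al be 1 0 = discretePart lam mu al be 0 1 := by
    simp [discretePart, zetaMass]
  fin_cases k <;> fin_cases l
  · exact ⟨i00, e00⟩
  · exact ⟨i01, e01⟩
  · refine ⟨i01, ?_⟩
    change Ψ 1 0 = (volume.withDensityᵥ (specDensity lam mu al be 1 0)) +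
      discretePart lam mu al be 1 0
    rw [hsymm, hds, hdd, e01]
  · exact ⟨i11, e11⟩

/-- One spectral matrix has been constructed, and uniqueness turns this into the equivalence. Only
the almost everywhere class of the density matters, so exceptional points may be ignored. -/
theorem hasSpectralMatrix_of_ae {Q : Fin 2 → ℤ → ℝ[X]}
    (hQ : IsGeneratedFamily (birth lam be) (death mu al) Q) {w : ℝ → Matrix (Fin 2) (Fin 2) ℝ}
    (hw : ∀ᵐ x, ∀ k l, w x k l = specDensity lam mu al be k l x) :
    HasSpectralMatrix lam mu al be Q w := by
  have hae : ∀ k l, (fun x => w x k l) =ᵐ[volume] specDensity lam mu al be k l := fun k l => by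
    filter_upwards [hw] with x hx
    exact hx k l
  have hi : ∀ k l, Integrable fun x => w x k l := fun k l =>
    (specMat_eq hlam hmu hal hbe k l).1.congr (hae k l).symm
  obtain ⟨K, c, hc, hgrow⟩ := potential_growth hlam hmu hal hbe
  have hspec := (boundedRates hlam hmu hal hbe).jacobiModel.isSpectralMatrix_specMat hQ hc hgrow
  have heq : (boundedRates hlam hmu hal hbe).jacobiModel.specMat =
      fun k l => (volume.withDensityᵥ fun x => w x k l) + discretePart lam mu al be k l := by
    funext k l
    rw [(specMat_eq hlam hmu hal hbe k l).2, WithDensityᵥEq.congr_ae (hae k l)]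
  refine ⟨hi, fun Ψ => ⟨fun h => ?_, fun h => ?_⟩⟩
  · rw [← heq]
    exact IsSpectralMatrix.unique hQ (fun i => ((boundedRates hlam hmu hal hbe).potential_pos i).ne') h hspec
  · rw [h, ← heq]
    exact hspec

end Measure


/-! ### Explicit densities -/

/-- The sign of `p + q - x`. -/
def sideSign (p q x : ℝ) : ℝ := if x ≤ p + q then 1 else -1

section Boundary

variable {p q : ℝ} (hp : 0 < p) (hq : 0 < q)
include hp hq

/-- This expression is the boundary value from above of the square root of the discriminant. For
real roots, taking the one of smaller modulus fixes the sign as that of p + q - x; between the edges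
Im w ≥ 0 makes the imaginary part negative. -/
lemma boundary_root (x : ℝ) : (p : ℂ) + q - x - 2 * p * decayRoot p q x =
    (sideSign p q x * rootPlus p q x : ℝ) - (rootMinus p q x : ℝ) * Complex.I := by
  have hz : 0 ≤ (x : ℂ).im := by simp
  have hW := isDecayRoot_decayRoot hp hq hz
  have hn := hW.normSq_le
  have hi := hW.im_nonneg
  have he := hW.eq
  set W := decayRoot p q x
  have hre := congrArg Complex.re he
  have him := congrArg Complex.im he
  simp [sq] at hre him
  rw [Complex.normSq_apply] at hn
  set c := W.re
  set d := W.im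
  have h1 : d * (2 * p * c - (p + q - x)) = 0 := by linarith
  have key : p + q - x - 2 * p * c = sideSign p q x * rootPlus p q x ∧
      2 * p * d = rootMinus p q x := by
    rcases mul_eq_zero.1 h1 with h2 | h2
    · rw [h2] at hre hn ⊢
      have e1 : (p + q - x) ^ 2 - 4 * p * q = (p + q - x - 2 * p * c) ^ 2 := by
        linear_combination -4 * p * hre
      have e2 : (p + q - x - 2 * p * c) * c = q - p * c ^ 2 := by linear_combination -hre
      have e3 : (p + q - x) * c = q + p * c ^ 2 := by linear_combination -hre
      constructor
      · rw [rootPlus, e1, Real.sqrt_sq_eq_abs, sideSign]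
        have e4 : 0 < (p + q - x) * c := by rw [e3]; positivity
        have e5 : 0 ≤ (p + q - x - 2 * p * c) * c := by rw [e2]; nlinarith
        split_ifs with h
        · have hc : 0 < c := by
            by_contra! hc
            nlinarith [mul_nonneg_of_nonpos_of_nonpos (by linarith : x - (p + q) ≤ 0) hc]
          rw [abs_of_nonneg (nonneg_of_mul_nonneg_left e5 hc), one_mul]
        · have hc : c < 0 := by
            by_contra! hc
            nlinarith [mul_nonneg (by linarith : 0 ≤ x - (p + q)) hc]
          have : p + q - x - 2 * p * c ≤ 0 := by
            by_contra! h6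
            nlinarith [mul_pos_of_neg_of_neg hc (neg_neg_of_pos h6)]
          rw [abs_of_nonpos this]
          ring
      · rw [rootMinus, e1, mul_zero, Real.sqrt_eq_zero_of_nonpos]
        nlinarith [sq_nonneg (p + q - x - 2 * p * c)]
    · have e1 : (p + q - x) ^ 2 - 4 * p * q = -(2 * p * d) ^ 2 := by
        linear_combination -(2 * p * c + (p + q - x)) * h2 - 4 * p * hre + 4 * p * c * h2
      rw [rootPlus, rootMinus, e1, neg_neg, Real.sqrt_sq (by positivity),
        Real.sqrt_eq_zero_of_nonpos (by nlinarith [sq_nonneg (2 * p * d)]), mul_zero]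
      exact ⟨by linarith, rfl⟩
  apply Complex.ext
  · simp only [Complex.sub_re, Complex.add_re, Complex.ofReal_re, Complex.mul_re, Complex.I_re,
      Complex.ofReal_im, Complex.I_im, Complex.re_ofNat, Complex.im_ofNat, Complex.mul_im]
    linarith [key.1]
  · simp only [Complex.sub_im, Complex.add_im, Complex.ofReal_re, Complex.mul_re, Complex.I_re,
      Complex.ofReal_im, Complex.I_im, Complex.re_ofNat, Complex.im_ofNat, Complex.mul_im]
    linarith [key.2]

lemma edge_lt : edgeMinus p q < p + q ∧ p + q < edgePlus p q := by
  have h1 := Real.sq_sqrt hp.le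
  have h2 := Real.sq_sqrt hq.le
  have h3 := mul_pos (Real.sqrt_pos.2 hp) (Real.sqrt_pos.2 hq)
  unfold edgeMinus edgePlus
  constructor <;> nlinarith

lemma rootPlus_eq_zero {x : ℝ} (h1 : edgeMinus p q ≤ x) (h2 : x ≤ edgePlus p q) :
    rootPlus p q x = 0 := by
  rw [rootPlus, edge_factor hp.le hq.le]
  exact Real.sqrt_eq_zero_of_nonpos (mul_nonpos_of_nonneg_of_nonpos (by linarith) (by linarith))

lemma rootMinus_of_le {x : ℝ} (h : x ≤ edgeMinus p q) :
    rootMinus p q x = 0 ∧ sideSign p q x = 1 := by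
  have h1 := edge_lt hp hq
  constructor
  · rw [rootMinus, edge_factor hp.le hq.le]
    exact Real.sqrt_eq_zero_of_nonpos (by nlinarith)
  · rw [sideSign, if_pos (by linarith)]

lemma rootMinus_of_ge {x : ℝ} (h : edgePlus p q ≤ x) :
    rootMinus p q x = 0 ∧ sideSign p q x = -1 := by
  have h1 := edge_lt hp hq
  constructor
  · rw [rootMinus, edge_factor hp.le hq.le]
    exact Real.sqrt_eq_zero_of_nonpos (by nlinarith)
  · rw [sideSign, if_neg (by linarith)]

end Boundary

/-- The Stieltjes transforms in terms of the two square roots. -/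
lemma transform_rational {lam mu al be x : ℝ} {w v : ℂ} (hmu : 0 < mu)
    (hwe : lam * w ^ 2 - (lam + mu - x) * w + mu = 0)
    (hve : al * v ^ 2 - (al + be - x) * v + be = 0) (hne : 1 - v * w ≠ 0)
    (hD : denom lam mu al be x ≠ 0) (k l : Fin 2) :
    (!![w, v * w; v * w, v] : Matrix (Fin 2) (Fin 2) ℂ) k l / (mu * (1 - v * w)) =
      ((pMat lam mu al be x k l : ℝ) + (qMat lam mu al be x k l : ℝ) * (lam + mu - x - 2 * lam * w) +
        (rMat lam mu al be x k l : ℝ) * (al + be - x - 2 * al * v) +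
        (sMat lam mu al be x k l : ℝ) * ((lam + mu - x - 2 * lam * w) * (al + be - x - 2 * al * v))) /
      (denom lam mu al be x : ℝ) := by
  have hmuc : (mu : ℂ) ≠ 0 := by exact_mod_cast hmu.ne'
  rw [div_eq_div_iff (mul_ne_zero hmuc hne) (by exact_mod_cast hD)]
  -- After clearing denominators each entry is a polynomial identity modulo the two characteristic
  -- equations; the multipliers below are the corresponding cofactors.
  fin_cases k <;> fin_cases l <;>
  simp only [Fin.zero_eta, Fin.mk_one, Matrix.of_apply, Matrix.cons_val', Matrix.cons_val_zero,
    Matrix.cons_val_one, Matrix.cons_val_fin_one, pMat, qMat, rMat, sMat, denom] <;> push_cast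
  · linear_combination (-2 * mu * v * (((al - mu) * x ^ 2
      + (-al ^ 2 - al * be - al * lam + al * mu + 2 * be * mu) * x
      - (al - be) * (al * lam - be * mu)) + ((mu - al) * x + al * lam - be * mu) *
      (al + be - x - 2 * al * v))) * hwe +
      (-2 * mu * w * ((mu - al) * x ^ 2 + (2 * al * lam + al * mu - be * mu - lam * mu - mu ^ 2) * x
      - (lam - mu) * (al * lam - be * mu)) - 2 * mu * ((mu - al) * x + al * lam - be * mu) *
      (2 * mu - (lam + mu - x) * w)) * hve
  · linear_combination (-2 * mu * v * (((al * lam + be * mu - 2 * al * be) * x -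
      (al - be) * (al * lam - be * mu)) + (al * lam - be * mu) *
      (al + be - x - 2 * al * v))) * hwe +
      (-2 * mu * w * ((al * lam + be * mu - 2 * lam * mu) * x - (lam - mu) * (al * lam - be * mu))
      - 2 * mu * (al * lam - be * mu) * (2 * mu - (lam + mu - x) * w)) * hve
  · linear_combination (-2 * mu * v * (((al * lam + be * mu - 2 * al * be) * x -
      (al - be) * (al * lam - be * mu)) + (al * lam - be * mu) *
      (al + be - x - 2 * al * v))) * hwe +
      (-2 * mu * w * ((al * lam + be * mu - 2 * lam * mu) * x - (lam - mu) * (al * lam - be * mu))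
      - 2 * mu * (al * lam - be * mu) * (2 * mu - (lam + mu - x) * w)) * hve
  · linear_combination (-2 * mu * v * (((be - lam) * x ^ 2
      + (-(al * be) + 2 * al * lam - be ^ 2 + be * lam - be * mu) * x
      - (al - be) * (al * lam - be * mu)) + ((be - lam) * x + al * lam - be * mu) *
      (al + be - x - 2 * al * v))) * hwe +
      (-2 * mu * w * ((lam - be) * x ^ 2 + (-(al * lam) + be * lam + 2 * be * mu - lam ^ 2 - lam * mu) * x
      - (lam - mu) * (al * lam - be * mu)) - 2 * mu * ((be - lam) * x + al * lam - be * mu) *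
      (2 * mu - (lam + mu - x) * w)) * hve

section Density

variable {lam mu al be : ℝ} (hlam : 0 < lam) (hmu : 0 < mu) (hal : 0 < al) (hbe : 0 < be)
include hmu

/-- If α = μ the bracket in D is μ(λ-β)², and if β = λ it is λ(α-μ)²; otherwise it is linear in x
with root ζ. The fraction defining ζ is thus used only when its denominator is nonzero. -/
lemma denom_ne_zero (hlam : 0 < lam) (hgen : ¬ (al = mu ∧ be = lam)) {x : ℝ} (h0 : x ≠ 0)
    (hz : x ≠ zeta lam mu al be) : denom lam mu al be x ≠ 0 := by
  unfold denom
  refine mul_ne_zero (by positivity) fun h => ?_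
  by_cases h1 : al = mu
  · have h2 : be ≠ lam := fun h2 => hgen ⟨h1, h2⟩
    rw [h1] at h
    have h3 : mu * (lam - be) ^ 2 = 0 := by linear_combination h
    exact h2 (by nlinarith [pow_eq_zero_iff (two_ne_zero) |>.1 ((mul_eq_zero.1 h3).resolve_left hmu.ne')])
  by_cases h2 : be = lam
  · rw [h2] at h
    have h3 : lam * (al - mu) ^ 2 = 0 := by linear_combination h
    exact h1 (by nlinarith [pow_eq_zero_iff (two_ne_zero) |>.1 ((mul_eq_zero.1 h3).resolve_left hlam.ne')])
  · apply hz
    rw [zeta, eq_div_iff (mul_ne_zero (sub_ne_zero.2 (Ne.symm h2)) (sub_ne_zero.2 h1))]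
    linear_combination -h

include hlam hal hbe

/-- Insert the boundary values of both square roots in the rational form. The term p is real and
drops out, and the product of the roots contributes the two mixed terms with s. Which terms survive
is decided later by the position of x. -/
lemma specDensity_eq (hgen : ¬ (al = mu ∧ be = lam)) {x : ℝ} (h0 : x ≠ 0)
    (hz : x ≠ zeta lam mu al be) (k l : Fin 2) : specDensity lam mu al be k l x =
      -(1 / (Real.pi * denom lam mu al be x)) *
        (rootMinus lam mu x * (qMat lam mu al be x k l +
          sideSign al be x * rootPlus al be x * sMat lam mu al be x k l) +
        rootMinus al be x * (rMat lam mu al be x k l +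
          sideSign lam mu x * rootPlus lam mu x * sMat lam mu al be x k l)) := by
  have hD := denom_ne_zero hmu hlam hgen h0 hz
  have hx : 0 ≤ (x : ℂ).im := by simp
  have hne : 1 - decayRoot al be x * decayRoot lam mu x ≠ 0 := fun h => by
    obtain ⟨-, -, -, -, -, -, -, -, -, -, h1⟩ := mem_criticalSet hlam hmu hal hbe
      (x := x) (by linear_combination -h)
    rcases h1 hgen with h2 | h2
    · exact h0 h2
    · exact hz h2
  rw [specDensity, transform_rational hmu (isDecayRoot_decayRoot hlam hmu hx).eq
    (isDecayRoot_decayRoot hal hbe hx).eq hne hD, boundary_root hlam hmu, boundary_root hal hbe,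
    Complex.div_ofReal_im]
  simp only [Complex.add_im, Complex.mul_im, Complex.sub_im, Complex.sub_re, Complex.mul_re,
    Complex.ofReal_re, Complex.ofReal_im, Complex.I_re, Complex.I_im]
  field_simp
  ring

/-- Here D vanishes identically, so the rational form is useless. Instead v = (λ/μ)w, and the
characteristic equation turns the denominator μ(1 - vw) into sw with s the square root of the
discriminant. -/
lemma specDensity_special (hgen : al = mu ∧ be = lam) {x : ℝ} (h0 : x ≠ edgeMinus lam mu)
    (h1 : x ≠ edgePlus lam mu) (k l : Fin 2) : specDensity lam mu al be k l x =
      (if x ∈ Set.Icc (edgeMinus lam mu) (edgePlus lam mu) then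
            (1 / (Real.pi * rootMinus lam mu x)) •
              !![1, (lam + mu - x) / (2 * mu); (lam + mu - x) / (2 * mu), lam / mu]
          else (0 : Matrix (Fin 2) (Fin 2) ℝ)) k l := by
  obtain ⟨rfl, rfl⟩ := hgen
  have hx : 0 ≤ (x : ℂ).im := by simp
  have hW := isDecayRoot_decayRoot hbe hal hx
  have hW0 := char_root_ne_zero hal hW.eq
  have hb := boundary_root hbe hal x
  have hv : decayRoot al be x = (be / al : ℝ) * decayRoot be al x := by
    have hac : (al : ℂ) ≠ 0 := by exact_mod_cast hal.ne'
    refine decayRoot_eq hal hbe ⟨?_, ?_, ?_⟩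
    · push_cast
      field_simp
      linear_combination be * hW.eq
    · rw [map_mul, Complex.normSq_ofReal]
      have := hW.normSq_le
      have e : al * (be / al * (be / al) * Complex.normSq (decayRoot be al x)) =
        be / al * (be * Complex.normSq (decayRoot be al x)) := by field_simp
      rw [e]
      calc be / al * (be * Complex.normSq (decayRoot be al x)) ≤ be / al * al := by gcongr
        _ = be := by field_simp
    · rw [Complex.im_ofReal_mul]
      exact mul_nonneg (by positivity) hW.im_nonneg
  have hΔ : (be + al - x) ^ 2 - 4 * be * al ≠ 0 := by
    rw [edge_factor hbe.le hal.le]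
    exact mul_ne_zero (sub_ne_zero.2 h0) (sub_ne_zero.2 h1)
  set W := decayRoot be al x with hWdef
  set s : ℂ := (be : ℂ) + al - x - 2 * be * W with hs
  have hac : (al : ℂ) ≠ 0 := by exact_mod_cast hal.ne'
  have hbc : (be : ℂ) ≠ 0 := by exact_mod_cast hbe.ne'
  have hs2 : s ^ 2 = (((be + al - x) ^ 2 - 4 * be * al : ℝ) : ℂ) := by
    push_cast
    rw [hs]
    linear_combination 4 * be * hW.eq
  have hs0 : s ≠ 0 := fun h => by
    rw [h, zero_pow two_ne_zero] at hs2
    exact hΔ (by exact_mod_cast hs2.symm)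
  have hsW : (al : ℂ) * (1 - decayRoot al be x * W) = s * W := by
    rw [hv, hs]
    push_cast
    field_simp
    linear_combination hW.eq
  -- Each entry is a real multiple of 1/s plus a real constant, so only 1/s contributes to the
  -- imaginary part, and only where s is imaginary.
  have hmat : (!![W, decayRoot al be x * W; decayRoot al be x * W, decayRoot al be x] :
      Matrix (Fin 2) (Fin 2) ℂ) k l / (al * (1 - decayRoot al be x * W)) =
      ((!![1, (be + al - x) / (2 * al); (be + al - x) / (2 * al), be / al] :
        Matrix (Fin 2) (Fin 2) ℝ) k l : ℝ) / s + ((!![0, -1 / (2 * al); -1 / (2 * al), 0] :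
        Matrix (Fin 2) (Fin 2) ℝ) k l : ℝ) := by
    rw [hsW, hv]
    fin_cases k <;> fin_cases l <;>
    simp only [Fin.zero_eta, Fin.mk_one, Matrix.of_apply, Matrix.cons_val', Matrix.cons_val_zero,
      Matrix.cons_val_one, Matrix.cons_val_fin_one] <;> push_cast <;> field_simp
    · ring
    · rw [hs]; ring
    · rw [hs]; ring
    · ring
  rw [specDensity, ← hWdef, hmat, Complex.add_im, Complex.ofReal_im, add_zero]
  split_ifs with h
  · have hr : 0 < rootMinus be al x := by
      rw [rootMinus]
      apply Real.sqrt_pos.2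
      have := rootPlus_eq_zero hbe hal h.1 h.2
      rw [rootPlus, Real.sqrt_eq_zero'] at this
      have := lt_of_le_of_ne this hΔ
      linarith
    have hsI : s = -(rootMinus be al x : ℝ) * Complex.I := by
      rw [hb, rootPlus_eq_zero hbe hal h.1 h.2]; simp
    have e : ∀ c : ℝ, ((c : ℂ) / s) = (c / rootMinus be al x : ℝ) * Complex.I := fun c => by
      have hrc : (rootMinus be al x : ℂ) ≠ 0 := by exact_mod_cast hr.ne'
      rw [hsI]
      push_cast
      rw [div_eq_iff (mul_ne_zero (neg_ne_zero.2 hrc) Complex.I_ne_zero)]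
      field_simp
      linear_combination (c : ℂ) * Complex.I_sq
    rw [e, Complex.im_ofReal_mul, Complex.I_im, Matrix.smul_apply, smul_eq_mul]
    field_simp
  · have hr : rootMinus be al x = 0 := by
      rw [Set.mem_Icc, not_and_or, not_le, not_le] at h
      rcases h with h | h
      · exact (rootMinus_of_le hbe hal h.le).1
      · exact (rootMinus_of_ge hbe hal h.le).1
    rw [hb, hr, Complex.ofReal_zero, zero_mul, sub_zero, ← Complex.ofReal_div, Complex.ofReal_im,
      zero_div]
    rfl

/-- On the complement of a finite set the density is given by the three regimes. -/
lemma specDensity_cases (hgen : ¬ (al = mu ∧ be = lam)) {x : ℝ} (h0 : x ≠ 0)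
    (hz : x ≠ zeta lam mu al be) (k l : Fin 2) :
    (∀ ε, rootMinus al be x = 0 ∧ sideSign al be x = ε →
      sigmaDensity lam mu al be ε x k l = specDensity lam mu al be k l x) ∧
    (∀ ε, rootMinus lam mu x = 0 ∧ sideSign lam mu x = ε →
      tauDensity lam mu al be ε x k l = specDensity lam mu al be k l x) ∧
    (rootPlus lam mu x = 0 → rootPlus al be x = 0 →
      bothDensity lam mu al be x k l = specDensity lam mu al be k l x) ∧
    (rootMinus lam mu x = 0 → rootMinus al be x = 0 →
      (0 : Matrix (Fin 2) (Fin 2) ℝ) k l = specDensity lam mu al be k l x) := by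
  rw [specDensity_eq hlam hmu hal hbe hgen h0 hz]
  simp only [sigmaDensity, tauDensity, bothDensity, Matrix.smul_apply, Matrix.add_apply,
    smul_eq_mul, Matrix.zero_apply]
  refine ⟨?_, ?_, ?_, ?_⟩
  · rintro ε ⟨h1, h2⟩
    rw [h1, h2]; ring
  · rintro ε ⟨h1, h2⟩
    rw [h1, h2]; ring
  · intro h1 h2
    rw [h1, h2]; ring
  · intro h1 h2
    rw [h1, h2]; ring

end Density


/-! ### The spectral matrix in the different regimes -/

section Regimes

variable {lam mu al be : ℝ} (hlam : 0 < lam) (hmu : 0 < mu) (hal : 0 < al) (hbe : 0 < be)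

lemma rootMinus_of_notMem {p q x : ℝ} (hp : 0 < p) (hq : 0 < q)
    (h : x ∉ Set.Icc (edgeMinus p q) (edgePlus p q)) : rootMinus p q x = 0 := by
  rw [Set.mem_Icc, not_and_or, not_le, not_le] at h
  rcases h with h | h
  · exact (rootMinus_of_le hp hq h.le).1
  · exact (rootMinus_of_ge hp hq h.le).1

include hlam hmu hal hbe

/-- The two excluded points are null; each regime below then reduces to reading off which square
roots vanish and with which sign. -/
theorem hasSpectralMatrix_generic {Q : Fin 2 → ℤ → ℝ[X]}
    (hQ : IsGeneratedFamily (birth lam be) (death mu al) Q) {w : ℝ → Matrix (Fin 2) (Fin 2) ℝ}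
    (hw : ∀ x, x ≠ 0 → x ≠ zeta lam mu al be → ∀ k l, w x k l = specDensity lam mu al be k l x) :
    HasSpectralMatrix lam mu al be Q w := by
  refine hasSpectralMatrix_of_ae hlam hmu hal hbe hQ ?_
  have h1 : ∀ c : ℝ, ∀ᵐ x : ℝ, x ≠ c := fun c => by simp [ae_iff]
  filter_upwards [h1 0, h1 (zeta lam mu al be)] with x h0 hz
  exact hw x h0 hz

variable {Q : Fin 2 → ℤ → ℝ[X]} (hQ : IsGeneratedFamily (birth lam be) (death mu al) Q)
include hQ

theorem hasSpectralMatrix_special (hs : al = mu ∧ be = lam) :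
    HasSpectralMatrix lam mu al be Q fun x =>
      if x ∈ Set.Icc (edgeMinus lam mu) (edgePlus lam mu) then
        (1 / (Real.pi * rootMinus lam mu x)) •
          !![1, (lam + mu - x) / (2 * mu); (lam + mu - x) / (2 * mu), lam / mu]
      else 0 := by
  refine hasSpectralMatrix_of_ae hlam hmu hal hbe hQ ?_
  have h1 : ∀ c : ℝ, ∀ᵐ x : ℝ, x ≠ c := fun c => by simp [ae_iff]
  filter_upwards [h1 (edgeMinus lam mu), h1 (edgePlus lam mu)] with x h0 hz k l
  exact (specDensity_special hlam hmu hal hbe hs h0 hz k l).symm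

variable (hgen : ¬ (al = mu ∧ be = lam))
include hgen

theorem hasSpectralMatrix_disjoint_left
    (h : Set.Icc (edgeMinus lam mu) (edgePlus lam mu) ∩
      Set.Icc (edgeMinus al be) (edgePlus al be) = ∅ ∧ edgeMinus lam mu < edgeMinus al be) :
    HasSpectralMatrix lam mu al be Q fun x =>
      if x ∈ Set.Icc (edgeMinus lam mu) (edgePlus lam mu) then sigmaDensity lam mu al be 1 x
      else if x ∈ Set.Icc (edgeMinus al be) (edgePlus al be) then tauDensity lam mu al be (-1) x
      else 0 := by
  refine hasSpectralMatrix_generic hlam hmu hal hbe hQ fun x h0 hz k l => ?_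
  obtain ⟨hS, hT, -, hZ⟩ := specDensity_cases hlam hmu hal hbe hgen h0 hz k l
  have ht := edge_lt hal hbe
  have hlt : edgePlus lam mu < edgeMinus al be := by
    by_contra! hle
    have : edgeMinus al be ∈ Set.Icc (edgeMinus lam mu) (edgePlus lam mu) ∩
      Set.Icc (edgeMinus al be) (edgePlus al be) := ⟨⟨h.2.le, hle⟩, ⟨le_rfl, by linarith⟩⟩
    rw [h.1] at this
    exact this
  split_ifs with h1 h2
  · exact hS 1 (rootMinus_of_le hal hbe (by linarith [h1.2]))
  · exact hT (-1) (rootMinus_of_ge hlam hmu (by linarith [h2.1]))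
  · exact hZ (rootMinus_of_notMem hlam hmu h1) (rootMinus_of_notMem hal hbe h2)

theorem hasSpectralMatrix_disjoint_right
    (h : Set.Icc (edgeMinus lam mu) (edgePlus lam mu) ∩
      Set.Icc (edgeMinus al be) (edgePlus al be) = ∅ ∧ edgeMinus al be < edgeMinus lam mu) :
    HasSpectralMatrix lam mu al be Q fun x =>
      if x ∈ Set.Icc (edgeMinus al be) (edgePlus al be) then tauDensity lam mu al be 1 x
      else if x ∈ Set.Icc (edgeMinus lam mu) (edgePlus lam mu) then
        sigmaDensity lam mu al be (-1) x
      else 0 := by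
  refine hasSpectralMatrix_generic hlam hmu hal hbe hQ fun x h0 hz k l => ?_
  obtain ⟨hS, hT, -, hZ⟩ := specDensity_cases hlam hmu hal hbe hgen h0 hz k l
  have hs := edge_lt hlam hmu
  have hlt : edgePlus al be < edgeMinus lam mu := by
    by_contra! hle
    have : edgeMinus lam mu ∈ Set.Icc (edgeMinus lam mu) (edgePlus lam mu) ∩
      Set.Icc (edgeMinus al be) (edgePlus al be) := ⟨⟨le_rfl, by linarith⟩, ⟨h.2.le, hle⟩⟩
    rw [h.1] at this
    exact this
  split_ifs with h1 h2
  · exact hT 1 (rootMinus_of_le hlam hmu (by linarith [h1.2]))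
  · exact hS (-1) (rootMinus_of_ge hal hbe (by linarith [h2.1]))
  · exact hZ (rootMinus_of_notMem hlam hmu h2) (rootMinus_of_notMem hal hbe h1)

theorem hasSpectralMatrix_nested_left
    (h : Set.Icc (edgeMinus al be) (edgePlus al be) ⊆
      Set.Icc (edgeMinus lam mu) (edgePlus lam mu)) :
    HasSpectralMatrix lam mu al be Q fun x =>
      if x ∈ Set.Icc (edgeMinus lam mu) (edgeMinus al be) then sigmaDensity lam mu al be 1 x
      else if x ∈ Set.Icc (edgeMinus al be) (edgePlus al be) then bothDensity lam mu al be x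
      else if x ∈ Set.Icc (edgePlus al be) (edgePlus lam mu) then
        sigmaDensity lam mu al be (-1) x
      else 0 := by
  refine hasSpectralMatrix_generic hlam hmu hal hbe hQ fun x h0 hz k l => ?_
  obtain ⟨hS, -, hB, hZ⟩ := specDensity_cases hlam hmu hal hbe hgen h0 hz k l
  split_ifs with h1 h2 h3
  · exact hS 1 (rootMinus_of_le hal hbe h1.2)
  · have h4 := h h2
    exact hB (rootPlus_eq_zero hlam hmu h4.1 h4.2) (rootPlus_eq_zero hal hbe h2.1 h2.2)
  · exact hS (-1) (rootMinus_of_ge hal hbe h3.1)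
  · refine hZ (rootMinus_of_notMem hlam hmu fun h4 => ?_) (rootMinus_of_notMem hal hbe h2)
    rcases le_total x (edgeMinus al be) with h5 | h5
    · exact h1 ⟨h4.1, h5⟩
    · rcases le_total x (edgePlus al be) with h6 | h6
      · exact h2 ⟨h5, h6⟩
      · exact h3 ⟨h6, h4.2⟩

theorem hasSpectralMatrix_nested_right
    (h : Set.Icc (edgeMinus lam mu) (edgePlus lam mu) ⊆
      Set.Icc (edgeMinus al be) (edgePlus al be)) :
    HasSpectralMatrix lam mu al be Q fun x =>
      if x ∈ Set.Icc (edgeMinus al be) (edgeMinus lam mu) then tauDensity lam mu al be 1 x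
      else if x ∈ Set.Icc (edgeMinus lam mu) (edgePlus lam mu) then bothDensity lam mu al be x
      else if x ∈ Set.Icc (edgePlus lam mu) (edgePlus al be) then tauDensity lam mu al be (-1) x
      else 0 := by
  refine hasSpectralMatrix_generic hlam hmu hal hbe hQ fun x h0 hz k l => ?_
  obtain ⟨-, hT, hB, hZ⟩ := specDensity_cases hlam hmu hal hbe hgen h0 hz k l
  split_ifs with h1 h2 h3
  · exact hT 1 (rootMinus_of_le hlam hmu h1.2)
  · have h4 := h h2
    exact hB (rootPlus_eq_zero hlam hmu h2.1 h2.2) (rootPlus_eq_zero hal hbe h4.1 h4.2)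
  · exact hT (-1) (rootMinus_of_ge hlam hmu h3.1)
  · refine hZ (rootMinus_of_notMem hlam hmu h2) (rootMinus_of_notMem hal hbe fun h4 => ?_)
    rcases le_total x (edgeMinus lam mu) with h5 | h5
    · exact h1 ⟨h4.1, h5⟩
    · rcases le_total x (edgePlus lam mu) with h6 | h6
      · exact h2 ⟨h5, h6⟩
      · exact h3 ⟨h6, h4.2⟩

theorem hasSpectralMatrix_overlap_left
    (h : edgeMinus lam mu < edgeMinus al be ∧ edgeMinus al be ≤ edgePlus lam mu ∧
      edgePlus lam mu < edgePlus al be) :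
    HasSpectralMatrix lam mu al be Q fun x =>
      if x ∈ Set.Icc (edgeMinus lam mu) (edgeMinus al be) then sigmaDensity lam mu al be 1 x
      else if x ∈ Set.Icc (edgeMinus al be) (edgePlus lam mu) then bothDensity lam mu al be x
      else if x ∈ Set.Icc (edgePlus lam mu) (edgePlus al be) then tauDensity lam mu al be (-1) x
      else 0 := by
  refine hasSpectralMatrix_generic hlam hmu hal hbe hQ fun x h0 hz k l => ?_
  obtain ⟨hS, hT, hB, hZ⟩ := specDensity_cases hlam hmu hal hbe hgen h0 hz k l
  split_ifs with h1 h2 h3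
  · exact hS 1 (rootMinus_of_le hal hbe h1.2)
  · exact hB (rootPlus_eq_zero hlam hmu (by linarith [h2.1]) h2.2)
      (rootPlus_eq_zero hal hbe h2.1 (by linarith [h2.2]))
  · exact hT (-1) (rootMinus_of_ge hlam hmu h3.1)
  · refine hZ (rootMinus_of_notMem hlam hmu fun h4 => ?_) (rootMinus_of_notMem hal hbe fun h4 => ?_)
    · rcases le_total x (edgeMinus al be) with h5 | h5
      · exact h1 ⟨h4.1, h5⟩
      · exact h2 ⟨h5, h4.2⟩
    · rcases le_total x (edgePlus lam mu) with h5 | h5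
      · exact h2 ⟨h4.1, h5⟩
      · exact h3 ⟨h5, h4.2⟩

theorem hasSpectralMatrix_overlap_right
    (h : edgeMinus al be < edgeMinus lam mu ∧ edgeMinus lam mu ≤ edgePlus al be ∧
      edgePlus al be < edgePlus lam mu) :
    HasSpectralMatrix lam mu al be Q fun x =>
      if x ∈ Set.Icc (edgeMinus al be) (edgeMinus lam mu) then tauDensity lam mu al be 1 x
      else if x ∈ Set.Icc (edgeMinus lam mu) (edgePlus al be) then bothDensity lam mu al be x
      else if x ∈ Set.Icc (edgePlus al be) (edgePlus lam mu) then
        sigmaDensity lam mu al be (-1) x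
      else 0 := by
  refine hasSpectralMatrix_generic hlam hmu hal hbe hQ fun x h0 hz k l => ?_
  obtain ⟨hS, hT, hB, hZ⟩ := specDensity_cases hlam hmu hal hbe hgen h0 hz k l
  split_ifs with h1 h2 h3
  · exact hT 1 (rootMinus_of_le hlam hmu h1.2)
  · exact hB (rootPlus_eq_zero hlam hmu h2.1 (by linarith [h2.2]))
      (rootPlus_eq_zero hal hbe (by linarith [h2.1]) h2.2)
  · exact hS (-1) (rootMinus_of_ge hal hbe h3.1)
  · refine hZ (rootMinus_of_notMem hlam hmu fun h4 => ?_) (rootMinus_of_notMem hal hbe fun h4 => ?_)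
    · rcases le_total x (edgePlus al be) with h5 | h5
      · exact h2 ⟨h4.1, h5⟩
      · exact h3 ⟨h5, h4.2⟩
    · rcases le_total x (edgeMinus lam mu) with h5 | h5
      · exact h1 ⟨h4.1, h5⟩
      · exact h2 ⟨h5, h4.2⟩

end Regimes

/-! ### Stieltjes transforms on the negative axis and moments of order `-1` -/

/-- Monotone convergence along z = -1/(n+1). Working with extended nonnegative division covers the
case d 0 = 0, where the integral is infinite. -/
lemma lintegral_inv_eq {ρ : Measure ℝ} [IsFiniteMeasure ρ] (hρ : ρ (Set.Iio 0) = 0) {c : ℝ}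
    {d : ℝ → ℝ} (hd : Continuous d) (hpos : ∀ z < 0, 0 < d z)
    (hF : ∀ z < 0, ∫ x, 1 / (x - z) ∂ρ = c / d z) :
    ∫⁻ x, (ENNReal.ofReal x)⁻¹ ∂ρ = ENNReal.ofReal c / ENNReal.ofReal (d 0) := by
  have hae : ∀ᵐ x ∂ρ, 0 ≤ x := by
    rw [ae_iff]
    simp only [not_le]
    exact hρ
  set ε : ℕ → ℝ := fun n => 1 / ((n : ℝ) + 1) with hε
  have hε0 : ∀ n, 0 < ε n := fun n => by positivity
  have hεt : Tendsto ε atTop (𝓝 0) := tendsto_one_div_add_atTop_nhds_zero_nat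
  have hεa : Antitone ε := fun m n hmn => by
    simp only [hε]
    gcongr
  have h1 : Tendsto (fun n => ∫⁻ x, ENNReal.ofReal (1 / (x - (-ε n))) ∂ρ) atTop
      (𝓝 (∫⁻ x, (ENNReal.ofReal x)⁻¹ ∂ρ)) := by
    refine lintegral_tendsto_of_tendsto_of_monotone
      (fun n => (by fun_prop : Measurable fun x : ℝ => ENNReal.ofReal (1 / (x - (-ε n)))).aemeasurable)
      ?_ ?_
    · filter_upwards [hae] with x hx m n hmn
      have := hεa hmn
      have := hε0 n
      apply ENNReal.ofReal_le_ofReal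
      apply one_div_le_one_div_of_le <;> linarith
    · filter_upwards [hae] with x hx
      have e : ∀ n, ENNReal.ofReal (1 / (x - (-ε n))) = (ENNReal.ofReal (x + ε n))⁻¹ := fun n => by
        rw [sub_neg_eq_add, one_div, ENNReal.ofReal_inv_of_pos (by linarith [hε0 n])]
      simp only [e]
      refine tendsto_inv_iff.2 (ENNReal.tendsto_ofReal ?_)
      simpa using hεt.const_add x
  have h2 : ∀ n, ∫⁻ x, ENNReal.ofReal (1 / (x - (-ε n))) ∂ρ =
      ENNReal.ofReal c / ENNReal.ofReal (d (-ε n)) := fun n => by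
    have hz : -ε n < 0 := neg_neg_of_pos (hε0 n)
    have hi : Integrable (fun x => 1 / (x - (-ε n))) ρ := by
      refine Integrable.of_bound (C := 1 / ε n)
        (by fun_prop : Measurable fun x : ℝ => 1 / (x - (-ε n))).aestronglyMeasurable ?_
      filter_upwards [hae] with x hx
      have := hε0 n
      rw [Real.norm_of_nonneg (by rw [sub_neg_eq_add]; positivity)]
      apply one_div_le_one_div_of_le <;> linarith
    rw [← ofReal_integral_eq_lintegral_ofReal hi, hF _ hz, ENNReal.ofReal_div_of_pos (hpos _ hz)]
    filter_upwards [hae] with x hx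
    have := hε0 n
    rw [sub_neg_eq_add]
    positivity
  simp only [h2] at h1
  have hdt : Tendsto (fun n => d (-ε n)) atTop (𝓝 (d 0)) := by
    refine (hd.tendsto 0).comp ?_
    simpa using hεt.neg
  refine tendsto_nhds_unique h1 (ENNReal.Tendsto.const_div (ENNReal.tendsto_ofReal hdt) (Or.inr ENNReal.ofReal_ne_top))

lemma rootPlus_zero (p q : ℝ) : rootPlus p q 0 = |p - q| := by
  rw [rootPlus, ← Real.sqrt_sq_eq_abs]
  congr 1
  ring

lemma continuous_rootPlus (p q : ℝ) : Continuous (rootPlus p q) := by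
  unfold rootPlus
  fun_prop

section Stieltjes

variable {lam mu al be : ℝ} (hlam : 0 < lam) (hmu : 0 < mu) (hal : 0 < al) (hbe : 0 < be)
include hlam hmu hal hbe

/-- The resolvent computation also applies at negative real z, and polarisation separates the
entries. -/
lemma stieltjes_specMat {z w v : ℝ} (hz : z < 0)
    (hwe : lam * w ^ 2 - (lam + mu - z) * w + mu = 0)
    (hve : al * v ^ 2 - (al + be - z) * v + be = 0) (hw0 : 0 < w) (hw1 : w < 1)
    (hv1 : v < 1) (hw : lam * w ^ 2 < mu) (hv : al * v ^ 2 < be) (k l : Fin 2) :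
    ((boundedRates hlam hmu hal hbe).jacobiModel.specMat k l).Integrable (fun x => 1 / (x - z)) ∧
    ∫ᵛ x, 1 / (x - z) ∂•((boundedRates hlam hmu hal hbe).jacobiModel.specMat k l) =
      (!![w, v * w; v * w, v] : Matrix (Fin 2) (Fin 2) ℝ) k l / (mu * (1 - v * w)) := by
  set hJ := (boundedRates hlam hmu hal hbe).jacobiModel
  have hφ : ContinuousOn (fun x : ℝ => 1 / (x - z))
      (spectrum ℝ (boundedRates hlam hmu hal hbe).jacobi) := by
    refine continuousOn_const.div (by fun_prop) fun x hx => ?_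
    have := hJ.spectrum_nonneg x hx
    linarith
  have hi := fun k l => hJ.integrable_specMat k l hφ
  refine ⟨hi k l, ?_⟩
  have hvw : v * w < 1 := by nlinarith
  have key : ∀ x y : ℝ, x ^ 2 * (∫ᵛ x, 1 / (x - z) ∂•(hJ.specMat 0 0)) +
      2 * x * y * (∫ᵛ x, 1 / (x - z) ∂•(hJ.specMat 0 1)) +
      y ^ 2 * (∫ᵛ x, 1 / (x - z) ∂•(hJ.specMat 1 1)) =
      (x ^ 2 * w + 2 * x * y * (v * w) + y ^ 2 * v) / (mu * (1 - v * w)) := by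
    intro x y
    have h1 := congrArg (fun s : SignedMeasure ℝ => ∫ᵛ x, 1 / (x - z) ∂•s) (hJ.specMat_quadratic x y)
    beta_reduce at h1
    rw [VectorMeasure.integral_add_vectorMeasure
        (((hi _ _).smul_vectorMeasure _).add_vectorMeasure ((hi _ _).smul_vectorMeasure _))
        ((hi _ _).smul_vectorMeasure _),
      VectorMeasure.integral_add_vectorMeasure ((hi _ _).smul_vectorMeasure _)
        ((hi _ _).smul_vectorMeasure _),
      VectorMeasure.integral_smul_vectorMeasure, VectorMeasure.integral_smul_vectorMeasure,
      VectorMeasure.integral_smul_vectorMeasure, vectorIntegral_toSignedMeasure] at h1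
    simp only [smul_eq_mul] at h1
    rw [h1]
    have h2 := stieltjes_quadratic hlam hmu hal hbe x y (z := z) (w := w) (v := v)
      (by exact_mod_cast hwe) (by exact_mod_cast hve)
      (by rw [Complex.normSq_ofReal, ← sq]; exact hw)
      (by rw [Complex.normSq_ofReal, ← sq]; exact hv)
      (by exact_mod_cast (sub_pos.2 hvw).ne') (fun t ht h => by
        have : t = z := by exact_mod_cast h
        linarith)
    have h3 : ∀ t : ℝ, ((t : ℂ) - z)⁻¹ = ((1 / (t - z) : ℝ) : ℂ) := fun t => by push_cast; ring
    simp only [h3] at h2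
    rw [integral_complex_ofReal] at h2
    exact_mod_cast h2
  have h10 := key 1 0
  have h01 := key 0 1
  have h11 := key 1 1
  have e00 : ∫ᵛ x, 1 / (x - z) ∂•(hJ.specMat 0 0) = w / (mu * (1 - v * w)) := by
    simpa using h10
  have e11 : ∫ᵛ x, 1 / (x - z) ∂•(hJ.specMat 1 1) = v / (mu * (1 - v * w)) := by
    simpa using h01
  have e01 : ∫ᵛ x, 1 / (x - z) ∂•(hJ.specMat 0 1) = v * w / (mu * (1 - v * w)) := by
    rw [e00, e11] at h11
    linear_combination h11 / 2
  fin_cases k <;> fin_cases l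
  · exact e00
  · exact e01
  · change ∫ᵛ x, 1 / (x - z) ∂•(hJ.specMat 1 0) = v * w / (mu * (1 - v * w))
    rw [hJ.specMat_symm 1 0]
    exact e01
  · exact e11

/-- The two denominators equal 2αμ(1 - vw)/w and 2λβ(1 - vw)/v by the characteristic equations. This
gives the closed forms, and positivity as well, which the limit z → 0 requires. -/
theorem stieltjes_formulas {z : ℝ} (hz : z < 0) :
    (∀ k l, ((boundedRates hlam hmu hal hbe).jacobiModel.specMat k l).Integrable
      fun x => 1 / (x - z)) ∧
    ∫ᵛ x, 1 / (x - z) ∂•((boundedRates hlam hmu hal hbe).jacobiModel.specMat 0 0) =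
      2 * al / (al * rootPlus lam mu z + mu * rootPlus al be z + (mu - al) * z
        + al * lam - be * mu) ∧
    ∫ᵛ x, 1 / (x - z) ∂•((boundedRates hlam hmu hal hbe).jacobiModel.specMat 0 1) =
      be / mu * ((lam + mu - z - rootPlus lam mu z) /
        (be * rootPlus lam mu z + lam * rootPlus al be z + (be - lam) * z
          + al * lam - be * mu)) ∧
    ∫ᵛ x, 1 / (x - z) ∂•((boundedRates hlam hmu hal hbe).jacobiModel.specMat 1 1) =
      be / mu * (2 * lam /
        (be * rootPlus lam mu z + lam * rootPlus al be z + (be - lam) * z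
          + al * lam - be * mu)) ∧
    (denom lam mu al be z ≠ 0 → ∀ k l,
      ∫ᵛ x, 1 / (x - z) ∂•((boundedRates hlam hmu hal hbe).jacobiModel.specMat k l) =
        (pMat lam mu al be z k l + qMat lam mu al be z k l * rootPlus lam mu z
          + rMat lam mu al be z k l * rootPlus al be z
          + sMat lam mu al be z k l * (rootPlus lam mu z * rootPlus al be z)) /
        denom lam mu al be z) ∧
    0 < al * rootPlus lam mu z + mu * rootPlus al be z + (mu - al) * z + al * lam - be * mu ∧
    0 < be * rootPlus lam mu z + lam * rootPlus al be z + (be - lam) * z + al * lam - be * mu := by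
  obtain ⟨hwe, hw0, hw1, hw⟩ := real_root hlam hmu hz
  obtain ⟨hve, hv0, hv1, hv⟩ := real_root hal hbe hz
  have hs : rootPlus lam mu z =
      lam + mu - z - 2 * lam * ((lam + mu - z - rootPlus lam mu z) / (2 * lam)) := by
    field_simp; ring
  have ht : rootPlus al be z =
      al + be - z - 2 * al * ((al + be - z - rootPlus al be z) / (2 * al)) := by
    field_simp; ring
  set w := (lam + mu - z - rootPlus lam mu z) / (2 * lam)
  set v := (al + be - z - rootPlus al be z) / (2 * al)
  have hst := stieltjes_specMat hlam hmu hal hbe hz hwe hve hw0 hw1 hv1 hw hv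
  have hvw : 0 < 1 - v * w := by nlinarith
  have d1 : al * rootPlus lam mu z + mu * rootPlus al be z + (mu - al) * z + al * lam - be * mu =
      2 * al * (mu * (1 - v * w)) / w := by
    rw [hs, ht, eq_div_iff hw0.ne']
    linear_combination (-2 * al) * hwe
  have d2 : be * rootPlus lam mu z + lam * rootPlus al be z + (be - lam) * z + al * lam - be * mu =
      2 * lam * be * (1 - v * w) / v := by
    rw [hs, ht, eq_div_iff hv0.ne']
    linear_combination (-2 * lam) * hve
  refine ⟨fun k l => (hst k l).1, ?_, ?_, ?_, fun hD k l => ?_, ?_, ?_⟩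
  · rw [(hst 0 0).2, d1]
    change w / (mu * (1 - v * w)) = _
    field_simp
  · rw [(hst 0 1).2, d2, hs]
    change v * w / (mu * (1 - v * w)) = _
    field_simp
    ring
  · rw [(hst 1 1).2, d2]
    change v / (mu * (1 - v * w)) = _
    field_simp
  · have h := transform_rational (x := z) (w := w) (v := v) hmu (by exact_mod_cast hwe)
      (by exact_mod_cast hve) (by exact_mod_cast hvw.ne') hD k l
    rw [(hst k l).2, hs, ht]
    have e : (!![(w : ℂ), v * w; v * w, v] : Matrix (Fin 2) (Fin 2) ℂ) k l =
        ((!![w, v * w; v * w, v] : Matrix (Fin 2) (Fin 2) ℝ) k l : ℝ) := by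
      fin_cases k <;> fin_cases l <;> simp
    rw [e] at h
    exact_mod_cast h
  · rw [d1]; positivity
  · rw [d2]; positivity

theorem moments_specMat :
    ∫⁻ x, (ENNReal.ofReal x)⁻¹
      ∂((boundedRates hlam hmu hal hbe).jacobiModel.specMat 0 0).variation =
      ENNReal.ofReal (2 * al) / ENNReal.ofReal (al * |lam - mu| + mu * |al - be| + al * lam - be * mu) ∧
    ∫⁻ x, (ENNReal.ofReal x)⁻¹
      ∂((boundedRates hlam hmu hal hbe).jacobiModel.specMat 1 1).variation =
      ENNReal.ofReal (be / mu * (2 * lam)) /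
        ENNReal.ofReal (be * |lam - mu| + lam * |al - be| + al * lam - be * mu) := by
  set hJ := (boundedRates hlam hmu hal hbe).jacobiModel
  have hst := fun z hz => stieltjes_formulas hlam hmu hal hbe (z := z) hz
  have c1 := continuous_rootPlus lam mu
  have c2 := continuous_rootPlus al be
  constructor
  · rw [hJ.specMat_zero, Measure.variation_toSignedMeasure, lintegral_inv_eq
      (hJ.spectralMeasure_Iio _ le_rfl) (c := 2 * al)
      (d := fun z => al * rootPlus lam mu z + mu * rootPlus al be z + (mu - al) * z
        + al * lam - be * mu) (by fun_prop)
      (fun z hz => (hst z hz).2.2.2.2.2.1) fun z hz => ?_]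
    · simp only [rootPlus_zero, mul_zero, add_zero]
    · rw [← (hst z hz).2.1, hJ.specMat_zero, vectorIntegral_toSignedMeasure]
  · rw [hJ.specMat_one, Measure.variation_toSignedMeasure, lintegral_inv_eq
      (hJ.spectralMeasure_Iio _ le_rfl) (c := be / mu * (2 * lam))
      (d := fun z => be * rootPlus lam mu z + lam * rootPlus al be z + (be - lam) * z
        + al * lam - be * mu) (by fun_prop)
      (fun z hz => (hst z hz).2.2.2.2.2.2) fun z hz => ?_]
    · simp only [rootPlus_zero, mul_zero, add_zero]
    · rw [mul_div_assoc, ← (hst z hz).2.2.2.1, hJ.specMat_one, vectorIntegral_toSignedMeasure]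

theorem moments_lt_top (h : mu < lam ∨ be < al) :
    ∫⁻ x, (ENNReal.ofReal x)⁻¹
      ∂((boundedRates hlam hmu hal hbe).jacobiModel.specMat 0 0).variation < ⊤ ∧
    ∫⁻ x, (ENNReal.ofReal x)⁻¹
      ∂((boundedRates hlam hmu hal hbe).jacobiModel.specMat 1 1).variation < ⊤ := by
  obtain ⟨h1, h2⟩ := moments_specMat hlam hmu hal hbe
  -- Both denominators at z = 0 have this shape, with (a, b) = (α, μ) and (β, λ), because α(λ-μ) +
  -- μ(α-β) = β(λ-μ) + λ(α-β) = αλ - βμ.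
  have key : ∀ a b : ℝ, 0 < a → 0 < b →
      0 < a * |lam - mu| + b * |al - be| + (a * (lam - mu) + b * (al - be)) := by
    intro a b ha hb
    have e1 : 0 ≤ |lam - mu| + (lam - mu) := by linarith [neg_abs_le (lam - mu)]
    have e2 : 0 ≤ |al - be| + (al - be) := by linarith [neg_abs_le (al - be)]
    rcases h with h | h
    · have : 0 < |lam - mu| + (lam - mu) := by linarith [abs_nonneg (lam - mu)]
      nlinarith [mul_pos ha this, mul_nonneg hb.le e2]
    · have : 0 < |al - be| + (al - be) := by linarith [abs_nonneg (al - be)]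
      nlinarith [mul_pos hb this, mul_nonneg ha.le e1]
  rw [h1, h2]
  constructor
  · refine ENNReal.div_lt_top ENNReal.ofReal_ne_top (ENNReal.ofReal_pos.2 ?_).ne'
    have := key al mu hal hmu
    linarith
  · refine ENNReal.div_lt_top ENNReal.ofReal_ne_top (ENNReal.ofReal_pos.2 ?_).ne'
    have := key be lam hbe hlam
    linarith

theorem moments_eq_top (h : lam ≤ mu ∧ al ≤ be) :
    ∫⁻ x, (ENNReal.ofReal x)⁻¹
      ∂((boundedRates hlam hmu hal hbe).jacobiModel.specMat 0 0).variation = ⊤ ∧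
    ∫⁻ x, (ENNReal.ofReal x)⁻¹
      ∂((boundedRates hlam hmu hal hbe).jacobiModel.specMat 1 1).variation = ⊤ := by
  obtain ⟨h1, h2⟩ := moments_specMat hlam hmu hal hbe
  rw [h1, h2, abs_of_nonpos (by linarith), abs_of_nonpos (by linarith)]
  constructor
  · have e : al * -(lam - mu) + mu * -(al - be) + al * lam - be * mu = 0 := by ring
    rw [e, ENNReal.ofReal_zero, ENNReal.div_zero (ENNReal.ofReal_pos.2 (by positivity)).ne']
  · have e : be * -(lam - mu) + lam * -(al - be) + al * lam - be * mu = 0 := by ring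
    rw [e, ENNReal.ofReal_zero, ENNReal.div_zero (ENNReal.ofReal_pos.2 (by positivity)).ne']

end Stieltjes


/-! ### The polynomials -/

/-- The solution of `p R_{n+2} = (p + q - x) R_{n+1} - q R_n` with `R_0 = 0` and `R_1 = 1`. -/
def halfPoly (p q : ℝ) : ℕ → ℝ[X]
  | 0 => 0
  | 1 => 1
  | n + 2 => C p⁻¹ * ((C (p + q) - X) * halfPoly p q (n + 1) - C q * halfPoly p q n)

lemma halfPoly_rec {p : ℝ} (hp : 0 < p) (q : ℝ) (n : ℕ) : C p * halfPoly p q (n + 2) =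
    (C (p + q) - X) * halfPoly p q (n + 1) - C q * halfPoly p q n := by
  rw [halfPoly, ← mul_assoc, ← C_mul, mul_inv_cancel₀ hp.ne', C_1, one_mul]

/-- Every solution of the three-term recurrence is determined by two consecutive values. -/
lemma eq_halfPoly {p q : ℝ} (hp : 0 < p) {T : ℕ → ℝ[X]}
    (hT : ∀ n, C p * T (n + 2) = (C (p + q) - X) * T (n + 1) - C q * T n) (n : ℕ) :
    T (n + 1) = halfPoly p q (n + 1) * T 1 - C (q / p) * halfPoly p q n * T 0 := by
  have hC : C p ≠ 0 := C_ne_zero.2 hp.ne'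
  have hq : C p * C (q / p) = C q := by rw [← C_mul, mul_div_cancel₀ _ hp.ne']
  induction n using Nat.twoStepInduction with
  | zero => simp [halfPoly]
  | one =>
    apply mul_left_cancel₀ hC
    have h1 := hT 0
    have h2 := halfPoly_rec hp q 0
    simp only [halfPoly] at h1 h2 ⊢
    linear_combination h1 - h2 * T 1 + hq * T 0
  | more n ih1 ih2 =>
    apply mul_left_cancel₀ hC
    have h1 := hT (n + 1)
    have h2 := halfPoly_rec hp q (n + 1)
    have h3 := halfPoly_rec hp q n
    rw [ih1, ih2] at h1
    linear_combination h1 - h2 * T 1 + C (q / p) * h3 * T 0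

/-- Rescaling by powers of √(q/p) turns the recurrence into that of the Chebyshev polynomials. The
extra factor on the left avoids the exponent n - 1 at n = 0. -/
lemma eval_halfPoly {p q : ℝ} (hp : 0 < p) (hq : 0 < q) (n : ℕ) (x : ℝ) :
    √(q / p) * (halfPoly p q n).eval x =
      √(q / p) ^ n * (Chebyshev.U ℝ ((n : ℤ) - 1)).eval ((p + q - x) / (2 * √(p * q))) := by
  have hr : √(q / p) ^ 2 = q / p := Real.sq_sqrt (by positivity)
  have hry : √(q / p) * (2 * ((p + q - x) / (2 * √(p * q)))) = (p + q - x) / p := by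
    rw [Real.sqrt_div hq.le, Real.sqrt_mul hp.le]
    have h1 := Real.sq_sqrt hp.le
    have h2 := (Real.sqrt_pos.2 hp).ne'
    have h3 := (Real.sqrt_pos.2 hq).ne'
    field_simp
    linear_combination -(p + q - x) * h1
  induction n using Nat.twoStepInduction with
  | zero => simp [halfPoly]
  | one => simp [halfPoly]
  | more n ih1 ih2 =>
    have h1 := congrArg (Polynomial.eval x) (halfPoly_rec hp q n)
    simp only [eval_mul, eval_sub, eval_C, eval_X] at h1
    have h2 : Chebyshev.U ℝ (((n + 2 : ℕ) : ℤ) - 1) =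
        2 * X * Chebyshev.U ℝ (((n + 1 : ℕ) : ℤ) - 1) - Chebyshev.U ℝ ((n : ℤ) - 1) := by
      have := Chebyshev.U_add_two ℝ ((n : ℤ) - 1)
      rw [show ((n + 2 : ℕ) : ℤ) - 1 = (n : ℤ) - 1 + 2 by push_cast; ring, this,
        show ((n + 1 : ℕ) : ℤ) - 1 = (n : ℤ) - 1 + 1 by push_cast; ring]
    have h3 : (halfPoly p q (n + 2)).eval x = (p + q - x) / p * (halfPoly p q (n + 1)).eval x -
        q / p * (halfPoly p q n).eval x := by
      field_simp
      linear_combination h1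
    rw [h3, h2]
    simp only [eval_sub, eval_mul, eval_X, eval_ofNat]
    linear_combination (p + q - x) / p * ih2 - q / p * ih1 -
      √(q / p) ^ (n + 1) * (Chebyshev.U ℝ (((n + 1 : ℕ) : ℤ) - 1)).eval
        ((p + q - x) / (2 * √(p * q))) * hry + √(q / p) ^ n *
        (Chebyshev.U ℝ ((n : ℤ) - 1)).eval ((p + q - x) / (2 * √(p * q))) * hr

lemma rpow_half {a : ℝ} (ha : 0 ≤ a) (n : ℕ) : a ^ ((n : ℝ) / 2) = √a ^ n := by
  rw [Real.sqrt_eq_rpow, ← Real.rpow_natCast, ← Real.rpow_mul ha]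
  congr 1
  ring

section Family

variable {lam mu al be : ℝ} (hlam : 0 < lam) (hmu : 0 < mu) (hal : 0 < al) (hbe : 0 < be)

/-- The explicit family of polynomials. -/
def explicitFamily (lam mu al be : ℝ) (k : Fin 2) : ℤ → ℝ[X]
  | Int.ofNat n => if k = 0 then halfPoly lam mu (n + 1) else -(C (mu / lam) * halfPoly lam mu n)
  | Int.negSucc n => if k = 0 then -(C (be / al) * halfPoly al be n) else halfPoly al be (n + 1)

include hlam in
lemma IsGeneratedFamily.eq_ofNat {Q : Fin 2 → ℤ → ℝ[X]}
    (hQ : IsGeneratedFamily (birth lam be) (death mu al) Q) (k : Fin 2) (n : ℕ) :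
    Q k n = halfPoly lam mu (n + 1) * Q k 0 - C (mu / lam) * halfPoly lam mu n * Q k (-1) := by
  have h := eq_halfPoly (q := mu) hlam (T := fun n : ℕ => Q k ((n : ℤ) - 1)) (fun n => ?_) n
  · simpa using h
  · have := hQ.recurrence k n
    rw [birth_ofNat, death_ofNat] at this
    rw [show ((n + 2 : ℕ) : ℤ) - 1 = (n : ℤ) + 1 by push_cast; ring,
      show ((n + 1 : ℕ) : ℤ) - 1 = (n : ℤ) by push_cast; ring]
    linear_combination -this

include hal in
lemma IsGeneratedFamily.eq_neg {Q : Fin 2 → ℤ → ℝ[X]}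
    (hQ : IsGeneratedFamily (birth lam be) (death mu al) Q) (k : Fin 2) (n : ℕ) :
    Q k (-(n : ℤ) - 1) =
      halfPoly al be (n + 1) * Q k (-1) - C (be / al) * halfPoly al be n * Q k 0 := by
  have h := eq_halfPoly (q := be) hal (T := fun n : ℕ => Q k (-(n : ℤ))) (fun n => ?_) n
  · simpa [sub_eq_add_neg, add_comm] using h
  · have := hQ.recurrence k (-(n : ℤ) - 1)
    rw [birth_neg (by omega), death_neg (by omega)] at this
    rw [show -((n + 2 : ℕ) : ℤ) = -(n : ℤ) - 1 - 1 by push_cast; ring,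
      show -((n + 1 : ℕ) : ℤ) = -(n : ℤ) - 1 by push_cast; ring]
    rw [sub_add_cancel, add_comm be al] at this
    linear_combination -this

include hlam hal

lemma isGeneratedFamily_explicit :
    IsGeneratedFamily (birth lam be) (death mu al) (explicitFamily lam mu al be) := by
  have hn : ∀ (k : Fin 2) (n : ℕ), explicitFamily lam mu al be k (n : ℤ) =
    if k = 0 then halfPoly lam mu (n + 1) else -(C (mu / lam) * halfPoly lam mu n) := fun _ _ => rfl
  have hm : ∀ (k : Fin 2) (n : ℕ), explicitFamily lam mu al be k (-(n : ℤ) - 1) =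
      if k = 0 then -(C (be / al) * halfPoly al be n) else halfPoly al be (n + 1) := fun k n => by
    rw [show -(n : ℤ) - 1 = Int.negSucc n by omega]
    rfl
  have h0 : ∀ k, explicitFamily lam mu al be k 0 = if k = 0 then 1 else 0 := fun k => by
    have := hn k 0
    simpa [halfPoly] using this
  have h1 : ∀ k, explicitFamily lam mu al be k (-1) = if k = 0 then 0 else 1 := fun k => by
    have := hm k 0
    simpa [halfPoly] using this
  have c1 : C lam * C (mu / lam) = C mu := by rw [← C_mul, mul_div_cancel₀ _ hlam.ne']
  have c2 : C al * C (be / al) = C be := by rw [← C_mul, mul_div_cancel₀ _ hal.ne']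
  refine ⟨by simp [h0], by simp [h1], by simp [h0], by simp [h1], fun k n => ?_⟩
  rcases lt_or_ge n 0 with hneg | hnn
  · rw [birth_neg hneg, death_neg hneg]
    obtain ⟨m, rfl⟩ : ∃ m : ℕ, n = -(m : ℤ) - 1 := ⟨(-n - 1).toNat, by omega⟩
    rw [show -(m : ℤ) - 1 - 1 = -((m + 1 : ℕ) : ℤ) - 1 by push_cast; ring, hm, hm, sub_add_cancel]
    cases m with
    | zero =>
      have := halfPoly_rec hal be 0
      rw [C_add] at this ⊢
      simp only [Nat.cast_zero, neg_zero, h0, halfPoly] at this ⊢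
      split_ifs
      · linear_combination c2
      · linear_combination -this
    | succ m =>
      rw [show -((m + 1 : ℕ) : ℤ) = -(m : ℤ) - 1 by push_cast; ring, hm]
      have r1 := halfPoly_rec hal be m
      have r2 := halfPoly_rec hal be (m + 1)
      rw [C_add] at r1 r2 ⊢
      split_ifs
      · linear_combination C (be / al) * r1
      · linear_combination -r2
  · rw [birth_nonneg hnn, death_nonneg hnn]
    obtain ⟨m, rfl⟩ := Int.eq_ofNat_of_zero_le hnn
    rw [show (m : ℤ) + 1 = ((m + 1 : ℕ) : ℤ) by push_cast; ring, hn, hn]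
    cases m with
    | zero =>
      have := halfPoly_rec hlam mu 0
      rw [C_add] at this ⊢
      simp only [Nat.cast_zero, zero_sub, h1, halfPoly] at this ⊢
      split_ifs
      · linear_combination -this
      · linear_combination c1
    | succ m =>
      rw [show ((m + 1 : ℕ) : ℤ) - 1 = (m : ℤ) by push_cast; ring, hn]
      have r1 := halfPoly_rec hlam mu m
      have r2 := halfPoly_rec hlam mu (m + 1)
      rw [C_add] at r1 r2 ⊢
      split_ifs
      · linear_combination -r2
      · linear_combination C (mu / lam) * r1

/-- The outer coefficients λ and α are invertible, so the values at 0 and -1 propagate in both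
directions. -/
theorem existsUnique_generatedFamily :
    ∃! Q : Fin 2 → ℤ → ℝ[X], IsGeneratedFamily (birth lam be) (death mu al) Q := by
  have hE := isGeneratedFamily_explicit (mu := mu) (be := be) hlam hal
  refine ⟨_, hE, fun Q hQ => ?_⟩
  have h0 : ∀ k, Q k 0 = explicitFamily lam mu al be k 0 := fun k => by
    fin_cases k
    · exact hQ.first_zero.trans hE.first_zero.symm
    · exact hQ.second_zero.trans hE.second_zero.symm
  have h1 : ∀ k, Q k (-1) = explicitFamily lam mu al be k (-1) := fun k => by
    fin_cases k
    · exact hQ.first_neg_one.trans hE.first_neg_one.symm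
    · exact hQ.second_neg_one.trans hE.second_neg_one.symm
  funext k n
  rcases lt_or_ge n 0 with hneg | hnn
  · obtain ⟨m, rfl⟩ : ∃ m : ℕ, n = -(m : ℤ) - 1 := ⟨(-n - 1).toNat, by omega⟩
    rw [hQ.eq_neg hal, hE.eq_neg hal, h0, h1]
  · obtain ⟨m, rfl⟩ := Int.eq_ofNat_of_zero_le hnn
    rw [hQ.eq_ofNat hlam, hE.eq_ofNat hlam, h0, h1]

include hmu hbe

theorem generatedFamily_chebyshev {Q : Fin 2 → ℤ → ℝ[X]}
    (hQ : IsGeneratedFamily (birth lam be) (death mu al) Q) (n : ℕ) (x : ℝ) :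
    (Q 0 n).eval x = (mu / lam) ^ ((n : ℝ) / 2) *
      (Chebyshev.U ℝ n).eval ((lam + mu - x) / (2 * √(lam * mu))) ∧
    (Q 0 (-(n : ℤ) - 1)).eval x = -(be / al) ^ (((n : ℝ) + 1) / 2) *
      (Chebyshev.U ℝ ((n : ℤ) - 1)).eval ((al + be - x) / (2 * √(al * be))) ∧
    (Q 1 n).eval x = -(mu / lam) ^ (((n : ℝ) + 1) / 2) *
      (Chebyshev.U ℝ ((n : ℤ) - 1)).eval ((lam + mu - x) / (2 * √(lam * mu))) ∧
    (Q 1 (-(n : ℤ) - 1)).eval x = (be / al) ^ ((n : ℝ) / 2) *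
      (Chebyshev.U ℝ n).eval ((al + be - x) / (2 * √(al * be))) := by
  have up : ∀ {p q : ℝ}, 0 < p → 0 < q → (halfPoly p q (n + 1)).eval x = (q / p) ^ ((n : ℝ) / 2) *
      (Chebyshev.U ℝ n).eval ((p + q - x) / (2 * √(p * q))) := fun {p q} hp hq => by
    have h := eval_halfPoly hp hq (n + 1) x
    have hs : √(q / p) ≠ 0 := (Real.sqrt_pos.2 (by positivity)).ne'
    rw [rpow_half (by positivity)]
    apply mul_left_cancel₀ hs
    rw [h, show ((n + 1 : ℕ) : ℤ) - 1 = (n : ℤ) by push_cast; ring]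
    ring
  have down : ∀ {p q : ℝ}, 0 < p → 0 < q → q / p * (halfPoly p q n).eval x =
      (q / p) ^ (((n : ℝ) + 1) / 2) *
      (Chebyshev.U ℝ ((n : ℤ) - 1)).eval ((p + q - x) / (2 * √(p * q))) := fun {p q} hp hq => by
    have h := eval_halfPoly hp hq n x
    have hr : √(q / p) ^ 2 = q / p := Real.sq_sqrt (by positivity)
    have := rpow_half (a := q / p) (by positivity) (n + 1)
    push_cast at this
    rw [this, ← hr]
    rw [hr]
    linear_combination √(q / p) * h - (halfPoly p q n).eval x * hr
  refine ⟨?_, ?_, ?_, ?_⟩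
  · rw [hQ.eq_ofNat hlam, hQ.first_zero, hQ.first_neg_one, ← up hlam hmu]
    simp
  · rw [hQ.eq_neg hal, hQ.first_zero, hQ.first_neg_one, neg_mul, ← down hal hbe]
    simp
  · rw [hQ.eq_ofNat hlam, hQ.second_zero, hQ.second_neg_one, neg_mul, ← down hlam hmu]
    simp
  · rw [hQ.eq_neg hal, hQ.second_zero, hQ.second_neg_one, ← up hal hbe]
    simp

end Family

/-! ### The other form of the condition for an atom -/

section Condition

variable {lam mu al be : ℝ} (hlam : 0 < lam) (hmu : 0 < mu) (hal : 0 < al) (hbe : 0 < be)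
include hlam hmu hal hbe

/-- Squaring the inequalities turns them into C₁ < 0 and C₂ > 0; the remaining sign alternatives are
those of `zetaCondition_iff`. -/
theorem zetaCondition_iff_sqrt : ZetaCondition lam mu al be ↔
    ((al ≠ mu ∧ √(lam / mu) < |(be - lam) / (al - mu)| ∧
        |(be - lam) / (al - mu)| < √(be / al)) ∧
      (lam < be ∨ (al < mu ∧ be < lam))) := by
  have key : al ≠ mu → ((√(lam / mu) < |(be - lam) / (al - mu)| ∧
      |(be - lam) / (al - mu)| < √(be / al)) ↔
      (constOne lam mu al be < 0 ∧ 0 < constTwo lam mu al be)) := by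
    intro h
    have h0 : 0 < (al - mu) ^ 2 := by have := sub_ne_zero.2 h; positivity
    rw [← Real.sqrt_sq_eq_abs, Real.sqrt_lt_sqrt_iff (by positivity),
      Real.sqrt_lt_sqrt_iff (by positivity), div_pow, div_lt_div_iff₀ hmu h0,
      div_lt_div_iff₀ h0 hal, constOne, constTwo]
    constructor <;> rintro ⟨h1, h2⟩ <;> constructor <;> linarith
  rw [zetaCondition_iff hmu hal hbe]
  constructor
  · rintro ⟨h1, h2, h3⟩
    refine ⟨⟨h1, (key h1).2 h3⟩, ?_⟩
    rcases (zetaCondition_iff hmu hal hbe).2 ⟨h1, h2, h3⟩ with h | h | h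
    · exact Or.inl h.2.1
    · exact Or.inl h.2.1
    · exact Or.inr ⟨h.1, h.2.1⟩
  · rintro ⟨⟨h1, h2⟩, h3⟩
    exact ⟨h1, h3.elim (fun h => h.ne') fun h => h.2.ne, (key h1).1 h2⟩

end Condition


/-! ### First passage -/

section Passage

variable {b d : ℤ → ℝ} (hb : ∀ n, 0 < b n) (hd : ∀ n, 0 < d n)

/-- The first jump time at which the jump chain started at `k` satisfies `R`. -/
def passage (b d : ℤ → ℝ) (R : ℕ → ℤ → Prop) (k : ℤ) (ω : Noise) : ℝ≥0∞ :=
  ⨅ (n : ℕ) (_ : R n (jumpChain b d k ω n)), ENNReal.ofReal (jumpTime b d k ω n)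

/-- The event that the jump chain started at `k` satisfies `R` at some time. -/
def passageEvent (b d : ℤ → ℝ) (R : ℕ → ℤ → Prop) (k : ℤ) : Set Noise :=
  {ω | ∃ n, R n (jumpChain b d k ω n)}

lemma passage_lt_top_iff (R : ℕ → ℤ → Prop) (k : ℤ) (ω : Noise) :
    passage b d R k ω < ⊤ ↔ ω ∈ passageEvent b d R k := by
  simp [passage, passageEvent, iInf_lt_iff]

lemma measurableSet_chain (R : ℕ → ℤ → Prop) (k : ℤ) (n : ℕ) :
    MeasurableSet {ω | R n (jumpChain b d k ω n)} :=
  (measurable_jumpChain b d k n) (MeasurableSet.of_discrete (s := {s | R n s}))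

lemma measurableSet_passageEvent (R : ℕ → ℤ → Prop) (k : ℤ) :
    MeasurableSet (passageEvent b d R k) := by
  have : passageEvent b d R k = ⋃ n, {ω | R n (jumpChain b d k ω n)} := by
    ext; simp [passageEvent]
  rw [this]
  exact MeasurableSet.iUnion fun n => measurableSet_chain R k n

lemma measurable_passage (R : ℕ → ℤ → Prop) (k : ℤ) : Measurable (passage b d R k) := by
  classical
  refine Measurable.iInf fun n => ?_
  have : (fun ω => ⨅ (_ : R n (jumpChain b d k ω n)), ENNReal.ofReal (jumpTime b d k ω n)) =
      fun ω => if R n (jumpChain b d k ω n) then ENNReal.ofReal (jumpTime b d k ω n) else ⊤ := by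
    funext ω
    exact iInf_eq_if _
  rw [this]
  exact Measurable.ite (measurableSet_chain R k n) (measurable_jumpTime b d k n).ennreal_ofReal
    measurable_const

lemma mem_passageEvent_cons {R : ℕ → ℤ → Prop} {k : ℤ} (hR : ¬ R 0 k) (p : unitInterval × ℝ)
    (ω : Noise) : noiseCons p ω ∈ passageEvent b d R k ↔
      ω ∈ passageEvent b d (fun n => R (n + 1)) (step b d k p.1) := by
  simp only [passageEvent, Set.mem_ofPred_eq]
  constructor
  · rintro ⟨n, hn⟩
    cases n with
    | zero => exact absurd hn hR
    | succ n => exact ⟨n, by rwa [jumpChain_cons] at hn⟩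
  · rintro ⟨n, hn⟩
    exact ⟨n + 1, by rwa [jumpChain_cons]⟩

include hb hd

lemma passage_cons {R : ℕ → ℤ → Prop} {k : ℤ} (hR : ¬ R 0 k) {p : unitInterval × ℝ}
    (hp : 0 ≤ p.2) {ω : Noise} (hω : ∀ n, 0 ≤ (ω n).2) :
    passage b d R k (noiseCons p ω) = ENNReal.ofReal (p.2 / (b k + d k)) +
      passage b d (fun n => R (n + 1)) (step b d k p.1) ω := by
  have h0 : (⨅ (_ : R 0 (jumpChain b d k (noiseCons p ω) 0)),
      ENNReal.ofReal (jumpTime b d k (noiseCons p ω) 0)) = ⊤ := iInf_neg hR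
  rw [passage, ← inf_iInf_nat_succ, h0, top_inf_eq, passage, ENNReal.add_iInf]
  refine iInf_congr fun n => ?_
  rw [ENNReal.add_iInf, jumpChain_cons, jumpTime_cons]
  refine iInf_congr fun _ => ?_
  rw [ENNReal.ofReal_add (div_nonneg hp (add_pos (hb _) (hd _)).le) (jumpTime_nonneg hb hd _ hω n)]

/-- First-step analysis. The target may depend on the step number, so that first returns (step at
least 1) and hitting within N steps are all instances; one jump replaces R by its shift. -/
lemma measure_passageEvent {R : ℕ → ℤ → Prop} {k : ℤ} (hR : ¬ R 0 k) :
    (b k + d k) * noiseLaw.real (passageEvent b d R k) =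
      b k * noiseLaw.real (passageEvent b d (fun n => R (n + 1)) (k + 1)) +
      d k * noiseLaw.real (passageEvent b d (fun n => R (n + 1)) (k - 1)) := by
  have hq : 0 < b k + d k := add_pos (hb k) (hd k)
  have h1 : noiseLaw (passageEvent b d R k) =
      ENNReal.ofReal (b k / (b k + d k)) *
        noiseLaw (passageEvent b d (fun n => R (n + 1)) (k + 1)) +
      ENNReal.ofReal (d k / (b k + d k)) *
        noiseLaw (passageEvent b d (fun n => R (n + 1)) (k - 1)) := by
    rw [← lintegral_indicator_one (measurableSet_passageEvent R k), lintegral_noise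
      (measurable_one.indicator (measurableSet_passageEvent R k))]
    have h2 : ∀ p : unitInterval × ℝ, ∫⁻ ω, (passageEvent b d R k).indicator 1 (noiseCons p ω) ∂noiseLaw =
        noiseLaw (passageEvent b d (fun n => R (n + 1)) (step b d k p.1)) := fun p => by
      rw [← lintegral_indicator_one (measurableSet_passageEvent _ _)]
      refine lintegral_congr fun ω => ?_
      by_cases h : noiseCons p ω ∈ passageEvent b d R k
      · rw [Set.indicator_of_mem h, Set.indicator_of_mem ((mem_passageEvent_cons hR p ω).1 h)]
        rfl
      · rw [Set.indicator_of_notMem h,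
          Set.indicator_of_notMem fun h' => h ((mem_passageEvent_cons hR p ω).2 h')]
    simp only [h2]
    rw [lintegral_step hb hd k
      (g := fun s _ => noiseLaw (passageEvent b d (fun n => R (n + 1)) s)) fun _ => measurable_const]
    simp
  have h3 := congrArg ENNReal.toReal h1
  rw [ENNReal.toReal_add (ENNReal.mul_ne_top ENNReal.ofReal_ne_top (measure_ne_top _ _))
    (ENNReal.mul_ne_top ENNReal.ofReal_ne_top (measure_ne_top _ _)), ENNReal.toReal_mul,
    ENNReal.toReal_mul, ENNReal.toReal_ofReal (div_nonneg (hb k).le hq.le),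
    ENNReal.toReal_ofReal (div_nonneg (hd k).le hq.le)] at h3
  simp only [measureReal_def]
  rw [h3]
  field_simp

omit hb hd in
lemma lintegral_exp_id (q : ℝ) (hq : 0 < q) (c : ℝ≥0∞) :
    ∫⁻ x, (ENNReal.ofReal (x / q) + c) ∂(expMeasure 1) = ENNReal.ofReal (1 / q) + c := by
  rw [lintegral_add_right _ measurable_const, lintegral_const, measure_univ, mul_one]
  congr 1
  have hm : ∫⁻ x, ENNReal.ofReal x ∂(expMeasure 1) = 1 := by
    rw [lintegral_expMeasure_one (by fun_prop), setLIntegral_congr Ioi_ae_eq_Ici.symm]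
    have h1 : ∀ x ∈ Set.Ioi (0 : ℝ), ENNReal.ofReal (Real.exp (-x)) * ENNReal.ofReal x =
        ENNReal.ofReal (Real.exp (-x) * x ^ ((2 : ℝ) - 1)) := fun x hx => by
      rw [← ENNReal.ofReal_mul (Real.exp_pos _).le, show (2 : ℝ) - 1 = 1 by norm_num, Real.rpow_one]
    rw [setLIntegral_congr_fun measurableSet_Ioi h1, ← ofReal_integral_eq_lintegral_ofReal
      (Real.GammaIntegral_convergent two_pos), ← Real.Gamma_eq_integral two_pos, Real.Gamma_two,
      ENNReal.ofReal_one]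
    filter_upwards [ae_restrict_mem measurableSet_Ioi] with x hx
    have : 0 < x := hx
    positivity
  have h2 : ∀ x : ℝ, ENNReal.ofReal (x / q) = ENNReal.ofReal (1 / q) * ENNReal.ofReal x := fun x => by
    rw [← ENNReal.ofReal_mul (by positivity)]; congr 1; ring
  rw [lintegral_congr h2, lintegral_const_mul _ (by fun_prop), hm, mul_one]

lemma lintegral_passage {R : ℕ → ℤ → Prop} {k : ℤ} (hR : ¬ R 0 k) :
    ∫⁻ ω, passage b d R k ω ∂noiseLaw =
      ENNReal.ofReal (b k / (b k + d k)) * (ENNReal.ofReal (1 / (b k + d k)) +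
        ∫⁻ ω, passage b d (fun n => R (n + 1)) (k + 1) ω ∂noiseLaw) +
      ENNReal.ofReal (d k / (b k + d k)) * (ENNReal.ofReal (1 / (b k + d k)) +
        ∫⁻ ω, passage b d (fun n => R (n + 1)) (k - 1) ω ∂noiseLaw) := by
  have hq : 0 < b k + d k := add_pos (hb k) (hd k)
  rw [lintegral_noise (measurable_passage R k)]
  have h1 : ∀ᵐ p ∂((volume : Measure unitInterval).prod (expMeasure 1)),
      ∫⁻ ω, passage b d R k (noiseCons p ω) ∂noiseLaw = ENNReal.ofReal (p.2 / (b k + d k)) +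
        ∫⁻ ω, passage b d (fun n => R (n + 1)) (step b d k p.1) ω ∂noiseLaw := by
    have h2 : ∀ᵐ p ∂((volume : Measure unitInterval).prod (expMeasure 1)), 0 ≤ p.2 := by
      have h3 : ∀ᵐ x ∂(expMeasure 1), 0 ≤ x := by
        rw [ae_iff]; simpa [Set.Iio] using expMeasure_one_Iio
      exact Measure.quasiMeasurePreserving_snd.ae h3
    filter_upwards [h2] with p hp
    rw [lintegral_congr_ae (ae_noise_nonneg.mono fun ω hω => passage_cons hb hd hR hp hω),
      lintegral_add_left measurable_const, lintegral_const, measure_univ, mul_one]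
  rw [lintegral_congr_ae h1, lintegral_step hb hd k (g := fun s x => ENNReal.ofReal (x / (b k + d k)) +
    ∫⁻ ω, passage b d (fun n => R (n + 1)) s ω ∂noiseLaw) fun s => by fun_prop]
  simp only [lintegral_exp_id _ hq]

/-! ### Hitting probabilities and mean hitting times -/

/-- Probability that the chain started at `k` ever visits `i`. -/
def hitProb (b d : ℤ → ℝ) (i k : ℤ) : ℝ := noiseLaw.real (passageEvent b d (fun _ s => s = i) k)

/-- Mean time until the process started at `k` visits `i`. -/
def meanHit (b d : ℤ → ℝ) (i k : ℤ) : ℝ≥0∞ := ∫⁻ ω, passage b d (fun _ s => s = i) k ω ∂noiseLaw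

omit hb hd in
lemma hitProb_mem (i k : ℤ) : 0 ≤ hitProb b d i k ∧ hitProb b d i k ≤ 1 :=
  ⟨measureReal_nonneg, measureReal_le_one⟩

omit hb hd in
lemma hitProb_self (i : ℤ) : hitProb b d i i = 1 := by
  have : passageEvent b d (fun _ s => s = i) i = Set.univ := by
    ext ω
    exact ⟨fun _ => trivial, fun _ => ⟨0, rfl⟩⟩
  rw [hitProb, this, probReal_univ]

lemma hitProb_eq {i k : ℤ} (hk : k ≠ i) : (b k + d k) * hitProb b d i k =
    b k * hitProb b d i (k + 1) + d k * hitProb b d i (k - 1) :=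
  measure_passageEvent hb hd hk

/-- Probability of return. -/
lemma measure_returnTime (i : ℤ) :
    (b i + d i) * noiseLaw.real {ω | returnTime b d i ω < ⊤} =
      b i * hitProb b d i (i + 1) + d i * hitProb b d i (i - 1) := by
  have h1 : {ω | returnTime b d i ω < ⊤} = passageEvent b d (fun n s => 1 ≤ n ∧ s = i) i := by
    ext ω
    exact passage_lt_top_iff (fun n s => 1 ≤ n ∧ s = i) i ω
  rw [h1, measure_passageEvent hb hd (by simp)]
  simp [hitProb]

lemma lintegral_returnTime (i : ℤ) :
    ∫⁻ ω, returnTime b d i ω ∂noiseLaw =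
      ENNReal.ofReal (b i / (b i + d i)) * (ENNReal.ofReal (1 / (b i + d i)) +
        meanHit b d i (i + 1)) +
      ENNReal.ofReal (d i / (b i + d i)) * (ENNReal.ofReal (1 / (b i + d i)) +
        meanHit b d i (i - 1)) := by
  have h := lintegral_passage hb hd (R := fun n s => 1 ≤ n ∧ s = i) (k := i) (by simp)
  simp only [le_add_iff_nonneg_left, zero_le, true_and] at h
  exact h

lemma meanHit_eq {i k : ℤ} (hk : k ≠ i) : meanHit b d i k =
      ENNReal.ofReal (b k / (b k + d k)) * (ENNReal.ofReal (1 / (b k + d k)) +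
        meanHit b d i (k + 1)) +
      ENNReal.ofReal (d k / (b k + d k)) * (ENNReal.ofReal (1 / (b k + d k)) +
        meanHit b d i (k - 1)) :=
  lintegral_passage hb hd hk

/-- Hitting probabilities are dominated by superharmonic functions. -/
lemma hitProb_le {i : ℤ} {h : ℤ → ℝ} (h0 : ∀ k, 0 ≤ h k) (hi : 1 ≤ h i)
    (hsup : ∀ k, k ≠ i → b k * h (k + 1) + d k * h (k - 1) ≤ (b k + d k) * h k) (k : ℤ) :
    hitProb b d i k ≤ h k := by
  -- Induction on the horizon: the probability of a visit within N steps is at most h, and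
  -- continuity from below removes the horizon.
  have key : ∀ (N : ℕ) (k : ℤ), noiseLaw.real (passageEvent b d (fun n s => s = i ∧ n ≤ N) k) ≤ h k := by
    intro N
    induction N with
    | zero =>
      intro k
      rcases eq_or_ne k i with rfl | hk
      · exact measureReal_le_one.trans hi
      · have : passageEvent b d (fun n s => s = i ∧ n ≤ 0) k = ∅ := by
          ext ω
          simp only [passageEvent, Set.mem_ofPred_eq, Set.mem_empty_iff_false, iff_false]
          rintro ⟨n, h1, h2⟩
          obtain rfl : n = 0 := by omega
          exact hk h1
        rw [this, measureReal_empty]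
        exact h0 k
    | succ N ih =>
      intro k
      rcases eq_or_ne k i with rfl | hk
      · exact measureReal_le_one.trans hi
      · have h1 := measure_passageEvent hb hd (R := fun n s => s = i ∧ n ≤ N + 1) (k := k)
          (fun h => hk h.1)
        simp only [Nat.add_le_add_iff_right] at h1
        have hq : 0 < b k + d k := add_pos (hb k) (hd k)
        refine le_of_mul_le_mul_left ?_ hq
        rw [h1]
        refine le_trans ?_ (hsup k hk)
        exact add_le_add (mul_le_mul_of_nonneg_left (ih _) (hb k).le)
          (mul_le_mul_of_nonneg_left (ih _) (hd k).le)
  have hunion : passageEvent b d (fun _ s => s = i) k =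
      ⋃ N : ℕ, passageEvent b d (fun n s => s = i ∧ n ≤ N) k := by
    ext ω
    simp only [passageEvent, Set.mem_ofPred_eq, Set.mem_iUnion]
    exact ⟨fun ⟨n, hn⟩ => ⟨n, n, hn, le_rfl⟩, fun ⟨_, n, hn, _⟩ => ⟨n, hn⟩⟩
  have hmono : Monotone fun N : ℕ => passageEvent b d (fun n s => s = i ∧ n ≤ N) k :=
    fun N N' hN ω ⟨n, h1, h2⟩ => ⟨n, h1, h2.trans hN⟩
  have ht := tendsto_measure_iUnion_atTop (μ := noiseLaw) hmono
  rw [← hunion] at ht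
  have ht' := (ENNReal.tendsto_toReal (measure_ne_top _ _)).comp ht
  exact le_of_tendsto ht' (Eventually.of_forall fun N => key N k)

/-- Mean hitting times are dominated by nonnegative solutions of the first-step inequality. -/
lemma meanHit_le {i : ℤ} {W : ℤ → ℝ} (h0 : ∀ k, 0 ≤ W k)
    (hsup : ∀ k, k ≠ i → 1 + b k * W (k + 1) + d k * W (k - 1) ≤ (b k + d k) * W k) {k : ℤ}
    (hk : hitProb b d i k = 1) : meanHit b d i k ≤ ENNReal.ofReal (W k) := by
  -- Stopping also at step N makes the mean accessible to induction, the base being that the stopped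
  -- time is 0 when N = 0.
  have key : ∀ (N : ℕ) (k : ℤ), ∫⁻ ω, passage b d (fun n s => s = i ∨ n = N) k ω ∂noiseLaw ≤
      ENNReal.ofReal (W k) := by
    have hzero : ∀ (N : ℕ) (k : ℤ), (k = i ∨ 0 = N) →
        ∫⁻ ω, passage b d (fun n s => s = i ∨ n = N) k ω ∂noiseLaw ≤ ENNReal.ofReal (W k) := by
      intro N k h
      have : ∀ ω, passage b d (fun n s => s = i ∨ n = N) k ω = 0 := fun ω => by
        refine le_antisymm ((iInf₂_le 0 h).trans ?_) zero_le
        simp [jumpTime]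
      simp [this]
    intro N
    induction N with
    | zero => exact fun k => hzero 0 k (Or.inr rfl)
    | succ N ih =>
      intro k
      rcases eq_or_ne k i with rfl | hk
      · exact hzero _ _ (Or.inl rfl)
      · have h1 := lintegral_passage hb hd (R := fun n s => s = i ∨ n = N + 1) (k := k)
          (fun h => h.elim hk (by omega))
        simp only [Nat.add_right_cancel_iff] at h1
        have hq : 0 < b k + d k := add_pos (hb k) (hd k)
        have hbq : 0 ≤ b k / (b k + d k) := div_nonneg (hb k).le hq.le
        have hdq : 0 ≤ d k / (b k + d k) := div_nonneg (hd k).le hq.le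
        have hq1 : 0 ≤ 1 / (b k + d k) := by positivity
        rw [h1]
        refine (add_le_add (mul_le_mul_right (add_le_add_right (ih (k + 1)) _) _)
          (mul_le_mul_right (add_le_add_right (ih (k - 1)) _) _)).trans ?_
        rw [← ENNReal.ofReal_add hq1 (h0 _), ← ENNReal.ofReal_add hq1 (h0 _),
          ← ENNReal.ofReal_mul hbq, ← ENNReal.ofReal_mul hdq, ← ENNReal.ofReal_add
            (mul_nonneg hbq (add_nonneg hq1 (h0 _))) (mul_nonneg hdq (add_nonneg hq1 (h0 _)))]
        apply ENNReal.ofReal_le_ofReal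
        have e : b k / (b k + d k) * (1 / (b k + d k) + W (k + 1)) +
            d k / (b k + d k) * (1 / (b k + d k) + W (k - 1)) =
            (1 + b k * W (k + 1) + d k * W (k - 1)) / (b k + d k) := by
          field_simp; ring
        rw [e, div_le_iff₀ hq, mul_comm (W k)]
        exact hsup k hk
  -- Almost every path visits i. Once N passes a visit, the stopped time is at least the hitting
  -- time, so Fatou applies; on paths that never visit i this comparison would fail.
  have hae : ∀ᵐ ω ∂noiseLaw, passage b d (fun _ s => s = i) k ω ≤
      liminf (fun N : ℕ => passage b d (fun n s => s = i ∨ n = N) k ω) atTop := by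
    have h1 : passageEvent b d (fun _ s => s = i) k ∈ ae noiseLaw :=
      (mem_ae_iff_prob_eq_one (measurableSet_passageEvent _ _)).2 (by
        rw [hitProb, measureReal_def] at hk
        exact (ENNReal.toReal_eq_one_iff _).1 hk)
    filter_upwards [h1, ae_noise_nonneg] with ω hω hnn
    obtain ⟨n₀, hn₀⟩ := hω
    refine le_liminf_of_le (by isBoundedDefault) ?_
    filter_upwards [eventually_ge_atTop n₀] with N hN
    refine le_iInf₂ fun m hm => ?_
    rcases hm with hm | rfl
    · exact iInf₂_le m hm
    · exact (iInf₂_le n₀ hn₀).trans (ENNReal.ofReal_le_ofReal (jumpTime_mono hb hd k hnn hN))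
  calc meanHit b d i k ≤ ∫⁻ ω, liminf (fun N : ℕ => passage b d (fun n s => s = i ∨ n = N) k ω) atTop
        ∂noiseLaw := lintegral_mono_ae hae
    _ ≤ liminf (fun N : ℕ => ∫⁻ ω, passage b d (fun n s => s = i ∨ n = N) k ω ∂noiseLaw) atTop :=
        lintegral_liminf_le fun N => measurable_passage _ _
    _ ≤ ENNReal.ofReal (W k) := liminf_le_of_le (by isBoundedDefault) fun c hc => by
        obtain ⟨N, hN⟩ := hc.exists
        exact hN.trans (key N k)

end Passage


/-! ### Solutions of the first-step equations -/

/-- A bounded sequence whose increments are multiplied by positive factors, eventually at least one,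
is constant if it starts with a minimum. -/
lemma eq_zero_of_increments {a c : ℕ → ℝ} {N : ℕ} (h0 : a 0 = 0) (hnn : ∀ n, 0 ≤ a n)
    (h1 : ∀ n, a n ≤ 1) (hc : ∀ n, 0 < c n) (hN : ∀ n, N ≤ n → 1 ≤ c n)
    (hrec : ∀ n, a (n + 2) - a (n + 1) = c n * (a (n + 1) - a n)) (n : ℕ) : a n = 0 := by
  -- A positive first increment stays positive and, beyond N, does not decrease, so a grows at least
  -- linearly and violates its bound.
  have hz : a 1 = 0 := by
    by_contra hne
    have hpos : ∀ n, 0 < a (n + 1) - a n := fun n => by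
      induction n with
      | zero =>
        rw [h0, sub_zero]
        exact lt_of_le_of_ne (hnn 1) (Ne.symm hne)
      | succ n ih => rw [hrec]; exact mul_pos (hc n) ih
    have hmono : ∀ n, a (N + 1) - a N ≤ a (N + n + 1) - a (N + n) := fun n => by
      induction n with
      | zero => exact le_rfl
      | succ n ih =>
        have h2 := hrec (N + n)
        have h3 := hN (N + n) (by omega)
        have h4 := hpos (N + n)
        have e : N + (n + 1) = N + n + 1 := by ring
        rw [e]
        nlinarith
    have hlin : ∀ n : ℕ, n * (a (N + 1) - a N) ≤ a (N + n) := fun n => by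
      induction n with
      | zero => simpa using hnn N
      | succ n ih =>
        have := hmono n
        have e : N + (n + 1) = N + n + 1 := by ring
        rw [e]
        push_cast
        linarith
    obtain ⟨n, hn⟩ := exists_nat_gt (1 / (a (N + 1) - a N))
    rw [div_lt_iff₀ (hpos N)] at hn
    linarith [hlin n, h1 (N + n)]
  have hall : ∀ n, a n = 0 ∧ a (n + 1) = 0 := fun n => by
    induction n with
    | zero => exact ⟨h0, hz⟩
    | succ n ih =>
      have := hrec n
      rw [ih.1, ih.2] at this
      exact ⟨ih.2, by linarith⟩
  exact (hall n).1

/-- A sequence whose increments eventually decrease by a fixed amount is not bounded below. -/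
lemma not_nonneg_of_increments {a : ℕ → ℝ} {N : ℕ} {c : ℝ} (hc : 0 < c)
    (hrec : ∀ n, N ≤ n → a (n + 2) - a (n + 1) = a (n + 1) - a n - c) : ¬ ∀ n, 0 ≤ a n := by
  intro hnn
  have hinc : ∀ n : ℕ, a (N + n + 1) - a (N + n) = a (N + 1) - a N - n * c := fun n => by
    induction n with
    | zero => simp
    | succ n ih =>
      have h2 := hrec (N + n) (by omega)
      have e : N + (n + 1) = N + n + 1 := by ring
      rw [e]
      push_cast
      linarith
  -- After N + m the increments are below -1, so the sequence eventually becomes negative.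
  obtain ⟨m, hm⟩ := exists_nat_gt ((a (N + 1) - a N + 1) / c)
  rw [div_lt_iff₀ hc] at hm
  have hlin : ∀ n : ℕ, a (N + m + n) ≤ a (N + m) - n := fun n => by
    induction n with
    | zero => simp
    | succ n ih =>
      have h2 := hinc (m + n)
      have e : N + m + (n + 1) = N + (m + n) + 1 := by ring
      have e2 : N + m + n = N + (m + n) := by ring
      rw [e]
      rw [e2] at ih
      push_cast at h2 ⊢
      have : 0 ≤ (n : ℝ) * c := by positivity
      linarith
  obtain ⟨n, hn⟩ := exists_nat_gt (a (N + m))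
  linarith [hlin n, hnn (N + m + n)]

/-- The reflection k ↦ -1 - k exchanges (λ, μ) with (α, β), so every statement about the left
half-line follows from its counterpart on the right. -/
lemma birth_reflect (mu al : ℝ) (k : ℤ) : birth al mu (-1 - k) = death mu al k := by
  unfold birth death
  rcases lt_or_ge k 0 with h | h
  · rw [if_pos (by omega), if_neg (by omega)]
  · rw [if_neg (by omega), if_pos h]

lemma death_reflect (lam be : ℝ) (k : ℤ) : death be lam (-1 - k) = birth lam be k := by
  unfold birth death
  rcases lt_or_ge k 0 with h | h
  · rw [if_pos (by omega), if_neg (by omega)]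
  · rw [if_neg (by omega), if_pos h]

section Equations

variable {lam mu al be : ℝ}

lemma birth_pos (hlam : 0 < lam) (hbe : 0 < be) (n : ℤ) : 0 < birth lam be n := by
  unfold birth; split_ifs <;> assumption

lemma death_pos (hmu : 0 < mu) (hal : 0 < al) (n : ℤ) : 0 < death mu al n := by
  unfold death; split_ifs <;> assumption

/-- Bounded solutions of the homogeneous equation vanish to the right of a zero. -/
lemma harmonic_right (hlam : 0 < lam) (hmu : 0 < mu) (hal : 0 < al) (hbe : 0 < be) (hle : lam ≤ mu)
    {i : ℤ} {v : ℤ → ℝ} (hv : ∀ k, 0 ≤ v k ∧ v k ≤ 1) (hi : v i = 0)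
    (heq : ∀ k, i < k → (birth lam be k + death mu al k) * v k =
      birth lam be k * v (k + 1) + death mu al k * v (k - 1)) {k : ℤ} (hk : i ≤ k) : v k = 0 := by
  -- Increments are multiplied by death over birth. After |i| steps the states are nonnegative and
  -- this factor is μ/λ, which is at least 1.
  have h := eq_zero_of_increments (a := fun n : ℕ => v (i + n))
    (c := fun n : ℕ => death mu al (i + n + 1) / birth lam be (i + n + 1)) (N := i.natAbs)
    (by simpa using hi) (fun n => (hv _).1) (fun n => (hv _).2)
    (fun n => div_pos (death_pos hmu hal _) (birth_pos hlam hbe _)) (fun n hn => ?_) (fun n => ?_)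
    (k - i).toNat
  · beta_reduce at h
    rwa [show i + ((k - i).toNat : ℤ) = k by omega] at h
  · rw [death_nonneg (by omega), birth_nonneg (by omega), one_le_div hlam]
    exact hle
  · have h1 := heq (i + n + 1) (by omega)
    have h2 := birth_pos hlam hbe (i + n + 1)
    rw [show i + (n : ℤ) + 1 + 1 = i + ((n + 2 : ℕ) : ℤ) by push_cast; ring,
      show i + (n : ℤ) + 1 - 1 = i + (n : ℤ) by ring] at h1
    rw [show i + ((n + 1 : ℕ) : ℤ) = i + (n : ℤ) + 1 by push_cast; ring]
    field_simp
    linarith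

lemma harmonic_left (hlam : 0 < lam) (hmu : 0 < mu) (hal : 0 < al) (hbe : 0 < be) (hle : al ≤ be)
    {i : ℤ} {v : ℤ → ℝ} (hv : ∀ k, 0 ≤ v k ∧ v k ≤ 1) (hi : v i = 0)
    (heq : ∀ k, k < i → (birth lam be k + death mu al k) * v k =
      birth lam be k * v (k + 1) + death mu al k * v (k - 1)) {k : ℤ} (hk : k ≤ i) : v k = 0 := by
  have h := harmonic_right (lam := al) (mu := be) (al := lam) (be := mu) hal hbe hlam hmu hle
    (i := -1 - i) (v := fun k => v (-1 - k)) (fun k => hv _) (by simpa using hi) (fun k hk => ?_)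
    (k := -1 - k) (by omega)
  · simpa using h
  · have h1 := heq (-1 - k) (by omega)
    rw [← birth_reflect, ← death_reflect, show -1 - (-1 - k) = k by ring] at h1
    rw [show -1 - (k + 1) = -1 - k - 1 by ring, show -1 - (k - 1) = -1 - k + 1 by ring]
    linarith

/-- The inhomogeneous equation has no nonnegative solution if the rates balance. -/
lemma no_mean_right (hlam : 0 < lam) (heq' : lam = mu) {i : ℤ} {W : ℤ → ℝ} (hW : ∀ k, 0 ≤ W k)
    (heq : ∀ k, i < k → (birth lam be k + death mu al k) * W k =
      1 + birth lam be k * W (k + 1) + death mu al k * W (k - 1)) : False := by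
  -- Once the states are nonnegative the rates balance, and each increment falls by exactly 1/λ.
  refine not_nonneg_of_increments (a := fun n : ℕ => W (i + n)) (N := i.natAbs)
    (c := 1 / lam) (by positivity) (fun n hn => ?_) fun n => hW _
  have h1 := heq (i + n + 1) (by omega)
  rw [death_nonneg (by omega), birth_nonneg (by omega), ← heq',
    show i + (n : ℤ) + 1 + 1 = i + ((n + 2 : ℕ) : ℤ) by push_cast; ring,
    show i + (n : ℤ) + 1 - 1 = i + (n : ℤ) by ring] at h1
  rw [show i + ((n + 1 : ℕ) : ℤ) = i + (n : ℤ) + 1 by push_cast; ring]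
  field_simp
  linarith

lemma no_mean_left (hal : 0 < al) (heq' : al = be) {i : ℤ} {W : ℤ → ℝ} (hW : ∀ k, 0 ≤ W k)
    (heq : ∀ k, k < i → (birth lam be k + death mu al k) * W k =
      1 + birth lam be k * W (k + 1) + death mu al k * W (k - 1)) : False := by
  refine no_mean_right (lam := al) (mu := be) (al := lam) (be := mu) hal heq' (i := -1 - i)
    (W := fun k => W (-1 - k)) (fun k => hW _) fun k hk => ?_
  have h1 := heq (-1 - k) (by omega)
  rw [← birth_reflect, ← death_reflect, show -1 - (-1 - k) = k by ring] at h1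
  rw [show -1 - (k + 1) = -1 - k - 1 by ring, show -1 - (k - 1) = -1 - k + 1 by ring]
  linarith

/-- Increments of the mean passage time to the left, on the negative states. -/
def meanIncrement (c al be : ℝ) : ℕ → ℝ
  | 0 => c
  | n + 1 => (1 + be * meanIncrement c al be n) / al

/-- An increasing solution of the inhomogeneous equation. -/
def meanSolution (c al be : ℝ) : ℤ → ℝ
  | Int.ofNat n => (n + 1) * c
  | Int.negSucc n => -∑ j ∈ Finset.range n, meanIncrement c al be (j + 1)

/-- On the nonnegative side the constant increment c = 1/(μ-λ) works, since μc = 1 + λc. Continued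
to the left, increments obey c ↦ (1 + βc)/α and stay positive, so the solution is monotone on all of
ℤ. -/
lemma exists_mean_right (hal : 0 < al) (hbe : 0 < be)
    (hlt : lam < mu) : ∃ V : ℤ → ℝ, Monotone V ∧
      ∀ k, (birth lam be k + death mu al k) * V k =
        1 + birth lam be k * V (k + 1) + death mu al k * V (k - 1) := by
  set c := 1 / (mu - lam) with hc
  have hc0 : 0 < c := by have := sub_pos.2 hlt; positivity
  have hpos : ∀ n, 0 < meanIncrement c al be n := fun n => by
    induction n with
    | zero => exact hc0
    | succ n ih => rw [meanIncrement]; positivity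
  have hn : ∀ n : ℕ, meanSolution c al be (n : ℤ) = (n + 1) * c := fun n => rfl
  have hm : ∀ n : ℕ, meanSolution c al be (-(n : ℤ) - 1) =
      -∑ j ∈ Finset.range n, meanIncrement c al be (j + 1) := fun n => by
    rw [show -(n : ℤ) - 1 = Int.negSucc n by omega]
    rfl
  have hn1 : ∀ n : ℕ, meanSolution c al be (n : ℤ) - meanSolution c al be ((n : ℤ) - 1) = c := by
    intro n
    cases n with
    | zero =>
      have := hm 0
      rw [hn]
      simp only [Nat.cast_zero, neg_zero, zero_sub] at this ⊢
      rw [this]; simp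
    | succ n =>
      rw [hn, show ((n + 1 : ℕ) : ℤ) - 1 = (n : ℤ) by push_cast; ring, hn]
      push_cast; ring
  have hm1 : ∀ n : ℕ, meanSolution c al be (-(n : ℤ) - 1) - meanSolution c al be (-(n : ℤ) - 1 - 1) =
      meanIncrement c al be (n + 1) := by
    intro n
    rw [show -(n : ℤ) - 1 - 1 = -((n + 1 : ℕ) : ℤ) - 1 by push_cast; ring, hm, hm,
      Finset.sum_range_succ]
    ring
  refine ⟨meanSolution c al be, monotone_int_of_le_succ fun k => ?_, fun k => ?_⟩
  · rcases lt_or_ge k (-1) with h | h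
    · obtain ⟨m, rfl⟩ : ∃ m : ℕ, k = -(m : ℤ) - 1 - 1 := ⟨(-k - 2).toNat, by omega⟩
      rw [sub_add_cancel]
      linarith [hm1 m, hpos (m + 1)]
    · obtain ⟨m, rfl⟩ : ∃ m : ℕ, k = (m : ℤ) - 1 := ⟨(k + 1).toNat, by omega⟩
      rw [sub_add_cancel]
      linarith [hn1 m]
  · rcases lt_or_ge k 0 with h | h
    · obtain ⟨m, rfl⟩ : ∃ m : ℕ, k = -(m : ℤ) - 1 := ⟨(-k - 1).toNat, by omega⟩
      rw [birth_neg h, death_neg h]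
      have h1 := hm1 m
      have h2 : meanSolution c al be (-(m : ℤ) - 1 + 1) - meanSolution c al be (-(m : ℤ) - 1) =
          meanIncrement c al be m := by
        cases m with
        | zero => simpa [meanIncrement] using hn1 0
        | succ m =>
          have := hm1 m
          rwa [show -((m + 1 : ℕ) : ℤ) - 1 + 1 = -(m : ℤ) - 1 by push_cast; ring,
            show -((m + 1 : ℕ) : ℤ) - 1 = -(m : ℤ) - 1 - 1 by push_cast; ring]
      have h3 : al * meanIncrement c al be (m + 1) = 1 + be * meanIncrement c al be m := by
        rw [meanIncrement, mul_div_cancel₀ _ hal.ne']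
      rw [← h1, ← h2] at h3
      linarith
    · obtain ⟨m, rfl⟩ := Int.eq_ofNat_of_zero_le h
      rw [birth_nonneg h, death_nonneg h]
      have h1 := hn1 m
      have h2 := hn1 (m + 1)
      rw [show ((m + 1 : ℕ) : ℤ) - 1 = (m : ℤ) by push_cast; ring,
        show ((m + 1 : ℕ) : ℤ) = (m : ℤ) + 1 by push_cast; ring] at h2
      have h3 : mu * c = 1 + lam * c := by
        rw [hc]
        have := (sub_pos.2 hlt).ne'
        field_simp
        ring
      have h4 : mu * (meanSolution c al be (m : ℤ) - meanSolution c al be ((m : ℤ) - 1)) =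
        1 + lam * (meanSolution c al be ((m : ℤ) + 1) - meanSolution c al be (m : ℤ)) := by
        rw [h1, h2, h3]
      linarith

lemma exists_mean_left (hlam : 0 < lam) (hmu : 0 < mu)
    (hlt : al < be) : ∃ V : ℤ → ℝ, Antitone V ∧
      ∀ k, (birth lam be k + death mu al k) * V k =
        1 + birth lam be k * V (k + 1) + death mu al k * V (k - 1) := by
  obtain ⟨V, hV, heq⟩ := exists_mean_right (lam := al) (mu := be) (al := lam) (be := mu)
    hlam hmu hlt
  refine ⟨fun k => V (-1 - k), fun a c hac => hV (by omega), fun k => ?_⟩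
  have h1 := heq (-1 - k)
  rw [birth_reflect, death_reflect] at h1
  beta_reduce
  rw [show -1 - (k + 1) = -1 - k - 1 by ring, show -1 - (k - 1) = -1 - k + 1 by ring]
  linarith

/-- A bounded superharmonic function decaying on the right. -/
lemma exists_superharmonic_right (hlam : 0 < lam) (hmu : 0 < mu) (hal : 0 < al) (hbe : 0 < be)
    (hlt : mu < lam) (i : ℤ) : ∃ h : ℤ → ℝ, (∀ k, 0 ≤ h k) ∧ h i = 1 ∧ (∃ k, i < k ∧ h k < 1) ∧
      ∀ k, birth lam be k * h (k + 1) + death mu al k * h (k - 1) ≤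
        (birth lam be k + death mu al k) * h k := by
  set ρ := mu / lam with hρ
  have hρ0 : 0 < ρ := by positivity
  have hρ1 : ρ < 1 := (div_lt_one hlam).2 hlt
  -- The function is 1 up to K and geometric beyond it; K ≥ 0 keeps the decaying part in the
  -- right-hand regime, and K ≥ i makes its value at i equal to 1.
  set K := max i 0 with hK
  have hK0 : 0 ≤ K := le_max_right _ _
  have hKi : i ≤ K := le_max_left _ _
  have hle : ∀ k : ℤ, ρ ^ (k - K).toNat ≤ 1 := fun k => pow_le_one₀ hρ0.le hρ1.le
  refine ⟨fun k => ρ ^ (k - K).toNat, fun k => by positivity, ?_, ⟨K + 1, by omega, ?_⟩, fun k => ?_⟩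
  · beta_reduce
    rw [show (i - K).toNat = 0 by omega, pow_zero]
  · beta_reduce
    rw [show (K + 1 - K).toNat = 1 by omega, pow_one]
    exact hρ1
  · beta_reduce
    rcases le_or_gt k K with h | h
    · rw [show (k - K).toNat = 0 by omega, pow_zero]
      have h1 := mul_le_mul_of_nonneg_left (hle (k + 1)) (birth_pos hlam hbe k).le
      have h2 := mul_le_mul_of_nonneg_left (hle (k - 1)) (death_pos hmu hal k).le
      linarith
    · obtain ⟨n, hn⟩ : ∃ n : ℕ, k = K + n + 1 := ⟨(k - K - 1).toNat, by omega⟩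
      rw [show (k - K).toNat = n + 1 by omega, show (k + 1 - K).toNat = n + 2 by omega,
        show (k - 1 - K).toNat = n by omega, birth_nonneg (by omega), death_nonneg (by omega)]
      have : lam * ρ = mu := by rw [hρ, mul_div_cancel₀ _ hlam.ne']
      rw [← this]
      apply le_of_eq
      ring

end Equations

/-! ### Classification -/

section Classification

variable {lam mu al be : ℝ} (hlam : 0 < lam) (hmu : 0 < mu) (hal : 0 < al) (hbe : 0 < be)
include hlam hmu hal hbe

/-- One minus the hitting probability takes values in [0, 1], is harmonic off i and vanishes at i,
so it vanishes on both sides. -/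
lemma hitProb_eq_one (h1 : lam ≤ mu) (h2 : al ≤ be) (i k : ℤ) :
    hitProb (birth lam be) (death mu al) i k = 1 := by
  have hv : ∀ k, 0 ≤ 1 - hitProb (birth lam be) (death mu al) i k ∧
      1 - hitProb (birth lam be) (death mu al) i k ≤ 1 := fun k => by
    have := hitProb_mem (b := birth lam be) (d := death mu al) i k
    constructor <;> linarith
  have heq : ∀ k, k ≠ i → (birth lam be k + death mu al k) *
      (1 - hitProb (birth lam be) (death mu al) i k) =
      birth lam be k * (1 - hitProb (birth lam be) (death mu al) i (k + 1)) +
      death mu al k * (1 - hitProb (birth lam be) (death mu al) i (k - 1)) := fun k hk => by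
    have := hitProb_eq (birth_pos hlam hbe) (death_pos hmu hal) hk
    linarith
  have hz : 1 - hitProb (birth lam be) (death mu al) i i = 0 := by rw [hitProb_self, sub_self]
  rcases le_total i k with h | h
  · have := harmonic_right hlam hmu hal hbe h1
      (v := fun k => 1 - hitProb (birth lam be) (death mu al) i k) hv hz
      (fun k hk => heq k hk.ne') h
    linarith
  · have := harmonic_left hlam hmu hal hbe h2
      (v := fun k => 1 - hitProb (birth lam be) (death mu al) i k) hv hz
      (fun k hk => heq k hk.ne) h
    linarith

theorem isRecurrent_of_le (h1 : lam ≤ mu) (h2 : al ≤ be) :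
    IsRecurrent (birth lam be) (death mu al) := by
  intro i
  have h := measure_returnTime (birth_pos hlam hbe) (death_pos hmu hal) i
  rw [hitProb_eq_one hlam hmu hal hbe h1 h2, hitProb_eq_one hlam hmu hal hbe h1 h2, mul_one,
    mul_one] at h
  have hq := add_pos (birth_pos hlam hbe i) (death_pos hmu hal i)
  have := mul_left_cancel₀ hq.ne' (h.trans (mul_one _).symm)
  rw [measureReal_def] at this
  exact (ENNReal.toReal_eq_one_iff _).1 this

/-- The return probability is a proper average of the hitting probabilities from the two neighbours,
so both are 1; the first-step equation then propagates the value 1 outwards. -/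
lemma returnProb_eq_one_imp {i : ℤ}
    (h : noiseLaw {ω | returnTime (birth lam be) (death mu al) i ω < ⊤} = 1) (k : ℤ) :
    hitProb (birth lam be) (death mu al) i k = 1 := by
  have hb := birth_pos hlam hbe
  have hd := death_pos hmu hal
  have h1 := measure_returnTime hb hd i
  rw [measureReal_def, h, ENNReal.toReal_one, mul_one] at h1
  have hm := hitProb_mem (b := birth lam be) (d := death mu al) i
  have hbi := hb i
  have hdi := hd i
  have hr : hitProb (birth lam be) (death mu al) i (i + 1) = 1 := by
    nlinarith [mul_nonneg hbi.le (sub_nonneg.2 (hm (i + 1)).2),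
      mul_nonneg hdi.le (sub_nonneg.2 (hm (i - 1)).2), (hm (i + 1)).2]
  have hl : hitProb (birth lam be) (death mu al) i (i - 1) = 1 := by
    nlinarith [mul_nonneg hbi.le (sub_nonneg.2 (hm (i + 1)).2),
      mul_nonneg hdi.le (sub_nonneg.2 (hm (i - 1)).2), (hm (i - 1)).2]
  have hs := hitProb_self (b := birth lam be) (d := death mu al) i
  rcases le_total i k with hk | hk
  · obtain ⟨n, rfl⟩ : ∃ n : ℕ, k = i + n := ⟨(k - i).toNat, by omega⟩
    have : ∀ n : ℕ, hitProb (birth lam be) (death mu al) i (i + n) = 1 ∧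
        hitProb (birth lam be) (death mu al) i (i + n + 1) = 1 := fun n => by
      induction n with
      | zero => simpa using ⟨hs, hr⟩
      | succ n ih =>
        have h2 := hitProb_eq hb hd (i := i) (k := i + n + 1) (by omega)
        rw [ih.2, show i + (n : ℤ) + 1 - 1 = i + n by ring, ih.1, mul_one, mul_one] at h2
        have h3 := hb (i + n + 1)
        rw [show i + ((n + 1 : ℕ) : ℤ) = i + (n : ℤ) + 1 by push_cast; ring]
        exact ⟨ih.2, mul_left_cancel₀ h3.ne' (by linarith)⟩
    exact (this n).1
  · obtain ⟨n, rfl⟩ : ∃ n : ℕ, k = i - n := ⟨(i - k).toNat, by omega⟩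
    have : ∀ n : ℕ, hitProb (birth lam be) (death mu al) i (i - n) = 1 ∧
        hitProb (birth lam be) (death mu al) i (i - n - 1) = 1 := fun n => by
      induction n with
      | zero => simpa using ⟨hs, hl⟩
      | succ n ih =>
        have h2 := hitProb_eq hb hd (i := i) (k := i - n - 1) (by omega)
        rw [ih.2, show i - (n : ℤ) - 1 + 1 = i - n by ring, ih.1, mul_one, mul_one] at h2
        have h3 := hd (i - n - 1)
        rw [show i - ((n + 1 : ℕ) : ℤ) = i - (n : ℤ) - 1 by push_cast; ring]
        exact ⟨ih.2, mul_left_cancel₀ h3.ne' (by linarith)⟩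
    exact (this n).1

/-- Certain return would make every hitting probability 1, but a superharmonic majorant is below 1
somewhere. Drift to the left is handled by reflection. -/
theorem isTransient_of_lt (h : mu < lam ∨ be < al) : IsTransient (birth lam be) (death mu al) := by
  intro i
  refine lt_of_le_of_ne prob_le_one fun h1 => ?_
  have hone := returnProb_eq_one_imp hlam hmu hal hbe h1
  rcases h with h | h
  · obtain ⟨f, hf0, hfi, ⟨k, -, hk⟩, hf⟩ := exists_superharmonic_right hlam hmu hal hbe h i
    have := hitProb_le (birth_pos hlam hbe) (death_pos hmu hal) hf0 hfi.ge (fun k _ => hf k) k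
    rw [hone] at this
    linarith
  · obtain ⟨f, hf0, hfi, ⟨k, -, hk⟩, hf⟩ := exists_superharmonic_right (lam := al) (mu := be)
      (al := lam) (be := mu) hal hbe hlam hmu h (-1 - i)
    have := hitProb_le (birth_pos hlam hbe) (death_pos hmu hal) (i := i) (h := fun k => f (-1 - k))
      (fun k => hf0 _) hfi.ge (fun k _ => ?_) (-1 - k)
    · rw [hone, show -1 - (-1 - k) = k by ring] at this
      linarith
    · have h2 := hf (-1 - k)
      rw [birth_reflect, death_reflect] at h2
      rw [show -1 - (k + 1) = -1 - k - 1 by ring, show -1 - (k - 1) = -1 - k + 1 by ring]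
      linarith

theorem isTransient_iff : IsTransient (birth lam be) (death mu al) ↔ mu < lam ∨ be < al := by
  refine ⟨fun h => ?_, isTransient_of_lt hlam hmu hal hbe⟩
  by_contra! hle
  exact (h 0).ne (isRecurrent_of_le hlam hmu hal hbe hle.1 hle.2 0)

theorem isRecurrent_iff : IsRecurrent (birth lam be) (death mu al) ↔ lam ≤ mu ∧ al ≤ be := by
  refine ⟨fun h => ?_, fun h => isRecurrent_of_le hlam hmu hal hbe h.1 h.2⟩
  by_contra hle
  rw [not_and_or, not_le, not_le] at hle
  exact (isTransient_of_lt hlam hmu hal hbe hle 0).ne (h 0)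

lemma meanReturn_lt_top (h1 : lam < mu) (h2 : al < be) (i : ℤ) :
    ∫⁻ ω, returnTime (birth lam be) (death mu al) i ω ∂noiseLaw < ⊤ := by
  have hb := birth_pos hlam hbe
  have hd := death_pos hmu hal
  obtain ⟨V, hV, hVe⟩ := exists_mean_right hal hbe h1
  obtain ⟨U, hU, hUe⟩ := exists_mean_left hlam hmu h2
  have hm : ∀ k, meanHit (birth lam be) (death mu al) i k < ⊤ := fun k => by
    -- Constants may be added to solutions of the first-step equation, so both solutions are
    -- normalised to vanish at i and glued there, where no equation is required.
    refine (meanHit_le hb hd (W := fun k => if i ≤ k then V k - V i else U k - U i) (fun k => ?_)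
      (fun k hk => ?_) (hitProb_eq_one hlam hmu hal hbe h1.le h2.le i k)).trans_lt
      ENNReal.ofReal_lt_top
    · split_ifs with h
      · exact sub_nonneg.2 (hV h)
      · exact sub_nonneg.2 (hU (not_le.1 h).le)
    · rcases lt_or_gt_of_ne hk with h | h
      · rw [if_neg (by omega : ¬ i ≤ k), if_neg (by omega : ¬ i ≤ k - 1)]
        have h3 : (if i ≤ k + 1 then V (k + 1) - V i else U (k + 1) - U i) = U (k + 1) - U i := by
          split_ifs with h4
          · obtain rfl : i = k + 1 := by omega
            simp
          · rfl
        rw [h3]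
        linarith [hUe k]
      · rw [if_pos (by omega : i ≤ k), if_pos (by omega : i ≤ k - 1), if_pos (by omega : i ≤ k + 1)]
        linarith [hVe k]
  rw [lintegral_returnTime hb hd]
  have e := hm (i + 1)
  have e2 := hm (i - 1)
  exact ENNReal.add_lt_top.2 ⟨ENNReal.mul_lt_top ENNReal.ofReal_lt_top
    (ENNReal.add_lt_top.2 ⟨ENNReal.ofReal_lt_top, e⟩), ENNReal.mul_lt_top ENNReal.ofReal_lt_top
    (ENNReal.add_lt_top.2 ⟨ENNReal.ofReal_lt_top, e2⟩)⟩

/-- If one mean return time were finite, the first-step equations with positive weights would spread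
finiteness to every mean hitting time. Their real values would then be a nonnegative solution, which
balanced rates exclude. -/
lemma meanReturn_eq_top (h : lam = mu ∨ al = be) (i : ℤ) :
    ∫⁻ ω, returnTime (birth lam be) (death mu al) i ω ∂noiseLaw = ⊤ := by
  have hb := birth_pos hlam hbe
  have hd := death_pos hmu hal
  by_contra hne
  have hq := fun k => add_pos (hb k) (hd k)
  have hfin : ∀ k, ENNReal.ofReal (birth lam be k / (birth lam be k + death mu al k)) *
      (ENNReal.ofReal (1 / (birth lam be k + death mu al k)) +
        meanHit (birth lam be) (death mu al) i (k + 1)) +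
      ENNReal.ofReal (death mu al k / (birth lam be k + death mu al k)) *
      (ENNReal.ofReal (1 / (birth lam be k + death mu al k)) +
        meanHit (birth lam be) (death mu al) i (k - 1)) ≠ ⊤ →
      meanHit (birth lam be) (death mu al) i (k + 1) ≠ ⊤ ∧
      meanHit (birth lam be) (death mu al) i (k - 1) ≠ ⊤ := fun k hk => by
    have p1 : ENNReal.ofReal (birth lam be k / (birth lam be k + death mu al k)) ≠ 0 :=
      (ENNReal.ofReal_pos.2 (div_pos (hb k) (hq k))).ne'
    have p2 : ENNReal.ofReal (death mu al k / (birth lam be k + death mu al k)) ≠ 0 :=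
      (ENNReal.ofReal_pos.2 (div_pos (hd k) (hq k))).ne'
    constructor
    · intro ht
      rw [ht, add_top, ENNReal.mul_top p1, top_add] at hk
      exact hk rfl
    · intro ht
      rw [ht, add_top, ENNReal.mul_top p2, add_top] at hk
      exact hk rfl
  have h0 : meanHit (birth lam be) (death mu al) i i ≠ ⊤ := by
    have : ∀ ω, passage (birth lam be) (death mu al) (fun _ s => s = i) i ω = 0 := fun ω => by
      refine le_antisymm ((iInf₂_le (f := fun (n : ℕ)
        (_ : jumpChain (birth lam be) (death mu al) i ω n = i) =>
        ENNReal.ofReal (jumpTime (birth lam be) (death mu al) i ω n)) 0 rfl).trans ?_) zero_le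
      simp [jumpTime]
    simp [meanHit, this]
  have h1 : meanHit (birth lam be) (death mu al) i (i + 1) ≠ ⊤ ∧
      meanHit (birth lam be) (death mu al) i (i - 1) ≠ ⊤ :=
    hfin i (by rwa [← lintegral_returnTime hb hd])
  have hstep : ∀ k, k ≠ i → meanHit (birth lam be) (death mu al) i k ≠ ⊤ →
      meanHit (birth lam be) (death mu al) i (k + 1) ≠ ⊤ ∧
      meanHit (birth lam be) (death mu al) i (k - 1) ≠ ⊤ := fun k hk hkt =>
    hfin k (by rwa [← meanHit_eq hb hd hk])
  have hall : ∀ k, meanHit (birth lam be) (death mu al) i k ≠ ⊤ := by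
    have hup : ∀ n : ℕ, meanHit (birth lam be) (death mu al) i (i + n + 1) ≠ ⊤ := fun n => by
      induction n with
      | zero => simpa using h1.1
      | succ n ih =>
        have := (hstep _ (by omega) ih).1
        rwa [show i + ((n + 1 : ℕ) : ℤ) + 1 = i + (n : ℤ) + 1 + 1 by push_cast; ring]
    have hdown : ∀ n : ℕ, meanHit (birth lam be) (death mu al) i (i - n - 1) ≠ ⊤ := fun n => by
      induction n with
      | zero => simpa using h1.2
      | succ n ih =>
        have := (hstep _ (by omega) ih).2
        rwa [show i - ((n + 1 : ℕ) : ℤ) - 1 = i - (n : ℤ) - 1 - 1 by push_cast; ring]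
    intro k
    rcases lt_trichotomy k i with hk | rfl | hk
    · have := hdown (i - k - 1).toNat
      rwa [show i - ((i - k - 1).toNat : ℤ) - 1 = k by omega] at this
    · exact h0
    · have := hup (k - i - 1).toNat
      rwa [show i + ((k - i - 1).toNat : ℤ) + 1 = k by omega] at this
  have hreal : ∀ k, k ≠ i → (birth lam be k + death mu al k) *
      (meanHit (birth lam be) (death mu al) i k).toReal =
      1 + birth lam be k * (meanHit (birth lam be) (death mu al) i (k + 1)).toReal +
      death mu al k * (meanHit (birth lam be) (death mu al) i (k - 1)).toReal := fun k hk => by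
    have h2 := congrArg ENNReal.toReal (meanHit_eq hb hd hk)
    have a1 : ∀ k', ENNReal.ofReal (1 / (birth lam be k + death mu al k)) +
        meanHit (birth lam be) (death mu al) i k' ≠ ⊤ := fun k' =>
      ENNReal.add_ne_top.2 ⟨ENNReal.ofReal_ne_top, hall k'⟩
    rw [ENNReal.toReal_add (ENNReal.mul_ne_top ENNReal.ofReal_ne_top (a1 _))
      (ENNReal.mul_ne_top ENNReal.ofReal_ne_top (a1 _)), ENNReal.toReal_mul, ENNReal.toReal_mul,
      ENNReal.toReal_add ENNReal.ofReal_ne_top (hall _),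
      ENNReal.toReal_add ENNReal.ofReal_ne_top (hall _),
      ENNReal.toReal_ofReal (div_pos (hb k) (hq k)).le,
      ENNReal.toReal_ofReal (div_pos (hd k) (hq k)).le,
      ENNReal.toReal_ofReal (one_div_pos.2 (hq k)).le] at h2
    rw [h2]
    have := (hq k).ne'
    field_simp
    ring
  rcases h with h | h
  · exact no_mean_right hlam h (i := i)
      (W := fun k => (meanHit (birth lam be) (death mu al) i k).toReal)
      (fun k => ENNReal.toReal_nonneg) fun k hk => hreal k hk.ne'
  · exact no_mean_left hal h (i := i)
      (W := fun k => (meanHit (birth lam be) (death mu al) i k).toReal)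
      (fun k => ENNReal.toReal_nonneg) fun k hk => hreal k hk.ne

theorem isPositiveRecurrent_iff :
    IsPositiveRecurrent (birth lam be) (death mu al) ↔ lam < mu ∧ al < be := by
  constructor
  · rintro ⟨h1, h2⟩
    obtain ⟨h3, h4⟩ := (isRecurrent_iff hlam hmu hal hbe).1 h1
    constructor
    · exact lt_of_le_of_ne h3 fun h =>
        (h2 0).ne (meanReturn_eq_top hlam hmu hal hbe (Or.inl h) 0)
    · exact lt_of_le_of_ne h4 fun h =>
        (h2 0).ne (meanReturn_eq_top hlam hmu hal hbe (Or.inr h) 0)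
  · rintro ⟨h1, h2⟩
    exact ⟨isRecurrent_of_le hlam hmu hal hbe h1.le h2.le, meanReturn_lt_top hlam hmu hal hbe h1 h2⟩

theorem isNullRecurrent_iff : IsNullRecurrent (birth lam be) (death mu al) ↔
    (lam ≤ mu ∧ al ≤ be) ∧ (lam = mu ∨ al = be) := by
  constructor
  · rintro ⟨h1, h2⟩
    have h3 := (isRecurrent_iff hlam hmu hal hbe).1 h1
    refine ⟨h3, ?_⟩
    by_contra! hne
    exact (meanReturn_lt_top hlam hmu hal hbe (lt_of_le_of_ne h3.1 hne.1)
      (lt_of_le_of_ne h3.2 hne.2) 0).ne (h2 0)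
  · rintro ⟨h1, h2⟩
    exact ⟨isRecurrent_of_le hlam hmu hal hbe h1.1 h1.2, meanReturn_eq_top hlam hmu hal hbe h2⟩

end Classification


/-! ### Invariant distributions -/

lemma integral_exp_mul_const (q t : ℝ) :
    ∫ r in (0 : ℝ)..t, Real.exp (-(q * (t - r))) * q = 1 - Real.exp (-(q * t)) := by
  have hderiv : ∀ r, HasDerivAt (fun r => Real.exp (-(q * (t - r))))
      (Real.exp (-(q * (t - r))) * q) r := by
    intro r
    have h1 : HasDerivAt (fun r => -(q * (t - r))) q r := by
      have := (((hasDerivAt_id r).const_sub t).const_mul q).neg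
      simpa [Pi.neg_def] using this
    exact h1.exp
  rw [intervalIntegral.integral_eq_sub_of_hasDerivAt (fun r _ => hderiv r)
    (Continuous.intervalIntegrable (by fun_prop) _ _)]
  simp

namespace BoundedRates

variable {b d : ℤ → ℝ} {M : ℝ} (h : BoundedRates b d M)
include h

/-- The process does not explode. -/
lemma stateIn_univ (i : ℤ) {t : ℝ} (ht : 0 ≤ t) :
    noiseLaw.real (stateIn b d i t Set.univ) = 1 := by
  have hm : ∀ k, Measurable fun s => noiseLaw.real (stateIn b d k s Set.univ) := fun k =>
    (measurable_stateIn b d k Set.univ).ennreal_toReal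
  -- The defect 1 - P(t) solves the backward equation without source, and it is bounded.
  have hz := backward_unique h.birth_pos h.death_pos h.birth_le h.death_le
    (G := fun i t => 1 - noiseLaw.real (stateIn b d i t Set.univ)) (T := t) (K := 1) (c := 1) le_rfl
    (fun i r _ => by
      have h0 : 0 ≤ noiseLaw.real (stateIn b d i r Set.univ) := measureReal_nonneg
      have h1 : noiseLaw.real (stateIn b d i r Set.univ) ≤ 1 := measureReal_le_one
      rw [abs_of_nonneg (by linarith)]
      simp) ?_ i t ⟨ht, le_rfl⟩
  · linarith
  · intro i r hr
    have hb := h.birth_pos i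
    have hd := h.death_pos i
    have i1 : IntervalIntegrable (fun s => Real.exp (-((b i + d i) * (r - s))) * (b i + d i))
        volume 0 r := Continuous.intervalIntegrable (by fun_prop) _ _
    have i2 : IntervalIntegrable (fun s => Real.exp (-((b i + d i) * (r - s))) *
        (b i * noiseLaw.real (stateIn b d (i + 1) s Set.univ) +
          d i * noiseLaw.real (stateIn b d (i - 1) s Set.univ))) volume 0 r := by
      refine i1.mono_fun (by have := hm (i + 1); have := hm (i - 1); fun_prop)
        (Eventually.of_forall fun s => ?_)
      have p1 : 0 ≤ noiseLaw.real (stateIn b d (i + 1) s Set.univ) := measureReal_nonneg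
      have p2 : 0 ≤ noiseLaw.real (stateIn b d (i - 1) s Set.univ) := measureReal_nonneg
      have p3 : noiseLaw.real (stateIn b d (i + 1) s Set.univ) ≤ 1 := measureReal_le_one
      have p4 : noiseLaw.real (stateIn b d (i - 1) s Set.univ) ≤ 1 := measureReal_le_one
      beta_reduce
      rw [Real.norm_of_nonneg (by positivity), Real.norm_of_nonneg (by positivity)]
      gcongr
      · exact mul_le_of_le_one_right hb.le p3
      · exact mul_le_of_le_one_right hd.le p4
    have e := integral_exp_mul_const (b i + d i) r
    rw [stateIn_backward h.birth_pos h.death_pos i hr.1 Set.univ]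
    simp only [Set.mem_univ, if_true, one_mul]
    rw [← sub_sub, ← e, ← intervalIntegral.integral_sub i1 i2]
    refine intervalIntegral.integral_congr fun s _ => ?_
    ring

lemma hasSum_transProb (i : ℤ) {t : ℝ} (ht : 0 ≤ t) :
    HasSum (fun j => transProb b d i j t) 1 := by
  have hU : stateIn b d i t Set.univ = ⋃ j, stateAt b d i t j := by
    ext ω
    simp only [stateIn, stateAt, Set.mem_iUnion, Set.mem_ofPred_eq, Set.mem_univ, and_true]
    exact ⟨fun ⟨n, h1, h2⟩ => ⟨_, n, h1, h2, rfl⟩, fun ⟨_, n, h1, h2, _⟩ => ⟨n, h1, h2⟩⟩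
  have hdisj : Pairwise (Function.onFun (AEDisjoint noiseLaw) (stateAt b d i t)) := by
    intro j k hjk
    refine measure_eq_zero_iff_ae_notMem.2 ?_
    filter_upwards [ae_noise_nonneg] with ω hω
    rintro ⟨⟨n, h1, h2, h3⟩, ⟨m, h4, h5, h6⟩⟩
    have hmono := jumpTime_mono h.birth_pos h.death_pos i hω
    rcases lt_trichotomy n m with hnm | hnm | hnm
    · exact (h2.trans_le (hmono hnm)).not_ge h4
    · subst hnm
      exact hjk (h3.symm.trans h6)
    · exact (h5.trans_le (hmono hnm)).not_ge h1
  have h1 : ∑' j, noiseLaw (stateAt b d i t j) = 1 := by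
    rw [← measure_iUnion₀ hdisj fun j => (measurableSet_stateIn b d i t {j}).nullMeasurableSet,
      ← hU]
    have := h.stateIn_univ i ht
    rw [measureReal_def] at this
    exact (ENNReal.toReal_eq_one_iff _).1 this
  have h2 := ENNReal.hasSum_toReal (f := fun j => noiseLaw (stateAt b d i t j)) (by simp [h1])
  rw [← ENNReal.tsum_toReal_eq fun j => measure_ne_top _ _, h1] at h2
  exact h2

variable {K c : ℝ} (hc : 1 ≤ c) (hgrow : ∀ i, (√(potential b d i))⁻¹ ≤ K * c ^ i.natAbs)
include hc hgrow

/-- Detailed balance. -/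
lemma potential_mul_transProb (i j : ℤ) {t : ℝ} (ht : 0 ≤ t) :
    potential b d i * transProb b d i j t = potential b d j * transProb b d j i t := by
  rw [h.jacobiModel.transProb_eq_spectralProb hc hgrow i j ht,
    h.jacobiModel.transProb_eq_spectralProb hc hgrow j i ht]
  have hs : IsSelfAdjoint (JacobiModel.semigroup h.jacobi t) := by
    rw [h.jacobiModel.semigroup_eq_cfc]
    exact IsSelfAdjoint.cfc
  rw [JacobiModel.spectralProb, JacobiModel.spectralProb, JacobiModel.re_inner_symm hs]
  ring

/-- Detailed balance turns the sum over starting states into a sum over final states, which is 1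
because the process does not explode. -/
lemma isInvariantDistribution_potential {m : ℝ} (hm : 0 ≤ m)
    (hs : HasSum (fun n => m * potential b d n) 1) :
    IsInvariantDistribution b d fun n => m * potential b d n := by
  refine ⟨fun n => mul_nonneg hm (h.potential_pos n).le, hs, fun t ht j => ?_⟩
  have h1 := (h.hasSum_transProb j ht).mul_left (m * potential b d j)
  rw [mul_one] at h1
  refine h1.congr_fun fun i => ?_
  rw [mul_assoc, h.potential_mul_transProb hc hgrow i j ht, mul_assoc]

/-- Differentiate pP(t) = p at t = 0. The difference quotients of the transition functions are
bounded by 2M uniformly in the starting state, so summability of p justifies differentiation under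
the sum. -/
lemma invariant_balance {p : ℤ → ℝ} (hp : IsInvariantDistribution b d p) (j : ℤ) :
    p (j - 1) * b (j - 1) - p j * (b j + d j) + p (j + 1) * d (j + 1) = 0 := by
  set S := JacobiModel.spectralProb b d h.jacobi (BoundedRates.basisVec b d) with hS
  have hM : 0 < M := (h.birth_pos 0).trans_le (h.birth_le 0)
  have hPS : ∀ i {t : ℝ}, 0 ≤ t → transProb b d i j t = S i j t := fun i t ht =>
    h.jacobiModel.transProb_eq_spectralProb hc hgrow i j ht
  have hder : ∀ i t, HasDerivAt (S i j) (b i * S (i + 1) j t - (b i + d i) * S i j t +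
      d i * S (i - 1) j t) t := fun i t => h.jacobiModel.hasDerivAt_spectralProb i j t
  have h0 : ∀ i, S i j 0 = if i = j then 1 else 0 := fun i => h.jacobiModel.spectralProb_zero i j
  have h01 : ∀ i {t : ℝ}, 0 ≤ t → 0 ≤ S i j t ∧ S i j t ≤ 1 := fun i t ht => by
    rw [← hPS i ht]
    exact ⟨measureReal_nonneg, measureReal_le_one⟩
  have hdb : ∀ i, ∀ t ∈ Set.Ici (0 : ℝ), ‖b i * S (i + 1) j t - (b i + d i) * S i j t +
      d i * S (i - 1) j t‖ ≤ 2 * M := fun i t ht => by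
    obtain ⟨a1, a2⟩ := h01 i ht
    obtain ⟨a3, a4⟩ := h01 (i + 1) ht
    obtain ⟨a5, a6⟩ := h01 (i - 1) ht
    have hb := h.birth_pos i
    have hd := h.death_pos i
    have hbM := h.birth_le i
    have hdM := h.death_le i
    have k1 := mul_le_of_le_one_right hb.le a2
    have k2 := mul_le_of_le_one_right hb.le a4
    have k3 := mul_le_of_le_one_right hd.le a2
    have k4 := mul_le_of_le_one_right hd.le a6
    have l1 := mul_nonneg hb.le a1
    have l2 := mul_nonneg hb.le a3
    have l3 := mul_nonneg hd.le a1
    have l4 := mul_nonneg hd.le a5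
    rw [Real.norm_eq_abs, abs_le]
    constructor <;> linarith
  have hlip : ∀ i, ∀ t, 0 < t → ‖t⁻¹ • (S i j (0 + t) - S i j 0)‖ ≤ 2 * M := fun i t ht => by
    have := (convex_Ici (0 : ℝ)).norm_image_sub_le_of_norm_hasDerivWithin_le
      (fun r _ => (hder i r).hasDerivWithinAt) (hdb i) (Set.self_mem_Ici (a := (0 : ℝ)))
      (Set.mem_Ici.2 ht.le)
    rw [zero_add, norm_smul, norm_inv, Real.norm_of_nonneg ht.le, inv_mul_le_iff₀ ht]
    rwa [sub_zero, Real.norm_of_nonneg ht.le, mul_comm] at this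
  set g : ℤ → ℝ := fun i => b i * S (i + 1) j 0 - (b i + d i) * S i j 0 + d i * S (i - 1) j 0
    with hg
  have hlim : Tendsto (fun t => ∑' i, p i * (t⁻¹ • (S i j (0 + t) - S i j 0))) (𝓝[>] 0)
      (𝓝 (∑' i, p i * g i)) := by
    refine tendsto_tsum_of_dominated_convergence (bound := fun i => p i * (2 * M))
      (hp.2.1.summable.mul_right _) (fun i => ?_) ?_
    · exact (hder i 0).tendsto_slope_zero_right.const_mul _
    · filter_upwards [self_mem_nhdsWithin] with t ht i
      rw [norm_mul, Real.norm_of_nonneg (hp.1 i)]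
      exact mul_le_mul_of_nonneg_left (hlip i t ht) (hp.1 i)
  have hzero : ∀ t : ℝ, 0 < t → ∑' i, p i * (t⁻¹ • (S i j (0 + t) - S i j 0)) = 0 := by
    intro t ht
    have h1 := hp.2.2 t ht.le j
    have h2 := hp.2.2 0 le_rfl j
    have h3 := (h1.sub h2).mul_left t⁻¹
    rw [sub_self, mul_zero] at h3
    refine Eq.trans (tsum_congr fun i => ?_) h3.tsum_eq
    rw [hPS i ht.le, hPS i le_rfl, zero_add, smul_eq_mul]
    ring
  have htsum : ∑' i, p i * g i = 0 := by
    refine tendsto_nhds_unique hlim (tendsto_const_nhds.congr' ?_)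
    filter_upwards [self_mem_nhdsWithin] with t ht
    exact (hzero t ht).symm
  have s1 : HasSum (fun i => p i * (b i * S (i + 1) j 0)) (p (j - 1) * b (j - 1)) := by
    convert! hasSum_single (j - 1) (f := fun i => p i * (b i * S (i + 1) j 0)) ?_ using 1
    · simp [h0]
    · intro i hi
      rw [h0, if_neg (by omega)]
      ring
  have s2 : HasSum (fun i => p i * ((b i + d i) * S i j 0)) (p j * (b j + d j)) := by
    convert! hasSum_single j (f := fun i => p i * ((b i + d i) * S i j 0)) ?_ using 1
    · simp [h0]
    · intro i hi
      rw [h0, if_neg hi]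
      ring
  have s3 : HasSum (fun i => p i * (d i * S (i - 1) j 0)) (p (j + 1) * d (j + 1)) := by
    convert! hasSum_single (j + 1) (f := fun i => p i * (d i * S (i - 1) j 0)) ?_ using 1
    · simp [h0]
    · intro i hi
      rw [h0, if_neg (by omega)]
      ring
  have s := (s1.sub s2).add s3
  refine s.tsum_eq.symm.trans (Eq.trans (tsum_congr fun i => ?_) htsum)
  rw [hg]
  ring

/-- The balance equation says that the flux p_j b_j - p_{j+1} d_{j+1} does not depend on j. It tends
to 0 because p is summable and the rates are bounded, so it is 0 and p is a multiple of π. -/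
lemma IsInvariantDistribution.eq_potential {p : ℤ → ℝ} (hp : IsInvariantDistribution b d p)
    (j : ℤ) : p j = p 0 * potential b d j := by
  have hbal := h.invariant_balance hc hgrow hp
  have hflux : ∀ j, p j * b j - p (j + 1) * d (j + 1) = p 0 * b 0 - p (0 + 1) * d (0 + 1) := by
    intro j
    induction j using Int.induction_on with
    | zero => rfl
    | succ i ih =>
      rw [← ih]
      have := hbal (i + 1)
      rw [add_sub_cancel_right] at this
      linarith
    | pred i ih =>
      rw [← ih]
      have := hbal (-i)
      rw [sub_add_cancel]
      linarith
  have hlim : Tendsto (fun n : ℕ => p n) atTop (𝓝 0) :=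
    (hp.2.1.summable.comp_injective Nat.cast_injective).tendsto_atTop_zero
  have hlim1 : Tendsto (fun n : ℕ => M * p n + M * p ((n + 1 : ℕ) : ℤ)) atTop (𝓝 0) := by
    simpa using (hlim.const_mul M).add (((tendsto_add_atTop_iff_nat 1).2 hlim).const_mul M)
  have hF : p 0 * b 0 - p (0 + 1) * d (0 + 1) = 0 := by
    refine abs_nonpos_iff.1 (ge_of_tendsto' hlim1 fun n => ?_)
    rw [← hflux n]
    have k1 := mul_le_mul_of_nonneg_left (h.birth_le n) (hp.1 n)
    have k2 := mul_le_mul_of_nonneg_left (h.death_le (n + 1)) (hp.1 (n + 1))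
    have k3 := mul_nonneg (hp.1 n) (h.birth_pos n).le
    have k4 := mul_nonneg (hp.1 (n + 1)) (h.death_pos (n + 1)).le
    push_cast
    rw [abs_le]
    constructor <;> nlinarith
  have hrec : ∀ j, p (j + 1) * d (j + 1) = p j * b j := fun j => by
    have := hflux j
    rw [hF] at this
    linarith
  have h00 : potential b d 0 = 1 := by
    change ∏ m ∈ Finset.range 0, b (m : ℤ) / d ((m : ℤ) + 1) = 1
    simp
  induction j using Int.induction_on with
  | zero => rw [h00, mul_one]
  | succ i ih =>
    refine mul_right_cancel₀ (h.death_pos (i + 1)).ne' ?_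
    rw [hrec, ih, mul_assoc, mul_assoc, h.potential_succ]
  | pred i ih =>
    refine mul_right_cancel₀ (h.birth_pos (-i - 1)).ne' ?_
    have e1 := hrec (-i - 1)
    have e2 := h.potential_succ (-i - 1)
    rw [sub_add_cancel] at e1 e2
    rw [← e1, ih, mul_assoc, mul_assoc, e2]

end BoundedRates

/-! ### The invariant distribution with two regimes -/

section Rates

variable {lam mu al be : ℝ} (hlam : 0 < lam) (hmu : 0 < mu) (hal : 0 < al) (hbe : 0 < be)
include hlam hmu hal hbe

lemma hasSum_potential (h1 : lam < mu) (h2 : al < be) :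
    HasSum (fun n => zeroMass lam mu al be * potential (birth lam be) (death mu al) n) 1 := by
  have s1 : HasSum (fun n : ℕ => potential (birth lam be) (death mu al) (n : ℤ))
      (1 - lam / mu)⁻¹ := by
    simp only [potential_ofNat]
    exact hasSum_geometric_of_lt_one (by positivity) ((div_lt_one hmu).2 h1)
  have s2 : HasSum (fun n : ℕ => potential (birth lam be) (death mu al) (-((n : ℤ) + 1)))
      (mu / be * (1 - al / be)⁻¹) := by
    simp only [← Int.negSucc_eq, potential_negSucc]
    exact (hasSum_geometric_of_lt_one (by positivity) ((div_lt_one hbe).2 h2)).mul_left _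
  convert! (s1.of_nat_of_neg_add_one s2).mul_left (zeroMass lam mu al be) using 1
  have k1 : mu - lam ≠ 0 := (sub_pos.2 h1).ne'
  have k2 : be - al ≠ 0 := (sub_pos.2 h2).ne'
  have k3 : be - al + mu - lam ≠ 0 := by linarith
  have e1 : 1 - lam / mu = (mu - lam) / mu := by field_simp
  have e2 : 1 - al / be = (be - al) / be := by field_simp
  rw [e1, e2, zeroMass]
  field_simp
  ring

theorem isInvariantDistribution_iff (h1 : lam < mu) (h2 : al < be) (p : ℤ → ℝ) :
    IsInvariantDistribution (birth lam be) (death mu al) p ↔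
      p = fun n => zeroMass lam mu al be * potential (birth lam be) (death mu al) n := by
  have h := boundedRates hlam hmu hal hbe
  obtain ⟨K, c, hc, hgrow⟩ := potential_growth hlam hmu hal hbe
  have hs := hasSum_potential hlam hmu hal hbe h1 h2
  constructor
  · intro hp
    have heq : p = fun n => p 0 * potential (birth lam be) (death mu al) n :=
      funext fun j => BoundedRates.IsInvariantDistribution.eq_potential h hc hgrow hp j
    have hs' := hp.2.1
    rw [heq] at hs'
    have hm : zeroMass lam mu al be ≠ 0 := by
      intro h0
      simp only [h0, zero_mul] at hs
      exact zero_ne_one (hasSum_zero.unique hs)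
    have e := (hs'.mul_left (zeroMass lam mu al be)).unique
      ((hs.mul_left (p 0)).congr_fun ?_)
    · have e' : p 0 = zeroMass lam mu al be := by linarith
      rw [heq, e']
    · intro n
      ring
  · rintro rfl
    refine h.isInvariantDistribution_potential hc hgrow ?_ hs
    have k1 := sub_pos.2 h1
    have k2 := sub_pos.2 h2
    have k3 : 0 < be - al + mu - lam := by linarith
    exact div_nonneg (mul_pos k2 k1).le (mul_pos hmu k3).le

end Rates

end BilateralBD
end

open BilateralBD in
theorem mainTheorem8 (lam mu al be : ℝ)
    (hlam : 0 < lam) (hmu : 0 < mu) (hal : 0 < al) (hbe : 0 < be) :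
    -- the polynomials generated by the three-term recurrence relation
    (∃! Q : Fin 2 → ℤ → ℝ[X], IsGeneratedFamily (birth lam be) (death mu al) Q) ∧
    (∀ Q : Fin 2 → ℤ → ℝ[X], IsGeneratedFamily (birth lam be) (death mu al) Q →
      (∀ (n : ℕ) (x : ℝ),
        (Q 0 n).eval x = (mu / lam) ^ ((n : ℝ) / 2) *
          (Chebyshev.U ℝ n).eval ((lam + mu - x) / (2 * √(lam * mu))) ∧
        (Q 0 (-(n : ℤ) - 1)).eval x = -(be / al) ^ (((n : ℝ) + 1) / 2) *
          (Chebyshev.U ℝ ((n : ℤ) - 1)).eval ((al + be - x) / (2 * √(al * be))) ∧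
        (Q 1 n).eval x = -(mu / lam) ^ (((n : ℝ) + 1) / 2) *
          (Chebyshev.U ℝ ((n : ℤ) - 1)).eval ((lam + mu - x) / (2 * √(lam * mu))) ∧
        (Q 1 (-(n : ℤ) - 1)).eval x = (be / al) ^ ((n : ℝ) / 2) *
          (Chebyshev.U ℝ n).eval ((al + be - x) / (2 * √(al * be)))) ∧
      -- the spectral matrix, generic rates
      (¬ (al = mu ∧ be = lam) →
        -- case 1 (a)
        ((Set.Icc (edgeMinus lam mu) (edgePlus lam mu) ∩
            Set.Icc (edgeMinus al be) (edgePlus al be) = ∅ ∧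
            edgeMinus lam mu < edgeMinus al be) →
          HasSpectralMatrix lam mu al be Q fun x =>
            if x ∈ Set.Icc (edgeMinus lam mu) (edgePlus lam mu) then
              sigmaDensity lam mu al be 1 x
            else if x ∈ Set.Icc (edgeMinus al be) (edgePlus al be) then
              tauDensity lam mu al be (-1) x
            else 0) ∧
        -- case 1 (b)
        ((Set.Icc (edgeMinus lam mu) (edgePlus lam mu) ∩
            Set.Icc (edgeMinus al be) (edgePlus al be) = ∅ ∧
            edgeMinus al be < edgeMinus lam mu) →
          HasSpectralMatrix lam mu al be Q fun x =>
            if x ∈ Set.Icc (edgeMinus al be) (edgePlus al be) then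
              tauDensity lam mu al be 1 x
            else if x ∈ Set.Icc (edgeMinus lam mu) (edgePlus lam mu) then
              sigmaDensity lam mu al be (-1) x
            else 0) ∧
        -- case 2 (a)
        (Set.Icc (edgeMinus al be) (edgePlus al be) ⊆
            Set.Icc (edgeMinus lam mu) (edgePlus lam mu) →
          HasSpectralMatrix lam mu al be Q fun x =>
            if x ∈ Set.Icc (edgeMinus lam mu) (edgeMinus al be) then
              sigmaDensity lam mu al be 1 x
            else if x ∈ Set.Icc (edgeMinus al be) (edgePlus al be) then
              bothDensity lam mu al be x
            else if x ∈ Set.Icc (edgePlus al be) (edgePlus lam mu) then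
              sigmaDensity lam mu al be (-1) x
            else 0) ∧
        -- case 2 (b)
        (Set.Icc (edgeMinus lam mu) (edgePlus lam mu) ⊆
            Set.Icc (edgeMinus al be) (edgePlus al be) →
          HasSpectralMatrix lam mu al be Q fun x =>
            if x ∈ Set.Icc (edgeMinus al be) (edgeMinus lam mu) then
              tauDensity lam mu al be 1 x
            else if x ∈ Set.Icc (edgeMinus lam mu) (edgePlus lam mu) then
              bothDensity lam mu al be x
            else if x ∈ Set.Icc (edgePlus lam mu) (edgePlus al be) then
              tauDensity lam mu al be (-1) x
            else 0) ∧
        -- case 3 (a)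
        ((edgeMinus lam mu < edgeMinus al be ∧ edgeMinus al be ≤ edgePlus lam mu ∧
            edgePlus lam mu < edgePlus al be) →
          HasSpectralMatrix lam mu al be Q fun x =>
            if x ∈ Set.Icc (edgeMinus lam mu) (edgeMinus al be) then
              sigmaDensity lam mu al be 1 x
            else if x ∈ Set.Icc (edgeMinus al be) (edgePlus lam mu) then
              bothDensity lam mu al be x
            else if x ∈ Set.Icc (edgePlus lam mu) (edgePlus al be) then
              tauDensity lam mu al be (-1) x
            else 0) ∧
        -- case 3 (b)
        ((edgeMinus al be < edgeMinus lam mu ∧ edgeMinus lam mu ≤ edgePlus al be ∧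
            edgePlus al be < edgePlus lam mu) →
          HasSpectralMatrix lam mu al be Q fun x =>
            if x ∈ Set.Icc (edgeMinus al be) (edgeMinus lam mu) then
              tauDensity lam mu al be 1 x
            else if x ∈ Set.Icc (edgeMinus lam mu) (edgePlus al be) then
              bothDensity lam mu al be x
            else if x ∈ Set.Icc (edgePlus al be) (edgePlus lam mu) then
              sigmaDensity lam mu al be (-1) x
            else 0)) ∧
      -- the spectral matrix when the rates do not depend on the state
      ((al = mu ∧ be = lam) →
        HasSpectralMatrix lam mu al be Q fun x =>
          if x ∈ Set.Icc (edgeMinus lam mu) (edgePlus lam mu) then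
            (1 / (Real.pi * rootMinus lam mu x)) •
              !![1, (lam + mu - x) / (2 * mu); (lam + mu - x) / (2 * mu), lam / mu]
          else 0) ∧
      -- Stieltjes transforms and moments of order `-1` of the spectral matrix
      (∀ Ψ : Fin 2 → Fin 2 → SignedMeasure ℝ,
        IsSpectralMatrix (birth lam be) (death mu al) Q Ψ →
        (∀ z : ℝ, z < 0 →
          (∀ k l, (Ψ k l).Integrable fun x => 1 / (x - z)) ∧
          ∫ᵛ x, 1 / (x - z) ∂•(Ψ 0 0) =
            2 * al / (al * rootPlus lam mu z + mu * rootPlus al be z + (mu - al) * z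
              + al * lam - be * mu) ∧
          ∫ᵛ x, 1 / (x - z) ∂•(Ψ 0 1) =
            be / mu * ((lam + mu - z - rootPlus lam mu z) /
              (be * rootPlus lam mu z + lam * rootPlus al be z + (be - lam) * z
                + al * lam - be * mu)) ∧
          ∫ᵛ x, 1 / (x - z) ∂•(Ψ 1 1) =
            be / mu * (2 * lam /
              (be * rootPlus lam mu z + lam * rootPlus al be z + (be - lam) * z
                + al * lam - be * mu)) ∧
          (denom lam mu al be z ≠ 0 → ∀ k l,
            ∫ᵛ x, 1 / (x - z) ∂•(Ψ k l) =
              (pMat lam mu al be z k l + qMat lam mu al be z k l * rootPlus lam mu z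
                + rMat lam mu al be z k l * rootPlus al be z
                + sMat lam mu al be z k l * (rootPlus lam mu z * rootPlus al be z)) /
              denom lam mu al be z)) ∧
        ((mu < lam ∨ be < al) →
          ∫⁻ x, (ENNReal.ofReal x)⁻¹ ∂(Ψ 0 0).variation < ⊤ ∧
          ∫⁻ x, (ENNReal.ofReal x)⁻¹ ∂(Ψ 1 1).variation < ⊤) ∧
        ((lam ≤ mu ∧ al ≤ be) →
          ∫⁻ x, (ENNReal.ofReal x)⁻¹ ∂(Ψ 0 0).variation = ⊤ ∧
          ∫⁻ x, (ENNReal.ofReal x)⁻¹ ∂(Ψ 1 1).variation = ⊤))) ∧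
    -- the other form of the condition for an atom at `zeta`
    (ZetaCondition lam mu al be ↔
      ((al ≠ mu ∧ √(lam / mu) < |(be - lam) / (al - mu)| ∧
          |(be - lam) / (al - mu)| < √(be / al)) ∧
        (lam < be ∨ (al < mu ∧ be < lam)))) ∧
    -- classification
    (IsTransient (birth lam be) (death mu al) ↔ mu < lam ∨ be < al) ∧
    (IsRecurrent (birth lam be) (death mu al) ↔ lam ≤ mu ∧ al ≤ be) ∧
    (IsPositiveRecurrent (birth lam be) (death mu al) ↔ lam < mu ∧ al < be) ∧
    (IsNullRecurrent (birth lam be) (death mu al) ↔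
      (lam ≤ mu ∧ al ≤ be) ∧ (lam = mu ∨ al = be)) ∧
    -- potential coefficients and invariant distribution
    (∀ n : ℕ, potential (birth lam be) (death mu al) n = (lam / mu) ^ n ∧
      potential (birth lam be) (death mu al) (-(n : ℤ) - 1) = mu / be * (al / be) ^ n) ∧
    (lam < mu → al < be → ∀ p : ℤ → ℝ,
      IsInvariantDistribution (birth lam be) (death mu al) p ↔
        p = fun n => zeroMass lam mu al be * potential (birth lam be) (death mu al) n) := by
  refine ⟨existsUnique_generatedFamily hlam hal, fun Q hQ => ⟨fun n x =>
    generatedFamily_chebyshev hlam hmu hal hbe hQ n x, fun hgen =>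
    ⟨hasSpectralMatrix_disjoint_left hlam hmu hal hbe hQ hgen,
      hasSpectralMatrix_disjoint_right hlam hmu hal hbe hQ hgen,
      hasSpectralMatrix_nested_left hlam hmu hal hbe hQ hgen,
      hasSpectralMatrix_nested_right hlam hmu hal hbe hQ hgen,
      hasSpectralMatrix_overlap_left hlam hmu hal hbe hQ hgen,
      hasSpectralMatrix_overlap_right hlam hmu hal hbe hQ hgen⟩,
    hasSpectralMatrix_special hlam hmu hal hbe hQ, fun Ψ hΨ => ?_⟩,
    zetaCondition_iff_sqrt hlam hmu hal hbe, isTransient_iff hlam hmu hal hbe,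
    isRecurrent_iff hlam hmu hal hbe, isPositiveRecurrent_iff hlam hmu hal hbe,
    isNullRecurrent_iff hlam hmu hal hbe, fun n => ⟨potential_ofNat n, ?_⟩,
    isInvariantDistribution_iff hlam hmu hal hbe⟩
  · obtain ⟨K, c, hc, hgrow⟩ := potential_growth hlam hmu hal hbe
    -- Uniqueness replaces an arbitrary spectral matrix by the one built from spectral measures, for
    -- which the transforms are known.
    obtain rfl := IsSpectralMatrix.unique hQ
      (fun i => ((boundedRates hlam hmu hal hbe).potential_pos i).ne') hΨ
      ((boundedRates hlam hmu hal hbe).jacobiModel.isSpectralMatrix_specMat hQ hc hgrow)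
    refine ⟨fun z hz => ?_, moments_lt_top hlam hmu hal hbe, moments_eq_top hlam hmu hal hbe⟩
    obtain ⟨h1, h2, h3, h4, h5, -⟩ := stieltjes_formulas hlam hmu hal hbe hz
    exact ⟨h1, h2, h3, h4, h5⟩
  · rw [← potential_negSucc, Int.negSucc_eq, neg_add']
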